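/- Asynchronous majority dynamics on a graph $G=(V,E)$ with $|V|=n$ and parameter $\delta\in(0,1/2)$ is defined as follows. Every node $v$ has a private signal $X(v)\in\{0,1\}$; the signals are independent and $\Pr(X(v)=1)=1/2+\delta$. Opinion $1$ is the correct one. Initially no node has announced an opinion: $C^0(v)=\perp$ for all $v$. In each round $t\ge 1$ a node $v^t$ is selected uniformly at random from $V$, independently of everything else. If $N_i^{t-1}(v)$ denotes the number of neighbours $w$ of $v$ with $C^{t-1}(w)=i$, then $C^t(v^t)=1$ if $N_1^{t-1}(v^t)>N_0^{t-1}(v^t)$, $C^t(v^t)=0$ if $N_1^{t-1}(v^t)<N_0^{t-1}(v^t)$, $C^t(v^t)=X(v^t)$ if $N_1^{t-1}(v^t)=N_0^{t-1}(v^t)$, and $C^t(v)=C^{t-1}(v)$ for $v\ne v^t$. The dynamics has terminated at time $T$ if no node would change its announcement if it were selected in the next round. The binomial random graph $\mathcal G(n,p)$ has node set $[n]$, and each pair of nodes is an edge independently with probability $p$; the graph, the signals and the selected nodes are independent. **Theorem.** There is an absolute constant $K>0$ such that the following holds. Let $\delta\in(0,1/10]$, let $\omega'=\omega'(n)$ be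 any function with $\omega'\to\infty$ and $\omega'=o(\log\log n)$ as $n\to\infty$, and let $p=p(n)\in[0,1]$ satisfy $$\frac{\log n+\omega'}{n}\le p\le\frac{\omega'\log n}{n}$$ for all sufficiently large $n$. Then, with probability tending to $1$ as $n\to\infty$, the asynchronous majority dynamics on $\mathcal G(n,p)$ terminates, with all nodes announcing the correct opinion, after at most $$K\,\frac{n(\log n)^2}{\log\log n}$$ rounds. -/

import Mathlib

open MeasureTheory ProbabilityTheory Filter Topology Asymptotics

namespace MajorityDynamics

noncomputable section

/-- An assignment of public announcements to the nodes: `none` is "no announcement yet" (`⊥`),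
`some true` is the correct opinion `1`, `some false` is the incorrect opinion `0`. -/
abbrev Announcements (V : Type*) := V → Option Bool

/-- `N_i(v)`: the number of neighbours of `v` whose current announcement is `i`. -/
def neighbourCount {V : Type*} (G : SimpleGraph V) (c : Announcements V) (i : Option Bool)
    (v : V) : ℕ :=
  Set.ncard {w : V | G.Adj v w ∧ c w = i}

/-- The opinion that `v` announces when it is selected: the majority opinion among the current
announcements of its neighbours, a tie being broken by the private signal `X v`. -/
def majorityOpinion {V : Type*} (G : SimpleGraph V) (X : V → Bool) (c : Announcements V)
    (v : V) : Bool :=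
  if neighbourCount G c (some false) v < neighbourCount G c (some true) v then true
  else if neighbourCount G c (some true) v < neighbourCount G c (some false) v then false
  else X v

/-- One round, in which the node `v` is selected: only the announcement of `v` is updated. -/
def step {V : Type*} [DecidableEq V] (G : SimpleGraph V) (X : V → Bool) (c : Announcements V)
    (v : V) : Announcements V :=
  Function.update c v (some (majorityOpinion G X c v))

/-- The announcements `C^t` after `t` rounds, on the graph `G`, with private signals `X`, when
`s 0, s 1, s 2, …` are the nodes selected in rounds `1, 2, 3, …`. -/
def announcement {V : Type*} [DecidableEq V] (G : SimpleGraph V) (X : V → Bool) (s : ℕ → V) :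
    ℕ → Announcements V
  | 0 => fun _ => none
  | t + 1 => step G X (announcement G X s t) (s t)

/-- The dynamics has terminated: no node would change its announcement if it were selected. -/
def IsTerminal {V : Type*} [DecidableEq V] (G : SimpleGraph V) (X : V → Bool)
    (c : Announcements V) : Prop :=
  ∀ v, step G X c v = c

/-- The probability `1/2 + δ` that a private signal is correct. -/
def correctProb (δ : Set.Ioo (0 : ℝ) (1 / 2)) : unitInterval :=
  ⟨1 / 2 + δ, by have := δ.2.1; linarith, by have := δ.2.2; linarith⟩

/-- The law of the private signals: independent, each correct with probability `1/2 + δ`. -/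
def signalLaw (n : ℕ) (δ : Set.Ioo (0 : ℝ) (1 / 2)) : Measure (Fin n → Bool) :=
  Measure.pi fun _ => bernoulliMeasure true false (correctProb δ)

/-- The law of the sequence of selected nodes: independent and uniform on the `n` nodes.
(If `n = 0` there is no node to select and no such sequence, and the value is the zero measure.) -/
def selectionLaw : (n : ℕ) → Measure (ℕ → Fin n)
  | 0 => 0
  | _ + 1 => Measure.infinitePi fun _ => uniformOn Set.univ

/-- The joint law of the binomial random graph `G(n, p)`, the private signals and the selected
nodes, which are independent of each other. -/
def jointLaw (n : ℕ) (p : unitInterval) (δ : Set.Ioo (0 : ℝ) (1 / 2)) :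
    Measure (SimpleGraph (Fin n) × (Fin n → Bool) × (ℕ → Fin n)) :=
  (SimpleGraph.binomialRandom (Fin n) p).prod ((signalLaw n δ).prod (selectionLaw n))

/-- The event that within at most `B` rounds the dynamics terminates with all nodes announcing
the correct opinion. -/
def correctWithin (n : ℕ) (B : ℝ) : Set (SimpleGraph (Fin n) × (Fin n → Bool) × (ℕ → Fin n)) :=
  {ω | ∃ T : ℕ, (T : ℝ) ≤ B ∧ IsTerminal ω.1 ω.2.1 (announcement ω.1 ω.2.1 ω.2.2 T) ∧
    ∀ v, announcement ω.1 ω.2.1 ω.2.2 T v = some true}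

end

end MajorityDynamics

namespace MajorityDynamics

noncomputable section

/-! Write d = pn. The graph and the signals enter only through properties that hold simultaneously
for all relevant announcement states or node sets. They come from union and first moment bounds, so
the dependence between the current state and the part of the graph that it reveals never has to be
handled. On a graph with these properties only the selections are random; they drive a Markov chain
that is controlled by supermartingales (`avgStep_iterate_le`).

Birth of a lead. During the first a/p = o(n) rounds almost every selected node is still silent.
While pt is at most δ/2, such a node usually has no announced neighbour and follows its signal
(`drift_ge_of_few`). Later, the majority of its announced neighbours is at least as favourable as
the opinion of one of them chosen at random, so a relative lead reproduces itself
(`drift_ge_of_biased`). For a fixed state the silent nodes decide independently, and the exp(o(n))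
states with o(n) announcements are beaten by a failure probability exponential in n
(`pairExp_not_hasTypicalSigns_le`). After a/p rounds the correct opinion therefore leads by a
constant proportion of those rounds (`HasTypicalSigns.biased`).

Takeover. If a is a large constant, every state with that many announcements and such a lead leaves
at most εn nodes without a strict correct majority: the moment generating function of the votes
beats the 6^n choices of a state and a node set (`graphExp_not_hasFewWeak_le`). About n log n more
rounds make the number of wrong nodes a small fraction of n, with failure probability O(ε) + o(1)
and ε as small as desired (`few_wrong_of_biased`).

Extinction. The wrong nodes lie in a small set Z closed under influence: every node with half of its
neighbours in Z is in Z. After about 2n log n rounds, enough to select everybody, the wrong nodes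
lie in `influenced G Z` (`epoch_le`). Nodes of degree at least d/100 in that set number O(|Z|/d) by
small set expansion (`graphExp_not_hasSmallSetExpansion_le`). The remaining nodes of low degree are
pairwise at distance more than two, so they cost only one extra generation
(`IsExpanding.card_influenced_influenced_le`). Hence two epochs shrink the set by a factor O(1/d),
where d is at least log n, and O(log n / log log n) epochs empty it. This last regime dominates the
running time. -/

/-- The transition operator of the dynamics on a fixed graph with fixed signals. -/
def avgStep {V : Type*} [Fintype V] [DecidableEq V] (G : SimpleGraph V) (X : V → Bool)
    (f : Announcements V → ℝ) (c : Announcements V) : ℝ :=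
  (∑ v, f (step G X c v)) / Fintype.card V

/-! ### Transition operator of the Markov chain -/

section AvgStep

variable {V : Type*} [Fintype V] [DecidableEq V] {G : SimpleGraph V} {X : V → Bool}

lemma avgStep_mono {f f' : Announcements V → ℝ} {c : Announcements V}
    (h : ∀ v, f (step G X c v) ≤ f' (step G X c v)) : avgStep G X f c ≤ avgStep G X f' c :=
  div_le_div_of_nonneg_right (Finset.sum_le_sum fun v _ => h v) (by positivity)

lemma avgStep_const [Nonempty V] (r : ℝ) (c : Announcements V) :
    avgStep G X (fun _ => r) c = r := by
  have : (Fintype.card V : ℝ) ≠ 0 := by simp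
  simp [avgStep]

lemma avgStep_add (f f' : Announcements V → ℝ) (c : Announcements V) :
    avgStep G X (fun x => f x + f' x) c = avgStep G X f c + avgStep G X f' c := by
  simp [avgStep, Finset.sum_add_distrib, add_div]

lemma avgStep_mul (r : ℝ) (f : Announcements V → ℝ) (c : Announcements V) :
    avgStep G X (fun x => r * f x) c = r * avgStep G X f c := by
  simp [avgStep, ← Finset.mul_sum, mul_div_assoc]

/-- Supermartingale bound: `F k` dominates the `k`-step expectation of `f` on the states
satisfying the invariant `I k`, where `k` is the number of rounds that remain. -/
lemma avgStep_iterate_le {f : Announcements V → ℝ} {F : ℕ → Announcements V → ℝ}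
    {I : ℕ → Announcements V → Prop}
    (hI : ∀ k c v, I (k + 1) c → I k (step G X c v))
    (h0 : ∀ c, I 0 c → f c ≤ F 0 c)
    (hF : ∀ k c, I (k + 1) c → avgStep G X (F k) c ≤ F (k + 1) c) (k : ℕ) :
    ∀ c, I k c → (avgStep G X)^[k] f c ≤ F k c := by
  induction k with
  | zero => exact h0
  | succ k ih =>
    intro c hc
    rw [Function.iterate_succ_apply']
    exact (avgStep_mono fun v => ih _ (hI k c v hc)).trans (hF k c hc)

lemma avgStep_iterate_mono {f f' : Announcements V → ℝ} (h : ∀ c, f c ≤ f' c) (k : ℕ) :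
    ∀ c, (avgStep G X)^[k] f c ≤ (avgStep G X)^[k] f' c := by
  induction k with
  | zero => exact h
  | succ k ih =>
    intro c
    rw [Function.iterate_succ_apply', Function.iterate_succ_apply']
    exact avgStep_mono fun v => ih _

lemma avgStep_iterate_add_const [Nonempty V] (f : Announcements V → ℝ) (r : ℝ) (k : ℕ) :
    ∀ c, (avgStep G X)^[k] (fun x => f x + r) c = (avgStep G X)^[k] f c + r := by
  induction k with
  | zero => intro c; rfl
  | succ k ih =>
    intro c
    rw [Function.iterate_succ_apply', Function.iterate_succ_apply', funext ih, avgStep_add,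
      avgStep_const]

lemma avgStep_iterate_le_one [Nonempty V] {f : Announcements V → ℝ} (h : ∀ c, f c ≤ 1) (k : ℕ) :
    ∀ c, (avgStep G X)^[k] f c ≤ 1 := by
  induction k with
  | zero => exact h
  | succ k ih =>
    intro c
    rw [Function.iterate_succ_apply']
    exact (avgStep_mono fun v => ih _).trans (avgStep_const 1 c).le

/-- The probability of missing `Q₂` after `k₁ + k₂` rounds is at most the probability of missing
`Q₁` after `k₁` rounds plus the worst probability of missing `Q₂` from a state in `Q₁`. -/
lemma avgStep_iterate_add_le [Nonempty V] {Q₁ Q₂ : Set (Announcements V)} {r : ℝ} (hr : 0 ≤ r)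
    {k₁ k₂ : ℕ} (h : ∀ c ∈ Q₁, (avgStep G X)^[k₂] (Q₂ᶜ.indicator 1) c ≤ r)
    (c : Announcements V) :
    (avgStep G X)^[k₁ + k₂] (Q₂ᶜ.indicator 1) c ≤
      (avgStep G X)^[k₁] (Q₁ᶜ.indicator 1) c + r := by
  -- Averaging fixes constants, so `r` moves inside the first `k₁` averages and a pointwise
  -- comparison of the two integrands is enough.
  rw [Function.iterate_add_apply, ← avgStep_iterate_add_const]
  refine avgStep_iterate_mono (fun c => ?_) k₁ c
  by_cases hc : c ∈ Q₁
  · simpa [hc] using h c hc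
  · have := avgStep_iterate_le_one (G := G) (X := X) (f := Q₂ᶜ.indicator 1)
      (fun c => Set.indicator_apply_le' (fun _ => le_rfl) (fun _ => zero_le_one)) k₂ c
    simp [hc]
    linarith

end AvgStep

/-! ### Markov property of the announcements under the selection law -/

instance : MeasurableSpace (Option Bool) := ⊤

instance : DiscreteMeasurableSpace (Option Bool) := ⟨fun _ => trivial⟩

lemma announcement_congr {V : Type*} [DecidableEq V] (G : SimpleGraph V) (X : V → Bool)
    {s s' : ℕ → V} {t : ℕ} (h : ∀ i < t, s i = s' i) :
    announcement G X s t = announcement G X s' t := by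
  induction t with
  | zero => rfl
  | succ t ih =>
    rw [announcement, announcement, ih fun i hi => h i (by omega), h t (by omega)]

instance (n : ℕ) : IsProbabilityMeasure (selectionLaw (n + 1)) := by
  unfold selectionLaw
  infer_instance

lemma selectionLaw_real_eval_eq (n t : ℕ) (v : Fin (n + 1)) :
    (selectionLaw (n + 1)).real {s | s t = v} = ((n + 1 : ℕ) : ℝ)⁻¹ := by
  have h : {s : ℕ → Fin (n + 1) | s t = v} = Function.eval t ⁻¹' ({v} : Set (Fin (n + 1))) := rfl
  rw [selectionLaw, h, measureReal_def, (measurePreserving_eval_infinitePi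
    (μ := fun _ => uniformOn Set.univ) t).measure_preimage
    (measurableSet_singleton v).nullMeasurableSet]
  rw [uniformOn_univ]
  simp only [Measure.count_singleton, Fintype.card_fin, one_div]
  rw [ENNReal.toReal_inv, ENNReal.toReal_natCast]

/-- The state after `t` rounds is a function of the selections with index below `t`, whereas `s t`
is used only in the next round. To exhibit that function, the later selections are replaced by node
0, which `announcement_congr` allows. -/
lemma indepFun_announcement_eval (n : ℕ) (G : SimpleGraph (Fin (n + 1))) (X : Fin (n + 1) → Bool)
    (t : ℕ) :
    IndepFun (fun s => announcement G X s t) (fun s => s t) (selectionLaw (n + 1)) := by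
  have h : iIndepFun (fun i (s : ℕ → Fin (n + 1)) => s i) (selectionLaw (n + 1)) :=
    iIndepFun_infinitePi (X := fun _ v => v) (by fun_prop)
  have h' := h.indepFun_finset (Finset.range t) {t} (by simp) (by fun_prop)
  let φ : (Finset.range t → Fin (n + 1)) → Announcements (Fin (n + 1)) := fun w =>
    announcement G X (fun i => if hi : i ∈ Finset.range t then w ⟨i, hi⟩ else 0) t
  let ψ : (({t} : Finset ℕ) → Fin (n + 1)) → Fin (n + 1) := fun w => w ⟨t, by simp⟩
  have := h'.comp (φ := φ) (ψ := ψ) .of_discrete .of_discrete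
  convert this using 1
  · ext1 s
    apply announcement_congr
    intro i hi
    simp [hi]
  · rfl

lemma measurable_announcement (n : ℕ) (G : SimpleGraph (Fin n)) (X : Fin n → Bool) (t : ℕ) :
    Measurable fun s : ℕ → Fin n => announcement G X s t := by
  induction t with
  | zero => exact measurable_const
  | succ t ih =>
    have : Measurable fun q : Announcements (Fin n) × Fin n => step G X q.1 q.2 := .of_discrete
    exact this.comp (ih.prodMk (measurable_pi_apply t))

/-- Conditioning on the last round replaces `f` by its one-step average, so the induction varies
`f`. This turns probabilities over infinite selection sequences into iterates of a finite averaging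
operator. -/
lemma integral_announcement (n : ℕ) (G : SimpleGraph (Fin (n + 1))) (X : Fin (n + 1) → Bool)
    (t : ℕ) (f : Announcements (Fin (n + 1)) → ℝ) :
    ∫ s, f (announcement G X s t) ∂(selectionLaw (n + 1)) =
      (avgStep G X)^[t] f (fun _ => none) := by
  induction t generalizing f with
  | zero => simp [announcement]
  | succ t ih =>
    rw [Function.iterate_succ_apply, ← ih]
    -- Splitting by the value of `s t` writes the integrand as products of a function of the past
    -- and a function of the new selection, to which independence applies.
    have h1 : ∀ s : ℕ → Fin (n + 1), f (announcement G X s (t + 1)) =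
        ∑ v, f (step G X (announcement G X s t) v) * (if s t = v then 1 else 0) := by
      intro s
      simp [announcement]
    have hinteg : ∀ (f' : Announcements (Fin (n + 1)) × Fin (n + 1) → ℝ),
        Integrable (fun s => f' (announcement G X s t, s t)) (selectionLaw (n + 1)) := by
      intro f'
      refine Integrable.of_bound (C := ∑ x, ‖f' x‖) ?_ (.of_forall fun s => ?_)
      · have hm : Measurable f' := .of_discrete
        exact (hm.comp ((measurable_announcement _ G X t).prodMk
          (measurable_pi_apply t))).aestronglyMeasurable
      · exact Finset.single_le_sum (f := fun x => ‖f' x‖) (fun _ _ => norm_nonneg _)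
          (Finset.mem_univ _)
    simp_rw [h1]
    rw [integral_finsetSum _ fun v _ =>
      hinteg fun q => f (step G X q.1 v) * (if q.2 = v then 1 else 0)]
    have h2 : ∀ v, ∫ s, f (step G X (announcement G X s t) v) * (if s t = v then 1 else 0)
        ∂(selectionLaw (n + 1)) =
        (∫ s, f (step G X (announcement G X s t) v) ∂(selectionLaw (n + 1))) *
          ((n + 1 : ℕ) : ℝ)⁻¹ := by
      intro v
      have hi := (indepFun_announcement_eval n G X t).comp
        (φ := fun c => f (step G X c v)) (ψ := fun w => if w = v then (1 : ℝ) else 0)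
        .of_discrete .of_discrete
      have := hi.integral_fun_mul_eq_mul_integral
        (hinteg fun q => f (step G X q.1 v)).aestronglyMeasurable
        (hinteg fun q => if q.2 = v then 1 else 0).aestronglyMeasurable
      simp only [Function.comp_apply] at this
      rw [this, ← selectionLaw_real_eval_eq n t v]
      congr 1
      have hm : MeasurableSet {s : ℕ → Fin (n + 1) | s t = v} :=
        measurableSet_eq_fun (measurable_pi_apply t) measurable_const
      rw [← integral_indicator_one hm]
      refine integral_congr_ae (.of_forall fun s => ?_)
      simp [Set.indicator_apply]
    simp_rw [h2]
    simp only [avgStep]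
    rw [integral_div, integral_finsetSum _ fun v _ => hinteg fun q => f (step G X q.1 v),
      ← Finset.sum_mul]
    simp [div_eq_mul_inv]

lemma selectionLaw_real_announcement (n : ℕ) (G : SimpleGraph (Fin (n + 1)))
    (X : Fin (n + 1) → Bool) (t : ℕ) (Q : Set (Announcements (Fin (n + 1)))) :
    (selectionLaw (n + 1)).real {s | announcement G X s t ∈ Q} =
      (avgStep G X)^[t] (Q.indicator 1) (fun _ => none) := by
  rw [← integral_announcement]
  have hm : MeasurableSet {s : ℕ → Fin (n + 1) | announcement G X s t ∈ Q} :=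
    (measurable_announcement _ G X t) (.of_discrete (s := Q))
  rw [← integral_indicator_one hm]
  rfl

/-! ### Bias, wrong nodes and exponential supermartingales -/

/-- The sum over all nodes of a function of the announcement. -/
def tally {V : Type*} [Fintype V] (φ : Option Bool → ℝ) (c : Announcements V) : ℝ := ∑ v, φ (c v)

/-- `+1` for the correct opinion, `-1` for the incorrect one, `0` for no announcement. -/
def voteSign : Option Bool → ℝ
  | none => 0
  | some true => 1
  | some false => -1

/-- The number of correct minus the number of incorrect announcements. -/
def bias {V : Type*} [Fintype V] (c : Announcements V) : ℝ := tally voteSign c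

/-- The number of nodes that have announced an opinion. -/
def announcedCount {V : Type*} [Fintype V] (c : Announcements V) : ℝ :=
  tally (fun x => if x = none then 0 else 1) c

/-- The set of nodes that do not announce the correct opinion. -/
def wrongSet {V : Type*} [Fintype V] (c : Announcements V) : Finset V :=
  Finset.univ.filter fun v => c v ≠ some true

/-- The set of nodes that would announce the incorrect opinion if they were selected. -/
def misledSet {V : Type*} [Fintype V] (G : SimpleGraph V) (X : V → Bool) (c : Announcements V) :
    Finset V :=
  Finset.univ.filter fun v => majorityOpinion G X c v = false

section Phases

variable {V : Type*} [Fintype V] {G : SimpleGraph V} {X : V → Bool}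

lemma card_wrongSet_eq_tally (c : Announcements V) :
    ((wrongSet c).card : ℝ) = tally (fun x => if x = some true then 0 else 1) c := by
  simp [wrongSet, tally, Finset.sum_ite]

lemma abs_voteSign_le (x : Option Bool) : |voteSign x| ≤ 1 := by
  rcases x with _ | _ | _ <;> simp [voteSign]

lemma bias_le_announcedCount (c : Announcements V) : bias c ≤ announcedCount c := by
  refine Finset.sum_le_sum fun v _ => ?_
  rcases c v with _ | _ | _ <;> simp [voteSign]

lemma announcedCount_nonneg (c : Announcements V) : 0 ≤ announcedCount c :=
  Finset.sum_nonneg fun v _ => by dsimp; split_ifs <;> simp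

lemma announcedCount_le (c : Announcements V) : announcedCount c ≤ Fintype.card V := by
  have : announcedCount c ≤ ∑ v : V, (1 : ℝ) :=
    Finset.sum_le_sum fun v _ => by dsimp; split_ifs <;> simp
  simpa using this

lemma card_wrongSet_le (c : Announcements V) : ((wrongSet c).card : ℝ) ≤ Fintype.card V := by
  exact_mod_cast Finset.card_le_univ _

/-- With g correct and b incorrect announcements among n nodes, the wrong nodes number n - g, so
this is g - b = 2n - 2(n - g) - (g + b). It shows that few wrong nodes force a bias of order n. -/
lemma bias_eq (c : Announcements V) :
    bias c = 2 * Fintype.card V - 2 * (wrongSet c).card - announcedCount c := by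
  have : (Fintype.card V : ℝ) = ∑ v : V, (1 : ℝ) := by simp
  rw [card_wrongSet_eq_tally, bias, announcedCount, tally, tally, tally, this,
    Finset.mul_sum, Finset.mul_sum, ← Finset.sum_sub_distrib, ← Finset.sum_sub_distrib]
  refine Finset.sum_congr rfl fun v _ => ?_
  rcases c v with _ | _ | _ <;> (simp [voteSign]; try norm_num)

lemma exp_neg_le {x : ℝ} (hx : |x| ≤ 1) : Real.exp (-x) ≤ 1 - x + x ^ 2 := by
  have := Real.abs_exp_sub_one_sub_id_le (x := -x) (by simpa using hx)
  have := (abs_le.1 this).2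
  nlinarith

/-- One round of the exponential supermartingale. -/
lemma avg_exp_neg_le [Nonempty V] {Δ : V → ℝ} {θ μ : ℝ} (hθ : 0 ≤ θ) (hθ' : θ ≤ 1 / 2)
    (hΔ : ∀ v, |Δ v| ≤ 2) (hμ : Fintype.card V * μ ≤ ∑ v, Δ v) :
    (∑ v, Real.exp (-(θ * Δ v))) / Fintype.card V ≤ Real.exp (-(θ * μ) + 4 * θ ^ 2) := by
  have hn : (0 : ℝ) < Fintype.card V := by exact_mod_cast Fintype.card_pos
  rw [div_le_iff₀ hn]
  have h1 : ∀ v, Real.exp (-(θ * Δ v)) ≤ 1 - θ * Δ v + 4 * θ ^ 2 := by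
    intro v
    have hv : |θ * Δ v| ≤ 1 := by
      rw [abs_mul, abs_of_nonneg hθ]
      nlinarith [hΔ v, abs_nonneg (Δ v)]
    have h2 : (Δ v) ^ 2 ≤ 4 := by
      have := sq_le_sq' (abs_le.1 (hΔ v)).1 (abs_le.1 (hΔ v)).2
      linarith
    have := exp_neg_le hv
    nlinarith [sq_nonneg θ]
  calc (∑ v, Real.exp (-(θ * Δ v))) ≤ ∑ v : V, (1 - θ * Δ v + 4 * θ ^ 2) :=
        Finset.sum_le_sum fun v _ => h1 v
    _ = Fintype.card V * (1 + 4 * θ ^ 2) - θ * ∑ v, Δ v := by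
        rw [Finset.sum_add_distrib, Finset.sum_sub_distrib, ← Finset.mul_sum]
        simp
        ring
    _ ≤ Fintype.card V * (-(θ * μ) + 4 * θ ^ 2 + 1) := by nlinarith
    _ ≤ Real.exp (-(θ * μ) + 4 * θ ^ 2) * Fintype.card V := by
        rw [mul_comm]
        exact mul_le_mul_of_nonneg_right (Real.add_one_le_exp _) hn.le

variable [DecidableEq V]

lemma tally_step (φ : Option Bool → ℝ) (c : Announcements V) (v : V) :
    tally φ (step G X c v) = tally φ c + (φ (some (majorityOpinion G X c v)) - φ (c v)) := by
  unfold tally step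
  rw [← Finset.add_sum_erase _ _ (Finset.mem_univ v),
    ← Finset.add_sum_erase _ (fun w => φ (c w)) (Finset.mem_univ v), Function.update_self]
  have : ∀ w ∈ Finset.univ.erase v,
      φ (Function.update c v (some (majorityOpinion G X c v)) w) = φ (c w) := by
    intro w hw
    rw [Function.update_of_ne (Finset.ne_of_mem_erase hw)]
  rw [Finset.sum_congr rfl this]
  ring

lemma bias_step (c : Announcements V) (v : V) :
    bias (step G X c v) - bias c = voteSign (some (majorityOpinion G X c v)) - voteSign (c v) := by
  rw [bias, bias, tally_step]
  ring

lemma abs_bias_step_le (c : Announcements V) (v : V) : |bias (step G X c v) - bias c| ≤ 2 := by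
  rw [bias_step]
  have h1 := abs_voteSign_le (some (majorityOpinion G X c v))
  have h2 := abs_voteSign_le (c v)
  rw [abs_le] at *
  constructor <;> linarith

lemma announcedCount_step (c : Announcements V) (v : V) :
    announcedCount (step G X c v) = announcedCount c + if c v = none then 1 else 0 := by
  rw [announcedCount, announcedCount, tally_step]
  split_ifs <;> simp_all

lemma card_wrongSet_step (c : Announcements V) (v : V) :
    ((wrongSet (step G X c v)).card : ℝ) - (wrongSet c).card =
      (if majorityOpinion G X c v = false then 1 else 0) - if c v = some true then 0 else 1 := by
  rw [card_wrongSet_eq_tally, card_wrongSet_eq_tally, tally_step]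
  cases majorityOpinion G X c v <;> simp

/-- If above the curve `h` the drift of the bias exceeds the slope of `h` by `4 * θ`, then the bias
is unlikely to end below `h`. -/
lemma bias_above_curve [Nonempty V] {h : ℕ → ℝ} {θ : ℝ} {T : ℕ} (hθ : 0 ≤ θ) (hθ' : θ ≤ 1 / 2)
    (hd : ∀ s < T, ∀ c : Announcements V, announcedCount c ≤ s → h s < bias c →
      Fintype.card V * (h (s + 1) - h s + 4 * θ) ≤ ∑ v, (bias (step G X c v) - bias c)) :
    (avgStep G X)^[T] ({c | h T ≤ bias c ∧ announcedCount c ≤ T}ᶜ.indicator 1)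
        (fun _ => none) ≤
      Real.exp (θ * h 0) := by
  -- Truncating the exponential at 1 makes the supermartingale inequality trivial at or below the
  -- curve, so the drift hypothesis is needed only above it. With `k` rounds left, `T - k` have been
  -- played, which also bounds the number of announcements.
  have key := avgStep_iterate_le (G := G) (X := X)
    (f := {c : Announcements V | h T ≤ bias c ∧ announcedCount c ≤ T}ᶜ.indicator 1)
    (F := fun k c => min 1 (Real.exp (-(θ * (bias c - h (T - k))))))
    (I := fun k c => k ≤ T ∧ announcedCount c ≤ ((T - k : ℕ) : ℝ)) ?_ ?_ ?_ T (fun _ => none)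
    ⟨le_rfl, by simp [announcedCount, tally]⟩
  · refine key.trans ((min_le_right _ _).trans ?_)
    simp [bias, tally, voteSign]
  · rintro k c v ⟨hk, hc⟩
    refine ⟨by omega, ?_⟩
    rw [announcedCount_step]
    have : T - k = T - (k + 1) + 1 := by omega
    rw [this]
    push_cast
    split_ifs <;> linarith
  · rintro c ⟨-, ha⟩
    rw [Nat.sub_zero] at ha
    by_cases hc : h T ≤ bias c
    · simp [hc, ha, Real.exp_nonneg]
    · simp only [hc, false_and, Set.mem_compl_iff, Set.mem_ofPred_eq, not_false_eq_true,
        Set.indicator_of_mem, Pi.one_apply, tsub_zero, le_inf_iff, le_refl, true_and]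
      apply Real.one_le_exp
      nlinarith
  · rintro k c ⟨hk, hc⟩
    refine le_min ?_ ?_
    · exact (avgStep_mono (f' := fun _ => 1) fun v => min_le_left _ _).trans (avgStep_const 1 c).le
    by_cases hb : h (T - (k + 1)) < bias c
    · have hs : T - (k + 1) < T := by omega
      have hd' := hd _ hs c hc hb
      have e : T - (k + 1) + 1 = T - k := by omega
      rw [e] at hd'
      have h1 := avg_exp_neg_le hθ hθ' (fun v => abs_bias_step_le c v) hd'
      refine (avgStep_mono (f' := fun c => Real.exp (-(θ * (bias c - h (T - k)))))
        fun v => min_le_right _ _).trans ?_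
      have h2 : avgStep G X (fun c => Real.exp (-(θ * (bias c - h (T - k))))) c =
          Real.exp (-(θ * (bias c - h (T - k)))) *
            ((∑ v, Real.exp (-(θ * (bias (step G X c v) - bias c)))) / Fintype.card V) := by
        rw [avgStep, ← mul_div_assoc, Finset.mul_sum]
        congr 1
        refine Finset.sum_congr rfl fun v _ => ?_
        rw [← Real.exp_add]
        congr 1
        ring
      rw [h2]
      refine (mul_le_mul_of_nonneg_left h1 (Real.exp_nonneg _)).trans ?_
      rw [← Real.exp_add]
      apply Real.exp_le_exp.2
      nlinarith
    · refine le_trans ?_ (Real.one_le_exp (by nlinarith))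
      exact (avgStep_mono (f' := fun _ => 1) fun v => min_le_left _ _).trans (avgStep_const 1 c).le

/-- From a biased state with enough announcements, few nodes are wrong after a while, provided few
nodes are misled in all such states. -/
lemma few_wrong_of_biased [Nonempty V] {ε ρ m η : ℝ} (hε : 0 < ε) (hε' : ε ≤ 1 / 80)
    (hρ : 0 ≤ ρ) (hρ' : ρ ≤ 1 / 2) (hη : 0 < η)
    (hB : ∀ c : Announcements V, m ≤ announcedCount c → ρ * announcedCount c ≤ bias c →
      ((misledSet G X c).card : ℝ) ≤ ε * Fintype.card V)
    (k : ℕ) (c : Announcements V) (hc : m ≤ announcedCount c) :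
    (avgStep G X)^[k] ({c | ((wrongSet c).card : ℝ) ≤ η * Fintype.card V}ᶜ.indicator 1) c ≤
      Real.exp (-(ε / 2 * (bias c - ρ * announcedCount c))) +
        k * Real.exp (-(ε / 2 * (Fintype.card V / 4 - 2))) +
        ((1 - 1 / Fintype.card V) ^ k + 2 * ε) / η := by
  set n : ℝ := (Fintype.card V : ℝ) with hn_def
  have hn : 1 ≤ n := by
    rw [hn_def]; exact_mod_cast (Fintype.card_pos : 0 < Fintype.card V)
  have hn0 : 0 < n := by linarith
  set τ := Real.exp (-(ε / 2 * (n / 4 - 2)))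
  set Y : Announcements V → ℝ := fun c => bias c - ρ * announcedCount c
  set q : ℝ := 1 - 1 / n
  have hq : 0 ≤ q := by
    have : 1 / n ≤ 1 := by rw [div_le_one hn0]; exact hn
    simp only [q]; linarith
  set w : Announcements V → ℝ := fun c => ((wrongSet c).card : ℝ)
  -- The potential adds three failure costs: the lead `Y` dropping to 0, an error `τ` per remaining
  -- round, and a Markov bound for the wrong count, whose mean relaxes geometrically to below `2 * ε
  -- * n`.
  have key := avgStep_iterate_le (G := G) (X := X)
    (f := {c : Announcements V | w c ≤ η * n}ᶜ.indicator 1)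
    (F := fun k c => min 1 (Real.exp (-(ε / 2 * Y c)) + k * τ +
      (q ^ k * (w c - 2 * ε * n) + 2 * ε * n) / (η * n)))
    (I := fun _ c => m ≤ announcedCount c) ?_ ?_ ?_ k c hc
  · refine key.trans ((min_le_right _ _).trans ?_)
    have h1 : (q ^ k * (w c - 2 * ε * n) + 2 * ε * n) / (η * n) ≤ (q ^ k + 2 * ε) / η := by
      rw [div_le_div_iff₀ (by positivity) hη]
      have hw : w c ≤ n := card_wrongSet_le c
      have : q ^ k * (w c - 2 * ε * n) ≤ q ^ k * n :=
        mul_le_mul_of_nonneg_left (by nlinarith) (pow_nonneg hq k)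
      nlinarith
    linarith
  · intro k c v hc
    rw [announcedCount_step]
    split_ifs <;> linarith
  · intro c _
    by_cases hw : w c ≤ η * n
    · have : ({c : Announcements V | w c ≤ η * n}ᶜ.indicator (1 : Announcements V → ℝ)) c = 0 := by
        simp [hw]
      rw [this]
      refine le_min zero_le_one ?_
      have h0 : 0 ≤ w c := Nat.cast_nonneg _
      have h1 : 0 ≤ w c / (η * n) := by positivity
      have h2 := Real.exp_nonneg (-(ε / 2 * Y c))
      simpa using add_nonneg h2 h1
    · have : ({c : Announcements V | w c ≤ η * n}ᶜ.indicator (1 : Announcements V → ℝ)) c = 1 := by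
        simp [hw]
      rw [this]
      refine le_min le_rfl ?_
      have h2 := Real.exp_nonneg (-(ε / 2 * Y c))
      have h1 : 1 ≤ w c / (η * n) := by
        rw [one_le_div (by positivity)]
        linarith
      simpa using le_add_of_nonneg_of_le h2 h1
  · intro k c hc
    have hle1 : avgStep G X (fun c => min 1 (Real.exp (-(ε / 2 * Y c)) + k * τ +
        (q ^ k * (w c - 2 * ε * n) + 2 * ε * n) / (η * n))) c ≤ 1 :=
      (avgStep_mono (f' := fun _ => 1) fun v => min_le_left _ _).trans (avgStep_const 1 c).le
    refine le_min hle1 ?_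
    have hqk := pow_nonneg hq k
    have hqk1 := pow_nonneg hq (k + 1)
    have hτ : 0 ≤ τ := Real.exp_nonneg _
    have hrest : 0 ≤ (q ^ (k + 1) * (w c - 2 * ε * n) + 2 * ε * n) / (η * n) := by
      have hq1 : q ^ (k + 1) ≤ 1 := pow_le_one₀ hq (by simp only [q]; linarith [one_div_pos.2 hn0])
      have h0 : 0 ≤ w c := Nat.cast_nonneg _
      have : 0 ≤ q ^ (k + 1) * w c + (1 - q ^ (k + 1)) * (2 * ε * n) := by
        have : 0 ≤ 1 - q ^ (k + 1) := by linarith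
        positivity
      apply div_nonneg _ (by positivity)
      linarith
    -- Without a lead the exponential alone is at least 1 and nothing is to be shown. With a
    -- positive lead, `hB` bounds the misled nodes.
    by_cases hY : Y c ≤ 0
    · refine hle1.trans ?_
      have : 1 ≤ Real.exp (-(ε / 2 * Y c)) := Real.one_le_exp (by nlinarith)
      have h3 : 0 ≤ ((k + 1 : ℕ) : ℝ) * τ := by positivity
      linarith
    push Not at hY
    have hM := hB c hc (by simp only [Y] at hY; linarith)
    have hMsum : ∑ v, (if majorityOpinion G X c v = false then (1 : ℝ) else 0) ≤ ε * n := by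
      refine le_trans (le_of_eq ?_) hM
      simp [misledSet]
    have hwsum : ∑ v, (if c v = some true then (0 : ℝ) else 1) = w c := by
      simp only [w]; rw [card_wrongSet_eq_tally]; rfl
    have hΔY : ∀ v, Y (step G X c v) - Y c =
        voteSign (some (majorityOpinion G X c v)) - voteSign (c v) -
          ρ * if c v = none then 1 else 0 := by
      intro v
      simp only [Y]
      rw [announcedCount_step, ← bias_step c v]
      ring
    have hYabs : ∀ v, |Y (step G X c v) - Y c| ≤ 2 := by
      intro v
      rw [hΔY, abs_le]
      cases majorityOpinion G X c v <;> rcases c v with _ | _ | _ <;> simp [voteSign] <;>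
        (constructor <;> linarith)
    have hexp : avgStep G X (fun c => Real.exp (-(ε / 2 * Y c))) c ≤
        Real.exp (-(ε / 2 * Y c)) + τ := by
      -- With many wrong nodes, corrections outweigh new errors: the mean drift of `Y` is at least
      -- 5ε/2, and at `θ = ε / 2` its gain 5ε²/4 exceeds the quadratic loss ε². Otherwise `ε ≤ 1 /
      -- 80` makes the wrong nodes fewer than n/8, so `Y` is at least n/4 and one round, which
      -- changes it by at most 2, leaves the exponential below `τ`.
      by_cases hw : 10 * ε * n ≤ w c
      · have hsum : n * (5 / 2 * ε) ≤ ∑ v, (Y (step G X c v) - Y c) := by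
          calc n * (5 / 2 * ε) ≤ 1 / 2 * w c - 5 / 2 * (ε * n) := by linarith
            _ ≤ 1 / 2 * (∑ v, (if c v = some true then (0 : ℝ) else 1)) -
                5 / 2 * ∑ v, (if majorityOpinion G X c v = false then (1 : ℝ) else 0) := by
                  rw [hwsum]; linarith
            _ = ∑ v, (1 / 2 * (if c v = some true then (0 : ℝ) else 1) -
                5 / 2 * (if majorityOpinion G X c v = false then (1 : ℝ) else 0)) := by
                  rw [Finset.sum_sub_distrib, Finset.mul_sum, Finset.mul_sum]
            _ ≤ _ := by
                  refine Finset.sum_le_sum fun v _ => ?_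
                  rw [hΔY]
                  cases majorityOpinion G X c v <;> rcases c v with _ | _ | _ <;>
                    simp [voteSign] <;> linarith
        have h1 := avg_exp_neg_le (θ := ε / 2) (by linarith) (by linarith) hYabs hsum
        have h2 : avgStep G X (fun c => Real.exp (-(ε / 2 * Y c))) c =
            Real.exp (-(ε / 2 * Y c)) *
              ((∑ v, Real.exp (-(ε / 2 * (Y (step G X c v) - Y c)))) / Fintype.card V) := by
          rw [avgStep, ← mul_div_assoc, Finset.mul_sum]
          congr 1
          refine Finset.sum_congr rfl fun v _ => ?_
          rw [← Real.exp_add]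
          congr 1
          ring
        have h3 : Real.exp (-(ε / 2 * (5 / 2 * ε)) + 4 * (ε / 2) ^ 2) ≤ 1 :=
          Real.exp_le_one_iff.2 (by nlinarith [sq_nonneg ε])
        rw [h2]
        have := mul_le_mul_of_nonneg_left (h1.trans h3) (Real.exp_nonneg (-(ε / 2 * Y c)))
        linarith
      · push Not at hw
        have hYn : n / 4 ≤ Y c := by
          have h1 := bias_eq c
          have h2 : announcedCount c ≤ n := announcedCount_le c
          simp only [Y]
          rw [h1]
          simp only [w] at hw
          nlinarith [announcedCount_nonneg c]
        have : avgStep G X (fun c => Real.exp (-(ε / 2 * Y c))) c ≤ τ := by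
          refine (avgStep_mono (f' := fun _ => τ) fun v => ?_).trans (avgStep_const τ c).le
          apply Real.exp_le_exp.2
          have := (abs_le.1 (hYabs v)).1
          nlinarith
        linarith [Real.exp_nonneg (-(ε / 2 * Y c))]
    have hwstep : avgStep G X (fun c => w c - 2 * ε * n) c ≤ q * (w c - 2 * ε * n) := by
      have : ∑ v, (w (step G X c v) - 2 * ε * n) ≤ (n - 1) * (w c - 2 * ε * n) := by
        calc ∑ v, (w (step G X c v) - 2 * ε * n)
            = ∑ v, ((w c - 2 * ε * n) + ((if majorityOpinion G X c v = false then (1 : ℝ) else 0) -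
                if c v = some true then 0 else 1)) := by
              refine Finset.sum_congr rfl fun v _ => ?_
              rw [← card_wrongSet_step c v]
              simp only [w]; ring
          _ = n * (w c - 2 * ε * n) +
              (∑ v, (if majorityOpinion G X c v = false then (1 : ℝ) else 0) - w c) := by
              rw [← hwsum, ← Finset.sum_sub_distrib, hn_def, ← nsmul_eq_mul, ← Finset.card_univ,
                ← Finset.sum_const, ← Finset.sum_add_distrib]
          _ ≤ _ := by nlinarith
      rw [avgStep, div_le_iff₀ hn0]
      refine this.trans (le_of_eq ?_)
      simp only [q]
      field_simp
    calc avgStep G X (fun c => min 1 (Real.exp (-(ε / 2 * Y c)) + k * τ +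
        (q ^ k * (w c - 2 * ε * n) + 2 * ε * n) / (η * n))) c
        ≤ avgStep G X (fun c => Real.exp (-(ε / 2 * Y c)) + ((k * τ + 2 * ε * n / (η * n)) +
          (q ^ k / (η * n)) * (w c - 2 * ε * n))) c := by
          refine avgStep_mono fun v => (min_le_right _ _).trans (le_of_eq ?_)
          ring
      _ = avgStep G X (fun c => Real.exp (-(ε / 2 * Y c))) c + ((k * τ + 2 * ε * n / (η * n)) +
          (q ^ k / (η * n)) * avgStep G X (fun c => w c - 2 * ε * n) c) := by
          rw [avgStep_add, avgStep_add, avgStep_const, avgStep_mul]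
      _ ≤ (Real.exp (-(ε / 2 * Y c)) + τ) + ((k * τ + 2 * ε * n / (η * n)) +
          (q ^ k / (η * n)) * (q * (w c - 2 * ε * n))) := by
          gcongr
      _ = _ := by
          push_cast
          ring

end Phases

/-! ### Influenced sets and extinction of the wrong opinion on expanding graphs -/

open scoped Classical in
/-- The number of neighbours of `v` in `Z`. -/
def nbrsIn {V : Type*} (G : SimpleGraph V) (v : V) (Z : Finset V) : ℕ := (Z.filter (G.Adj v)).card

/-- The nodes with at least half of their neighbours in `Z`. -/
def influenced {V : Type*} [Fintype V] (G : SimpleGraph V) (Z : Finset V) : Finset V :=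
  Finset.univ.filter fun v => nbrsIn G v Finset.univ ≤ 2 * nbrsIn G v Z

/-- The graph has no isolated node, and the nodes influenced by any small set `Z` are few, apart
from those in an exceptional set `S` of pairwise far apart nodes. -/
structure IsExpanding {V : Type*} [Fintype V] [DecidableEq V] (G : SimpleGraph V)
    (S : Finset V) (κ m : ℝ) :
    Prop where
  deg_pos : ∀ v, 0 < nbrsIn G v Finset.univ
  not_adj : ∀ v ∈ S, ∀ v' ∈ S, ¬ G.Adj v v'
  no_common : ∀ v ∈ S, ∀ v' ∈ S, v ≠ v' → ∀ u, G.Adj v u → ¬ G.Adj v' u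
  card_le : ∀ Z : Finset V, (Z.card : ℝ) ≤ m →
    (((influenced G Z).filter (· ∉ S)).card : ℝ) ≤ κ * Z.card

section Influenced

variable {V : Type*} {G : SimpleGraph V} {X : V → Bool}

lemma nbrsIn_mono (v : V) {Z Z' : Finset V} (h : Z ⊆ Z') : nbrsIn G v Z ≤ nbrsIn G v Z' := by
  classical
  exact Finset.card_le_card (Finset.filter_subset_filter _ h)

variable [Fintype V]

lemma mem_wrongSet {c : Announcements V} {v : V} : v ∈ wrongSet c ↔ c v ≠ some true := by
  simp [wrongSet]

lemma influenced_mono : Monotone (influenced G) := by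
  intro Z Z' h v
  simp only [influenced, Finset.mem_filter, Finset.mem_univ, true_and]
  have := nbrsIn_mono (G := G) v h
  omega

lemma neighbourCount_eq_nbrsIn (c : Announcements V) (i : Option Bool) (v : V) :
    neighbourCount G c i v = nbrsIn G v (Finset.univ.filter fun w => c w = i) := by
  classical
  rw [neighbourCount, nbrsIn, ← Set.ncard_coe_finset]
  congr 1
  ext w
  simp [and_comm]

/-- Silent neighbours count as wrong here, so more than half of all neighbours announce 1; no tie
can occur and the signal plays no role. -/
lemma majorityOpinion_eq_true {c : Announcements V} {v : V}
    (hv : v ∉ influenced G (wrongSet c)) : majorityOpinion G X c v = true := by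
  classical
  simp only [influenced, Finset.mem_filter, Finset.mem_univ, true_and, not_le] at hv
  have h1 : nbrsIn G v Finset.univ = neighbourCount G c (some true) v +
      nbrsIn G v (wrongSet c) := by
    rw [neighbourCount_eq_nbrsIn, nbrsIn, nbrsIn, nbrsIn, wrongSet, Finset.filter_filter,
      Finset.filter_filter]
    rw [← Finset.card_union_of_disjoint]
    · congr 1
      ext w
      simp only [Finset.mem_filter, Finset.mem_univ, true_and, Finset.mem_union]
      tauto
    · rw [Finset.disjoint_filter]
      tauto
  have h2 : neighbourCount G c (some false) v ≤ nbrsIn G v (wrongSet c) := by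
    rw [neighbourCount_eq_nbrsIn]
    refine nbrsIn_mono v fun w => ?_
    simp only [wrongSet, Finset.mem_filter, Finset.mem_univ, true_and]
    intro h
    simp [h]
  rw [majorityOpinion, if_pos (by omega)]

lemma influenced_iterate_subset {Z : Finset V} (hZ : influenced G Z ⊆ Z) (k : ℕ) :
    influenced G ((influenced G)^[k] Z) ⊆ (influenced G)^[k] Z := by
  rw [← Function.iterate_succ_apply' (influenced G), Function.iterate_succ_apply]
  exact influenced_mono.iterate k hZ

variable [DecidableEq V]

lemma mem_wrongSet_step {c : Announcements V} {v w : V} (hw : w ∈ wrongSet (step G X c v)) :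
    (w ≠ v ∧ w ∈ wrongSet c) ∨ (w = v ∧ v ∈ influenced G (wrongSet c)) := by
  by_cases h : w = v
  · subst h
    refine Or.inr ⟨rfl, ?_⟩
    by_contra hv
    simp [wrongSet, step, majorityOpinion_eq_true (X := X) hv] at hw
  · refine Or.inl ⟨h, ?_⟩
    rw [mem_wrongSet, step, Function.update_of_ne h] at hw
    exact mem_wrongSet.2 hw

/-- Coupon collecting. As long as the wrong nodes lie in the closed set `Z`, a node outside
`influenced G Z` turns correct when selected and stays correct. The expected number of wrong nodes
outside `influenced G Z` thus shrinks by the factor 1 - 1/n per round, and it bounds the probability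
that one is left. -/
lemma epoch_le [Nonempty V] {Z : Finset V} (hZ : influenced G Z ⊆ Z) (T : ℕ)
    {c : Announcements V} (hc : wrongSet c ⊆ Z) :
    (avgStep G X)^[T] ({c | wrongSet c ⊆ influenced G Z}ᶜ.indicator 1) c ≤
      Fintype.card V * (1 - 1 / Fintype.card V) ^ T := by
  have hn : (1 : ℝ) ≤ Fintype.card V := by exact_mod_cast (Fintype.card_pos : 0 < Fintype.card V)
  have hq : (0 : ℝ) ≤ 1 - 1 / Fintype.card V := by
    have : 1 / (Fintype.card V : ℝ) ≤ 1 := by rw [div_le_one (by linarith)]; exact hn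
    linarith
  have key := avgStep_iterate_le (G := G) (X := X)
    (f := {c : Announcements V | wrongSet c ⊆ influenced G Z}ᶜ.indicator 1)
    (F := fun k c => (1 - 1 / Fintype.card V) ^ k * ((wrongSet c \ influenced G Z).card : ℝ))
    (I := fun _ c => wrongSet c ⊆ Z) ?_ ?_ ?_ T c hc
  · refine key.trans ?_
    rw [mul_comm]
    exact mul_le_mul_of_nonneg_right (by exact_mod_cast Finset.card_le_univ _) (pow_nonneg hq T)
  · intro k c v hc w hw
    rcases mem_wrongSet_step hw with ⟨_, h⟩ | ⟨rfl, h⟩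
    · exact hc h
    · exact hZ (influenced_mono hc h)
  · intro c _
    refine Set.indicator_apply_le' (fun h => ?_) (fun _ => by positivity)
    have : (wrongSet c \ influenced G Z).Nonempty := by
      rw [Finset.sdiff_nonempty]
      exact h
    simpa using this.card_pos
  · intro k c hc
    rw [avgStep_mul, pow_succ, mul_assoc]
    refine mul_le_mul_of_nonneg_left ?_ (pow_nonneg hq k)
    rw [avgStep, div_le_iff₀ (by linarith)]
    set U := wrongSet c \ influenced G Z
    calc ∑ v, ((wrongSet (step G X c v) \ influenced G Z).card : ℝ)
        ≤ ∑ v, ((U.card : ℝ) - if v ∈ U then 1 else 0) := by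
          refine Finset.sum_le_sum fun v _ => ?_
          have h1 : wrongSet (step G X c v) \ influenced G Z ⊆ U.erase v := by
            intro w hw
            rw [Finset.mem_sdiff] at hw
            rcases mem_wrongSet_step hw.1 with ⟨h, h'⟩ | ⟨rfl, h⟩
            · exact Finset.mem_erase.2 ⟨h, Finset.mem_sdiff.2 ⟨h', hw.2⟩⟩
            · exact absurd (influenced_mono hc h) hw.2
          have h2 := Finset.card_le_card h1
          rw [Finset.card_erase_eq_ite] at h2
          split_ifs with h
          · rw [if_pos h] at h2
            have : 0 < U.card := Finset.card_pos.2 ⟨v, h⟩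
            have h3 : (wrongSet (step G X c v) \ influenced G Z).card + 1 ≤ U.card := by omega
            have h4 : ((wrongSet (step G X c v) \ influenced G Z).card : ℝ) + 1 ≤ U.card := by
              exact_mod_cast h3
            linarith
          · rw [if_neg h] at h2
            rw [sub_zero]
            exact_mod_cast h2
      _ = Fintype.card V * U.card - U.card := by
          rw [Finset.sum_sub_distrib]
          simp
      _ = (1 - 1 / Fintype.card V) * U.card * Fintype.card V := by
          field_simp

lemma epochs_le [Nonempty V] {Z : Finset V} (hZ : influenced G Z ⊆ Z) (T k : ℕ)
    {c : Announcements V} (hc : wrongSet c ⊆ Z) :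
    (avgStep G X)^[k * T] ({c | wrongSet c ⊆ (influenced G)^[k] Z}ᶜ.indicator 1) c ≤
      k * (Fintype.card V * (1 - 1 / Fintype.card V) ^ T) := by
  have hn : (1 : ℝ) ≤ Fintype.card V := by exact_mod_cast (Fintype.card_pos : 0 < Fintype.card V)
  have hq : (0 : ℝ) ≤ 1 - 1 / Fintype.card V := by
    have : 1 / (Fintype.card V : ℝ) ≤ 1 := by rw [div_le_one (by linarith)]; exact hn
    linarith
  induction k with
  | zero => simp [hc]
  | succ k ih =>
    rw [Nat.succ_mul]
    refine (avgStep_iterate_add_le (Q₁ := {c | wrongSet c ⊆ (influenced G)^[k] Z})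
      (r := Fintype.card V * (1 - 1 / Fintype.card V) ^ T) (by positivity) ?_ c).trans ?_
    · intro c hc
      rw [Function.iterate_succ_apply']
      exact epoch_le (influenced_iterate_subset hZ k) T hc
    · push_cast
      linarith

variable {S : Finset V} {κ m : ℝ}

/-- Expansion says nothing about nodes of `S`, which is why two generations are taken. A node of `S`
influenced by `Z' = influenced G Z` has a neighbour in `Z'`, which is outside `S`; distinct nodes of
`S` share no neighbour, so they are at most as many as the nodes of `Z'` outside `S`, that is `κ *
|Z|`. The influenced nodes outside `S` contribute another `κ * |Z'|`. -/
lemma IsExpanding.card_influenced_influenced_le (h : IsExpanding G S κ m) {Z : Finset V}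
    (hZ : influenced G Z ⊆ Z) (hκ : 0 ≤ κ) (hm : (Z.card : ℝ) ≤ m) :
    ((influenced G (influenced G Z)).card : ℝ) ≤ 2 * κ * Z.card := by
  set Z' := influenced G Z with hZ'
  have hcard : (Z'.card : ℝ) ≤ Z.card := by exact_mod_cast Finset.card_le_card hZ
  have h1 := h.card_le Z' (hcard.trans hm)
  have h2 := h.card_le Z hm
  have h3 : ((influenced G Z').filter (· ∈ S)).card ≤ (Z'.filter (· ∉ S)).card := by
    have hex : ∀ v ∈ (influenced G Z').filter (· ∈ S), ∃ u ∈ Z'.filter (· ∉ S), G.Adj v u := by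
      intro v hv
      rw [Finset.mem_filter] at hv
      have hpos := h.deg_pos v
      have : nbrsIn G v Finset.univ ≤ 2 * nbrsIn G v Z' := by
        simpa [influenced] using hv.1
      have hpos' : 0 < nbrsIn G v Z' := by omega
      classical
      obtain ⟨u, hu⟩ := Finset.card_pos.1 hpos'
      rw [Finset.mem_filter] at hu
      exact ⟨u, Finset.mem_filter.2 ⟨hu.1, fun hS => h.not_adj v hv.2 u hS hu.2⟩, hu.2⟩
    choose! f hf hadj using hex
    refine Finset.card_le_card_of_injOn f (fun v hv => hf v hv) ?_
    intro v hv v' hv' hvv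
    by_contra hne
    refine h.no_common v (Finset.mem_filter.1 hv).2 v' (Finset.mem_filter.1 hv').2 hne (f v)
      (hadj v hv) ?_
    rw [hvv]
    exact hadj v' hv'
  have h4 : ((influenced G Z').filter (· ∈ S)).card + ((influenced G Z').filter (· ∉ S)).card =
      (influenced G Z').card := Finset.card_filter_add_card_filter_not _
  have h3' : (((influenced G Z').filter (· ∈ S)).card : ℝ) ≤ (Z'.filter (· ∉ S)).card := by
    exact_mod_cast h3
  rw [← h4]
  push_cast
  nlinarith

lemma IsExpanding.card_iterate_le (h : IsExpanding G S κ m) {Z : Finset V}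
    (hZ : influenced G Z ⊆ Z) (hκ : 0 ≤ κ) (hm : (Z.card : ℝ) ≤ m) (j : ℕ) :
    (((influenced G)^[2 * j] Z).card : ℝ) ≤ (2 * κ) ^ j * Z.card := by
  induction j with
  | zero => simp
  | succ j ih =>
    have e : 2 * (j + 1) = 2 * j + 1 + 1 := by ring
    rw [e, Function.iterate_succ_apply', Function.iterate_succ_apply']
    have hsub : ∀ k, (influenced G)^[k] Z ⊆ Z := by
      intro k
      induction k with
      | zero => simp
      | succ k ih =>
        rw [Function.iterate_succ_apply']
        exact (influenced_iterate_subset hZ k).trans ih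
    have hc : (((influenced G)^[2 * j] Z).card : ℝ) ≤ Z.card := by
      exact_mod_cast Finset.card_le_card (hsub _)
    refine (h.card_influenced_influenced_le (influenced_iterate_subset hZ _) hκ
      (hc.trans hm)).trans ?_
    rw [pow_succ', mul_assoc (2 * κ)]
    exact mul_le_mul_of_nonneg_left ih (by positivity)

/-- A small set is contained in a small set that is closed under influence. -/
lemma IsExpanding.exists_closed (h : IsExpanding G S κ m) {W : Finset V} (hS : S ⊆ W)
    (hκ : κ ≤ 1 / 2) (hm : 2 * (W.card : ℝ) ≤ m) :
    ∃ Z, W ⊆ Z ∧ influenced G Z ⊆ Z ∧ (Z.card : ℝ) ≤ 2 * W.card := by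
  -- The closed set is the limit of iterating `Φ` from the empty set. Nodes of `S` already lie in
  -- `W`, so an iterate of size at most 2|W| gains at most `κ * 2|W| ≤ |W|` nodes beyond `W`, and
  -- the bound 2|W| persists.
  let Φ : Finset V → Finset V := fun Q => W ∪ influenced G Q
  have hΦ : Monotone Φ := fun Q Q' hQ => Finset.union_subset_union le_rfl (influenced_mono hQ)
  have hmono : Monotone fun i => Φ^[i] ∅ :=
    hΦ.monotone_iterate_of_le_map (Finset.empty_subset _)
  obtain ⟨N, hN⟩ := WellFoundedGT.monotone_chain_condition ⟨_, hmono⟩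
  have hfix : Φ (Φ^[N] ∅) = Φ^[N] ∅ := by
    have := hN (N + 1) (by omega)
    simp only [OrderHom.coe_mk] at this
    rw [← Function.iterate_succ_apply' Φ]
    exact this.symm
  have hcard : ∀ i, ((Φ^[i] ∅).card : ℝ) ≤ 2 * W.card := by
    intro i
    induction i with
    | zero => simp
    | succ i ih =>
      rw [Function.iterate_succ_apply']
      have h1 := h.card_le _ (ih.trans hm)
      have h2 : Φ (Φ^[i] ∅) ⊆ W ∪ (influenced G (Φ^[i] ∅)).filter (· ∉ S) := by
        intro v hv
        simp only [Φ, Finset.mem_union, Finset.mem_filter] at hv ⊢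
        by_cases hvS : v ∈ S
        · exact Or.inl (hS hvS)
        · exact hv.imp_right fun h => ⟨h, hvS⟩
      have h3 : ((Φ (Φ^[i] ∅)).card : ℝ) ≤ W.card +
          ((influenced G (Φ^[i] ∅)).filter (· ∉ S)).card := by
        exact_mod_cast (Finset.card_le_card h2).trans (Finset.card_union_le _ _)
      have h4 : (0 : ℝ) ≤ (Φ^[i] ∅).card := Nat.cast_nonneg _
      nlinarith
  refine ⟨Φ^[N] ∅, ?_, ?_, hcard N⟩
  · rw [← hfix]
    exact Finset.subset_union_left
  · nth_rewrite 2 [← hfix]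
    exact Finset.subset_union_right

/-- On an expanding graph, a state with few wrong nodes reaches correct consensus. -/
lemma IsExpanding.consensus_le [Nonempty V] (h : IsExpanding G S κ m) (hκ : 0 ≤ κ)
    (hκ' : κ ≤ 1 / 2) {c : Announcements V}
    (hm : 2 * (((wrongSet c).card : ℝ) + S.card) ≤ m) (T j : ℕ)
    (hj : (2 * κ) ^ j * m < 1) :
    (avgStep G X)^[2 * j * T] ({c | wrongSet c = ∅}ᶜ.indicator 1) c ≤
      2 * j * (Fintype.card V * (1 - 1 / Fintype.card V) ^ T) := by
  have hU : ((wrongSet c ∪ S).card : ℝ) ≤ (wrongSet c).card + S.card := by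
    exact_mod_cast Finset.card_union_le _ _
  -- The exceptional set joins the wrong nodes, since the closure argument controls influence only
  -- outside `S`.
  obtain ⟨Z, hWZ, hZ, hcard⟩ := h.exists_closed (W := wrongSet c ∪ S) Finset.subset_union_right
    hκ' (by linarith)
  have hZm : (Z.card : ℝ) ≤ m := by linarith
  have hempty : (influenced G)^[2 * j] Z = ∅ := by
    have h1 := h.card_iterate_le hZ hκ hZm j
    have h2 : (2 * κ) ^ j * (Z.card : ℝ) ≤ (2 * κ) ^ j * m :=
      mul_le_mul_of_nonneg_left hZm (by positivity)
    have h3 : (((influenced G)^[2 * j] Z).card : ℝ) < 1 := by linarith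
    have h4 : ((influenced G)^[2 * j] Z).card < 1 := by exact_mod_cast h3
    exact Finset.card_eq_zero.1 (by omega)
  have := epochs_le (X := X) hZ T (2 * j) (Finset.subset_union_left.trans hWZ)
  rw [hempty] at this
  simpa using this

/-- Positive degrees matter here: an isolated node always faces a tie and would keep following its
own signal. -/
lemma IsExpanding.isTerminal (h : IsExpanding G S κ m) {c : Announcements V}
    (hc : wrongSet c = ∅) : IsTerminal G X c ∧ ∀ v, c v = some true := by
  have hall : ∀ v, c v = some true := by
    intro v
    by_contra hv
    have : v ∈ wrongSet c := by simp [wrongSet, hv]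
    simp [hc] at this
  refine ⟨fun v => ?_, hall⟩
  have hv : v ∉ influenced G (wrongSet c) := by
    have := h.deg_pos v
    simp only [hc, influenced, Finset.mem_filter, Finset.mem_univ, true_and, not_le]
    simpa [nbrsIn] using this
  rw [step, majorityOpinion_eq_true hv, ← hall v, Function.update_eq_self]

end Influenced

/-! ### Expectations over random subsets -/

section SubsetExp

variable {α : Type*} [DecidableEq α] {p : ℝ}

/-- The expectation of `F T`, where `T` is the random subset of `E` that contains every element
independently with probability `p`. -/
def subsetExp (p : ℝ) (E : Finset α) (F : Finset α → ℝ) : ℝ :=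
  ∑ T ∈ E.powerset, p ^ T.card * (1 - p) ^ (E \ T).card * F T

lemma subsetExp_mono (hp : 0 ≤ p) (hp' : p ≤ 1) {E : Finset α} {F F' : Finset α → ℝ}
    (h : ∀ T ⊆ E, F T ≤ F' T) : subsetExp p E F ≤ subsetExp p E F' := by
  have : 0 ≤ 1 - p := by linarith
  exact Finset.sum_le_sum fun T hT =>
    mul_le_mul_of_nonneg_left (h T (Finset.mem_powerset.1 hT)) (by positivity)

lemma subsetExp_congr {E : Finset α} {F F' : Finset α → ℝ}
    (h : ∀ T ⊆ E, F T = F' T) : subsetExp p E F = subsetExp p E F' :=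
  Finset.sum_congr rfl fun T hT => by rw [h T (Finset.mem_powerset.1 hT)]

/-- Expanding the product over `E` yields one term for each subset. This is the independence of the
elements. -/
lemma subsetExp_prod (E : Finset α) (f g : α → ℝ) :
    subsetExp p E (fun T => ∏ e ∈ E, if e ∈ T then f e else g e) =
      ∏ e ∈ E, (p * f e + (1 - p) * g e) := by
  rw [Finset.prod_add, subsetExp]
  refine Finset.sum_congr rfl fun T hT => ?_
  rw [Finset.prod_ite, Finset.filter_mem_eq_inter, Finset.inter_eq_right.2
    (Finset.mem_powerset.1 hT), Finset.filter_notMem_eq_sdiff, Finset.prod_mul_distrib,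
    Finset.prod_mul_distrib, Finset.prod_const, Finset.prod_const]
  ring

lemma subsetExp_insert {E : Finset α} {e : α} (he : e ∉ E) (F : Finset α → ℝ) :
    subsetExp p (insert e E) F =
      p * subsetExp p E (fun T => F (insert e T)) + (1 - p) * subsetExp p E F := by
  unfold subsetExp
  rw [Finset.sum_powerset_insert he, add_comm, Finset.mul_sum, Finset.mul_sum]
  congr 1
  · refine Finset.sum_congr rfl fun T hT => ?_
    have heT : e ∉ T := fun h => he (Finset.mem_powerset.1 hT h)
    rw [Finset.card_insert_of_notMem heT, Finset.insert_sdiff_insert,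
      Finset.sdiff_insert_of_notMem he]
    ring
  · refine Finset.sum_congr rfl fun T hT => ?_
    have heT : e ∉ T := fun h => he (Finset.mem_powerset.1 hT h)
    rw [Finset.insert_sdiff_of_notMem _ heT, Finset.card_insert_of_notMem (by simp [he])]
    ring

lemma subsetExp_mul_left (E : Finset α) (r : ℝ) (F : Finset α → ℝ) :
    subsetExp p E (fun T => r * F T) = r * subsetExp p E F := by
  unfold subsetExp
  rw [Finset.mul_sum]
  exact Finset.sum_congr rfl fun T _ => by ring

lemma subsetExp_add (E : Finset α) (F F' : Finset α → ℝ) :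
    subsetExp p E (fun T => F T + F' T) = subsetExp p E F + subsetExp p E F' := by
  unfold subsetExp
  rw [← Finset.sum_add_distrib]
  exact Finset.sum_congr rfl fun T _ => by ring

lemma subsetExp_sum {ι : Type*} (s : Finset ι) (E : Finset α) (F : ι → Finset α → ℝ) :
    subsetExp p E (fun T => ∑ i ∈ s, F i T) = ∑ i ∈ s, subsetExp p E (F i) := by
  unfold subsetExp
  rw [Finset.sum_comm]
  exact Finset.sum_congr rfl fun T _ => by rw [Finset.mul_sum]

lemma subsetExp_union {E₁ E₂ : Finset α} (h : Disjoint E₁ E₂) (F : Finset α → ℝ) :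
    subsetExp p (E₁ ∪ E₂) F = subsetExp p E₁ fun T₁ => subsetExp p E₂ fun T₂ => F (T₁ ∪ T₂) := by
  induction E₁ using Finset.induction_on generalizing F with
  | empty => simp [subsetExp]
  | insert e E₁ he ih =>
    rw [Finset.disjoint_insert_left] at h
    rw [Finset.insert_union, subsetExp_insert (by simp [he, h.1]), subsetExp_insert he,
      ih h.2, ih h.2]
    simp only [Finset.insert_union]

lemma subsetExp_card (E : Finset α) (f : ℕ → ℝ) :
    subsetExp p E (fun T => f T.card) =
      ∑ i ∈ Finset.range (E.card + 1), E.card.choose i * p ^ i * (1 - p) ^ (E.card - i) * f i := by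
  unfold subsetExp
  have h : ∀ T ∈ E.powerset, p ^ T.card * (1 - p) ^ (E \ T).card * f T.card =
      (fun i => p ^ i * (1 - p) ^ (E.card - i) * f i) T.card := by
    intro T hT
    rw [Finset.card_sdiff_of_subset (Finset.mem_powerset.1 hT)]
  rw [Finset.sum_congr rfl h,
    Finset.sum_powerset_apply_card fun i => p ^ i * (1 - p) ^ (E.card - i) * f i]
  refine Finset.sum_congr rfl fun i _ => ?_
  rw [nsmul_eq_mul]
  ring

lemma subsetExp_const (E : Finset α) (r : ℝ) : subsetExp p E (fun _ => r) = r := by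
  have := subsetExp_prod (p := p) E (fun _ => 1) (fun _ => 1)
  simp only [ite_self, Finset.prod_const_one, mul_one, add_sub_cancel] at this
  rw [show (fun _ : Finset α => r) = fun _ => r * 1 by simp, subsetExp_mul_left, this, mul_one]

end SubsetExp

/-! ### Expectations over the binomial random graph -/

section GraphExp

variable {V : Type*}

lemma fromEdgeSet_adj_iff (T : Finset (Sym2 V)) (v u : V) :
    (SimpleGraph.fromEdgeSet (T : Set (Sym2 V))).Adj v u ↔ s(v, u) ∈ T ∧ v ≠ u := by
  simp

variable [Fintype V] [DecidableEq V]

variable (V) in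
/-- The edges of the complete graph. -/
def allEdges : Finset (Sym2 V) := Finset.univ.filter fun e => ¬ e.IsDiag

/-- The expectation of a function of the binomial random graph. -/
def graphExp (p : ℝ) (F : SimpleGraph V → ℝ) : ℝ :=
  subsetExp p (allEdges V) fun T => F (SimpleGraph.fromEdgeSet (T : Set (Sym2 V)))

/-- A graph is identified with its set of edges, which links the combinatorial expectation to the
measure `SimpleGraph.binomialRandom`. -/
lemma graphExp_eq_sum (p : unitInterval) (F : SimpleGraph V → ℝ) :
    graphExp p F = ∑ G, (SimpleGraph.binomialRandom V p).real {G} * F G := by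
  classical
  unfold graphExp subsetExp
  refine Finset.sum_bij' (fun T _ => SimpleGraph.fromEdgeSet (T : Set (Sym2 V)))
    (fun G _ => G.edgeFinset) (fun _ _ => Finset.mem_univ _) ?_ ?_ ?_ ?_
  · intro G _
    rw [Finset.mem_powerset]
    intro e he
    simp only [allEdges, Finset.mem_filter, Finset.mem_univ, true_and]
    exact G.not_isDiag_of_mem_edgeFinset he
  · intro T hT
    rw [Finset.mem_powerset] at hT
    ext e
    simp only [SimpleGraph.mem_edgeFinset, SimpleGraph.edgeSet_fromEdgeSet, Set.mem_sdiff,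
      Finset.mem_coe]
    constructor
    · exact fun h => h.1
    · intro h
      refine ⟨h, ?_⟩
      have := hT h
      simpa [allEdges] using this
  · intro G _
    simp
  · intro T hT
    rw [Finset.mem_powerset] at hT
    congr 1
    have h1 : (SimpleGraph.fromEdgeSet (T : Set (Sym2 V))).edgeSet = T := by
      rw [SimpleGraph.edgeSet_fromEdgeSet]
      ext e
      simp only [Set.mem_sdiff, Finset.mem_coe]
      constructor
      · exact fun h => h.1
      · intro h
        refine ⟨h, ?_⟩
        have := hT h
        simpa [allEdges] using this
    have h2 : (allEdges V).card = (Nat.card V).choose 2 := by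
      rw [Nat.card_eq_fintype_card, ← Sym2.card_diagSet_compl, allEdges]
      rw [Fintype.card_subtype]
      congr 1
    rw [measureReal_def, SimpleGraph.binomialRandom_singleton, h1, Set.ncard_coe_finset,
      Finset.card_sdiff_of_subset hT, h2]
    simp

end GraphExp

/-! ### Independence of rows and moment generating functions -/

section GraphBounds

variable {V : Type*} [DecidableEq V]

/-- The expectation of a function of a binomial random variable. -/
def binExp (p : ℝ) (m : ℕ) (f : ℕ → ℝ) : ℝ :=
  ∑ i ∈ Finset.range (m + 1), m.choose i * p ^ i * (1 - p) ^ (m - i) * f i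

/-- The number of `u ∈ U` with the pair `s(v, u)` in `T`. -/
def rowCount (T : Finset (Sym2 V)) (v : V) (U : Finset V) : ℕ :=
  (U.filter fun u => s(v, u) ∈ T).card

lemma rowCount_union_eq {v : V} {U : Finset V} {T T' : Finset (Sym2 V)}
    (h : ∀ u ∈ U, s(v, u) ∉ T') : rowCount (T ∪ T') v U = rowCount T v U := by
  unfold rowCount
  congr 1
  refine Finset.filter_congr fun u hu => ?_
  simp [h u hu]

lemma rowCount_eq_card {v : V} {U : Finset V} {T : Finset (Sym2 V)}
    (h : T ⊆ U.image fun u => s(v, u)) : rowCount T v U = T.card := by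
  unfold rowCount
  have h1 : T = (U.filter fun u => s(v, u) ∈ T).image fun u => s(v, u) := by
    ext e
    simp only [Finset.mem_image, Finset.mem_filter]
    constructor
    · intro he
      obtain ⟨u, hu, rfl⟩ := Finset.mem_image.1 (h he)
      exact ⟨u, ⟨hu, he⟩, rfl⟩
    · rintro ⟨u, ⟨_, hu⟩, rfl⟩
      exact hu
  conv_rhs => rw [h1]
  rw [Finset.card_image_of_injective _ fun _ _ => Sym2.congr_right.1]

/-- Because `S` avoids `U₁` and `U₀`, the pairs joining different nodes of `S` to these sets are
different, and the rows can be split off one at a time. The ambient set `E` is arbitrary so that the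
induction may delete a row from it. -/
lemma subsetExp_rows (p : ℝ) {U₁ U₀ : Finset V} (hU : Disjoint U₁ U₀) (k : ℕ → ℕ → ℝ)
    (S : Finset V) (h₁ : Disjoint S U₁) (h₀ : Disjoint S U₀) (E : Finset (Sym2 V))
    (hE : ∀ v ∈ S, ∀ u ∈ U₁ ∪ U₀, s(v, u) ∈ E) :
    subsetExp p E (fun T => ∏ v ∈ S, k (rowCount T v U₁) (rowCount T v U₀)) =
      (binExp p U₁.card fun i => binExp p U₀.card fun j => k i j) ^ S.card := by
  induction S using Finset.induction_on generalizing E with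
  | empty => simp [subsetExp_const]
  | insert v S hv ih =>
    rw [Finset.disjoint_insert_left] at h₁ h₀
    set R₁ := U₁.image fun u => s(v, u) with hR₁
    set R₀ := U₀.image fun u => s(v, u) with hR₀
    have hinj : Function.Injective fun u : V => s(v, u) := fun _ _ => Sym2.congr_right.1
    have hR : Disjoint R₁ R₀ := by
      rw [hR₁, hR₀, Finset.disjoint_image hinj]
      exact hU
    have hsub : R₁ ∪ R₀ ⊆ E := by
      rw [hR₁, hR₀, ← Finset.image_union]
      intro e he
      obtain ⟨u, hu, rfl⟩ := Finset.mem_image.1 he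
      exact hE v (Finset.mem_insert_self _ _) u hu
    have hnot : ∀ w ∈ S, ∀ u ∈ U₁ ∪ U₀, s(w, u) ∉ R₁ ∪ R₀ := by
      intro w hw u hu hmem
      rw [hR₁, hR₀, ← Finset.image_union] at hmem
      obtain ⟨u', hu', he⟩ := Finset.mem_image.1 hmem
      have hwv : w ≠ v := fun h => hv (h ▸ hw)
      rw [Sym2.eq_iff] at he
      rcases he with ⟨h, _⟩ | ⟨_, h⟩
      · exact hwv h.symm
      · subst h
        rcases Finset.mem_union.1 hu' with h | h
        · exact Finset.disjoint_left.1 h₁.2 hw h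
        · exact Finset.disjoint_left.1 h₀.2 hw h
    have hEeq : E = (R₁ ∪ R₀) ∪ (E \ (R₁ ∪ R₀)) := (Finset.union_sdiff_of_subset hsub).symm
    have hih := ih h₁.2 h₀.2 (E \ (R₁ ∪ R₀)) (fun w hw u hu => Finset.mem_sdiff.2
      ⟨hE w (Finset.mem_insert_of_mem hw) u hu, hnot w hw u hu⟩)
    rw [hEeq, subsetExp_union Finset.disjoint_sdiff]
    have h2 : ∀ T₁ ⊆ R₁ ∪ R₀, (subsetExp p (E \ (R₁ ∪ R₀)) fun T₂ =>
        ∏ w ∈ insert v S, k (rowCount (T₁ ∪ T₂) w U₁) (rowCount (T₁ ∪ T₂) w U₀)) =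
        (binExp p U₁.card fun i => binExp p U₀.card fun j => k i j) ^ S.card *
          k (rowCount T₁ v U₁) (rowCount T₁ v U₀) := by
      intro T₁ hT₁
      rw [← hih, mul_comm, ← subsetExp_mul_left]
      refine subsetExp_congr fun T₂ hT₂ => ?_
      rw [Finset.prod_insert hv]
      have hvT : ∀ U ⊆ U₁ ∪ U₀, rowCount (T₁ ∪ T₂) v U = rowCount T₁ v U := by
        intro U hUU
        apply rowCount_union_eq
        intro u hu hmem
        have := (Finset.mem_sdiff.1 (hT₂ hmem)).2
        rw [hR₁, hR₀, ← Finset.image_union] at this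
        exact this (Finset.mem_image_of_mem _ (hUU hu))
      have hwT : ∀ w ∈ S, ∀ U ⊆ U₁ ∪ U₀, rowCount (T₁ ∪ T₂) w U = rowCount T₂ w U := by
        intro w hw U hUU
        rw [Finset.union_comm]
        apply rowCount_union_eq
        intro u hu hmem
        exact hnot w hw u (hUU hu) (hT₁ hmem)
      rw [hvT _ Finset.subset_union_left, hvT _ Finset.subset_union_right]
      congr 1
      refine Finset.prod_congr rfl fun w hw => ?_
      rw [hwT w hw _ Finset.subset_union_left, hwT w hw _ Finset.subset_union_right]
    rw [subsetExp_congr h2, subsetExp_mul_left, subsetExp_union hR,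
      Finset.card_insert_of_notMem hv, pow_succ]
    congr 1
    have h3 : ∀ T₁ ⊆ R₁, (subsetExp p R₀ fun T₂ =>
        k (rowCount (T₁ ∪ T₂) v U₁) (rowCount (T₁ ∪ T₂) v U₀)) =
        binExp p U₀.card fun j => k T₁.card j := by
      intro T₁ hT₁
      have h4 : ∀ T₂ ⊆ R₀, k (rowCount (T₁ ∪ T₂) v U₁) (rowCount (T₁ ∪ T₂) v U₀) =
          k T₁.card T₂.card := by
        intro T₂ hT₂
        congr 1
        · rw [rowCount_union_eq, rowCount_eq_card hT₁]
          intro u hu hmem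
          exact Finset.disjoint_left.1 hR (Finset.mem_image_of_mem _ hu) (hT₂ hmem)
        · rw [Finset.union_comm, rowCount_union_eq, rowCount_eq_card hT₂]
          intro u hu hmem
          exact Finset.disjoint_left.1 hR (hT₁ hmem) (Finset.mem_image_of_mem _ hu)
      rw [subsetExp_congr h4, subsetExp_card R₀ (fun j => k T₁.card j), hR₀,
        Finset.card_image_of_injective _ hinj]
      rfl
    rw [subsetExp_congr h3, subsetExp_card R₁ (fun i => binExp p U₀.card fun j => k i j), hR₁,
      Finset.card_image_of_injective _ hinj]
    rfl

variable [Fintype V]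

lemma graphExp_mono (p : unitInterval) {F F' : SimpleGraph V → ℝ} (h : ∀ G, F G ≤ F' G) :
    graphExp p F ≤ graphExp p F' :=
  subsetExp_mono p.2.1 p.2.2 fun _ _ => h _

lemma graphExp_sum {ι : Type*} (s : Finset ι) (p : ℝ) (F : ι → SimpleGraph V → ℝ) :
    graphExp p (fun G => ∑ i ∈ s, F i G) = ∑ i ∈ s, graphExp p (F i) :=
  subsetExp_sum s (allEdges V) fun i (T : Finset (Sym2 V)) =>
    F i (SimpleGraph.fromEdgeSet (T : Set (Sym2 V)))

lemma graphExp_mul_left (p r : ℝ) (F : SimpleGraph V → ℝ) :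
    graphExp p (fun G => r * F G) = r * graphExp p F :=
  subsetExp_mul_left _ _ _

open scoped Classical in
/-- All edges of `F` are present and `x` is raised to the number of edges in `I`. -/
lemma graphExp_subset_pow_card (p x : ℝ) {F I : Finset (Sym2 V)} (hF : F ⊆ allEdges V)
    (hI : I ⊆ allEdges V) (hFI : Disjoint F I) :
    graphExp p (fun G => (if ∀ e ∈ F, e ∈ G.edgeSet then 1 else 0) *
      x ^ (I.filter (· ∈ G.edgeSet)).card) = p ^ F.card * (1 - p + p * x) ^ I.card := by
  have hmem : ∀ T ⊆ allEdges V, ∀ e, e ∈ (SimpleGraph.fromEdgeSet (T : Set (Sym2 V))).edgeSet ↔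
      e ∈ T := by
    intro T hT e
    rw [SimpleGraph.edgeSet_fromEdgeSet]
    simp only [Set.mem_sdiff, Finset.mem_coe]
    refine ⟨fun h => h.1, fun h => ⟨h, ?_⟩⟩
    have := hT h
    simpa [allEdges] using this
  have key := subsetExp_prod (p := p) (allEdges V) (fun e => if e ∈ I then x else 1)
    (fun e => if e ∈ F then 0 else 1)
  have h2 : ∏ e ∈ allEdges V, (p * (if e ∈ I then x else 1) + (1 - p) * if e ∈ F then 0 else 1) =
      p ^ F.card * (1 - p + p * x) ^ I.card := by
    have : ∀ e ∈ allEdges V, (p * (if e ∈ I then x else 1) + (1 - p) * if e ∈ F then 0 else 1) =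
        (if e ∈ F then p else 1) * (if e ∈ I then 1 - p + p * x else 1) := by
      intro e _
      by_cases h1 : e ∈ F
      · have := Finset.disjoint_left.1 hFI h1
        simp [h1, this]
      · by_cases h2 : e ∈ I <;> simp [h1, h2]
        ring
    rw [Finset.prod_congr rfl this, Finset.prod_mul_distrib, Finset.prod_ite_mem,
      Finset.prod_ite_mem, Finset.inter_eq_right.2 hF, Finset.inter_eq_right.2 hI,
      Finset.prod_const, Finset.prod_const]
  rw [← h2, ← key, graphExp]
  refine subsetExp_congr fun T hT => ?_
  have h3 : ∏ e ∈ allEdges V, (if e ∈ T then (if e ∈ I then x else 1) else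
      if e ∈ F then 0 else 1) =
      (∏ e ∈ allEdges V, if e ∈ F then (if e ∈ T then 1 else 0) else 1) *
        ∏ e ∈ allEdges V, if e ∈ I then (if e ∈ T then x else 1) else 1 := by
    rw [← Finset.prod_mul_distrib]
    refine Finset.prod_congr rfl fun e _ => ?_
    by_cases h1 : e ∈ F
    · have := Finset.disjoint_left.1 hFI h1
      by_cases h3 : e ∈ T <;> simp [h1, this, h3]
    · by_cases h2 : e ∈ I <;> by_cases h3 : e ∈ T <;> simp [h1, h2, h3]
  rw [h3, Finset.prod_ite_mem, Finset.prod_ite_mem, Finset.inter_eq_right.2 hF,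
    Finset.inter_eq_right.2 hI]
  simp only [hmem T hT]
  congr 1
  · by_cases h : ∀ e ∈ F, e ∈ T
    · rw [if_pos h, Finset.prod_congr rfl fun e he => if_pos (h e he), Finset.prod_const_one]
    · rw [if_neg h]
      push Not at h
      obtain ⟨e, he, heT⟩ := h
      exact (Finset.prod_eq_zero he (if_neg heT)).symm
  · rw [← Finset.prod_filter, Finset.prod_const]

open scoped Classical in
/-- A bound for the moment generating function of a linear function of the adjacency matrix. -/
lemma graphExp_exp_le (p : unitInterval) (A : V → V → ℝ) :
    graphExp p (fun G => Real.exp (∑ v, ∑ u, if G.Adj v u then A v u else 0)) ≤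
      Real.exp (p / 2 * ∑ v, ∑ u, if v = u then 0 else (Real.exp (2 * A v u) - 1)) := by
  set D : Finset (V × V) := Finset.univ.filter fun x => x.1 ≠ x.2 with hD
  -- The double sum meets each edge in both orientations, so an edge has the weight `A a b + A b a`,
  -- and distinct edges are independent.
  set w : Sym2 V → ℝ := fun e => ∑ x ∈ D with s(x.1, x.2) = e, A x.1 x.2 with hw
  have hmaps : ∀ x ∈ D, s(x.1, x.2) ∈ allEdges V := by
    intro x hx
    simpa [allEdges, hD] using hx
  have h1 : graphExp p (fun G => Real.exp (∑ v, ∑ u, if G.Adj v u then A v u else 0)) =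
      subsetExp p (allEdges V) fun T => ∏ e ∈ allEdges V,
        if e ∈ T then Real.exp (w e) else 1 := by
    refine subsetExp_congr fun T hT => ?_
    have hadj := fromEdgeSet_adj_iff T
    beta_reduce
    generalize SimpleGraph.fromEdgeSet (T : Set (Sym2 V)) = G at hadj
    have h2 : ∑ v, ∑ u, (if G.Adj v u then A v u else 0)
        = ∑ e ∈ allEdges V, if e ∈ T then w e else 0 := by
      rw [← Finset.sum_product', Finset.univ_product_univ]
      have h3 : ∀ x ∈ (Finset.univ : Finset (V × V)),
          (if G.Adj x.1 x.2 then A x.1 x.2 else 0) =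
          if x.1 ≠ x.2 then (if s(x.1, x.2) ∈ T then A x.1 x.2 else 0) else 0 := by
        intro x _
        by_cases ha : s(x.1, x.2) ∈ T <;> by_cases hb : x.1 = x.2 <;> simp [hadj, ha, hb]
      rw [Finset.sum_congr rfl h3, ← Finset.sum_filter, ← Finset.sum_fiberwise_of_maps_to hmaps]
      refine Finset.sum_congr rfl fun e _ => ?_
      by_cases he : e ∈ T
      · rw [if_pos he]
        refine Finset.sum_congr rfl fun x hx => ?_
        rw [(Finset.mem_filter.1 hx).2, if_pos he]
      · rw [if_neg he]
        refine Finset.sum_eq_zero fun x hx => ?_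
        rw [(Finset.mem_filter.1 hx).2, if_neg he]
    rw [h2, Real.exp_sum]
    refine Finset.prod_congr rfl fun e _ => ?_
    split_ifs <;> simp
  rw [h1, subsetExp_prod]
  have hp : (0 : ℝ) ≤ p := p.2.1
  have hp1 : (p : ℝ) ≤ 1 := p.2.2
  calc ∏ e ∈ allEdges V, ((p : ℝ) * Real.exp (w e) + (1 - p) * 1)
      ≤ ∏ e ∈ allEdges V, Real.exp (p * (Real.exp (w e) - 1)) := by
        refine Finset.prod_le_prod (fun e _ => ?_) fun e _ => ?_
        · have := Real.exp_nonneg (w e)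
          nlinarith [mul_nonneg hp this]
        · have := Real.add_one_le_exp (p * (Real.exp (w e) - 1))
          linarith
    _ = Real.exp (p * ∑ e ∈ allEdges V, (Real.exp (w e) - 1)) := by
        rw [← Real.exp_sum, Finset.mul_sum]
    _ ≤ _ := by
        apply Real.exp_le_exp.2
        rw [div_mul_eq_mul_div, mul_div_assoc]
        refine mul_le_mul_of_nonneg_left ?_ hp
        have h5 : ∑ v, ∑ u, (if v = u then 0 else (Real.exp (2 * A v u) - 1)) =
            ∑ e ∈ allEdges V, ∑ x ∈ D with s(x.1, x.2) = e,
              (Real.exp (2 * A x.1 x.2) - 1) := by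
          rw [Finset.sum_fiberwise_of_maps_to hmaps, hD, Finset.sum_filter,
            ← Finset.univ_product_univ, Finset.sum_product]
          refine Finset.sum_congr rfl fun v _ => Finset.sum_congr rfl fun u _ => ?_
          by_cases h : v = u <;> simp [h]
        rw [h5, Finset.sum_div]
        refine Finset.sum_le_sum fun e he => ?_
        induction e using Sym2.ind with
        | _ a b =>
          have hab : a ≠ b := by simpa [allEdges] using he
          have hfib : (D.filter fun x => s(x.1, x.2) = s(a, b)) = {(a, b), (b, a)} := by
            ext ⟨x, y⟩
            simp only [hD, Finset.mem_filter, Finset.mem_univ, true_and, Sym2.eq_iff,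
              Finset.mem_insert, Finset.mem_singleton, Prod.mk.injEq]
            constructor
            · exact fun h => h.2
            · rintro (⟨rfl, rfl⟩ | ⟨rfl, rfl⟩)
              · exact ⟨hab, Or.inl ⟨rfl, rfl⟩⟩
              · exact ⟨hab.symm, Or.inr ⟨rfl, rfl⟩⟩
          have hne : (a, b) ∉ ({(b, a)} : Finset (V × V)) := by
            simp [hab]
          simp only [hw]
          rw [hfib, Finset.sum_insert hne, Finset.sum_singleton, Finset.sum_insert hne,
            Finset.sum_singleton]
          dsimp only
          rw [Real.exp_add, two_mul, two_mul, Real.exp_add, Real.exp_add]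
          -- The inequality 2xy ≤ x² + y² for the exponentials decouples the two orientations. It is
          -- the origin of the factor 2 in the exponent and of `p / 2`.
          nlinarith [sq_nonneg (Real.exp (A a b) - Real.exp (A b a))]

/-- The numbers of neighbours in `U₁` and `U₀` of the nodes of `S` are independent. -/
lemma graphExp_rows (p : ℝ) {U₁ U₀ : Finset V} (hU : Disjoint U₁ U₀) (k : ℕ → ℕ → ℝ)
    (S : Finset V) (h₁ : Disjoint S U₁) (h₀ : Disjoint S U₀) :
    graphExp p (fun G => ∏ v ∈ S, k (nbrsIn G v U₁) (nbrsIn G v U₀)) =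
      (binExp p U₁.card fun i => binExp p U₀.card fun j => k i j) ^ S.card := by
  classical
  rw [← subsetExp_rows p hU k S h₁ h₀ (allEdges V), graphExp]
  · refine subsetExp_congr fun T _ => Finset.prod_congr rfl fun v hv => ?_
    have : ∀ U, Disjoint S U →
        nbrsIn (SimpleGraph.fromEdgeSet (T : Set (Sym2 V))) v U = rowCount T v U := by
      intro U hSU
      have hadj := fromEdgeSet_adj_iff T
      generalize SimpleGraph.fromEdgeSet (T : Set (Sym2 V)) = G at hadj
      unfold nbrsIn rowCount
      congr 1
      refine Finset.filter_congr fun u hu => ?_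
      have : v ≠ u := fun h => Finset.disjoint_left.1 hSU hv (h ▸ hu)
      simp [hadj, this]
    rw [this _ h₁, this _ h₀]
  · intro v hv u hu
    have : v ≠ u := by
      rintro rfl
      rcases Finset.mem_union.1 hu with h | h
      · exact Finset.disjoint_left.1 h₁ hv h
      · exact Finset.disjoint_left.1 h₀ hv h
    simpa [allEdges] using this

end GraphBounds

/-! ### Binomial variables and the drift of a new announcement -/

section Binomial

variable {p : ℝ}

lemma binExp_mono (hp : 0 ≤ p) (hp' : p ≤ 1) {m : ℕ} {f g : ℕ → ℝ} (h : ∀ i, f i ≤ g i) :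
    binExp p m f ≤ binExp p m g := by
  have : 0 ≤ 1 - p := by linarith
  exact Finset.sum_le_sum fun i _ => mul_le_mul_of_nonneg_left (h i) (by positivity)

lemma binExp_add (m : ℕ) (f g : ℕ → ℝ) :
    binExp p m (fun i => f i + g i) = binExp p m f + binExp p m g := by
  simp only [binExp, mul_add, Finset.sum_add_distrib]

lemma binExp_mul_left (m : ℕ) (r : ℝ) (f : ℕ → ℝ) :
    binExp p m (fun i => r * f i) = r * binExp p m f := by
  simp only [binExp, Finset.mul_sum]
  exact Finset.sum_congr rfl fun i _ => by ring

lemma binExp_sub (m : ℕ) (f g : ℕ → ℝ) :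
    binExp p m (fun i => f i - g i) = binExp p m f - binExp p m g := by
  simp only [binExp, mul_sub, Finset.sum_sub_distrib]

lemma binExp_eq_subsetExp (m : ℕ) (f : ℕ → ℝ) :
    binExp p m f = subsetExp p (Finset.range m) fun T => f T.card := by
  rw [subsetExp_card, Finset.card_range]
  rfl

lemma binExp_const (m : ℕ) (r : ℝ) : binExp p m (fun _ => r) = r := by
  rw [binExp_eq_subsetExp, subsetExp_const]

/-- A sum of independent binomial random variables is binomial. -/
lemma binExp_binExp_add (a b : ℕ) (h : ℕ → ℝ) :
    (binExp p a fun i => binExp p b fun j => h (i + j)) = binExp p (a + b) h := by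
  have hd : Disjoint (Finset.range a) (Finset.Ico a (a + b)) := by
    rw [Finset.disjoint_left]
    intro x hx hx'
    simp only [Finset.mem_range, Finset.mem_Ico] at hx hx'
    omega
  have hu : Finset.range (a + b) = Finset.range a ∪ Finset.Ico a (a + b) := by
    ext x
    simp only [Finset.mem_range, Finset.mem_union, Finset.mem_Ico]
    omega
  rw [binExp_eq_subsetExp (a + b), hu, subsetExp_union hd, binExp_eq_subsetExp]
  refine subsetExp_congr fun T₁ hT₁ => ?_
  have h2 : ∀ T₂ ⊆ Finset.Ico a (a + b), h (T₁ ∪ T₂).card = h (T₁.card + T₂.card) := by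
    intro T₂ hT₂
    rw [Finset.card_union_of_disjoint (Finset.disjoint_of_subset_left hT₁
      (Finset.disjoint_of_subset_right hT₂ hd))]
  rw [subsetExp_congr h2, subsetExp_card (Finset.Ico a (a + b)) fun j => h (T₁.card + j)]
  simp [binExp]

/-- Size biasing: choosing one of the `i` successes leaves `m - 1` free trials. -/
lemma binExp_id_mul (m : ℕ) (h : ℕ → ℝ) :
    binExp p m (fun i => i * h i) = m * p * binExp p (m - 1) fun i => h (i + 1) := by
  cases m with
  | zero => simp [binExp]
  | succ m =>
    unfold binExp
    rw [Finset.sum_range_succ', Nat.add_sub_cancel, Finset.mul_sum]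
    simp only [Nat.cast_zero, zero_mul, mul_zero, add_zero]
    refine Finset.sum_congr rfl fun i _ => ?_
    have h1 : ((m + 1 : ℕ) : ℝ) * m.choose i = (m + 1).choose (i + 1) * ((i + 1 : ℕ) : ℝ) := by
      exact_mod_cast Nat.add_one_mul_choose_eq m i
    rw [Nat.add_sub_add_right]
    linear_combination (-p ^ (i + 1) * (1 - p) ^ (m - i) * h (i + 1)) * h1

/-- The likelihood ratio of two binomials with the same `p` increases with the outcome when the
first has more trials. -/
lemma choose_mul_choose_le {g b i j : ℕ} (hbg : b ≤ g) (hji : j ≤ i) :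
    g.choose j * b.choose i ≤ g.choose i * b.choose j := by
  induction i, hji using Nat.le_induction with
  | base => exact le_rfl
  | succ i _ ih =>
    have h1 := Nat.choose_succ_right_eq b i
    have h2 := Nat.choose_succ_right_eq g i
    refine Nat.le_of_mul_le_mul_right (c := i + 1) ?_ (by omega)
    calc g.choose j * b.choose (i + 1) * (i + 1) = g.choose j * b.choose i * (b - i) := by
          rw [mul_assoc, h1]; ring
      _ ≤ g.choose i * b.choose j * (g - i) := Nat.mul_le_mul ih (by omega)
      _ = g.choose (i + 1) * b.choose j * (i + 1) := by
          rw [mul_right_comm, ← h2]; ring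

/-- An antisymmetric function that is nonnegative below the diagonal has nonnegative expectation
when the first binomial variable has more trials than the second. -/
lemma binExp_antisymm_nonneg (hp : 0 ≤ p) (hp' : p ≤ 1) {g b : ℕ} (hbg : b ≤ g) {φ : ℕ → ℕ → ℝ}
    (hanti : ∀ i j, φ j i = -φ i j) (hnn : ∀ i j, j ≤ i → 0 ≤ φ i j) :
    0 ≤ binExp p g fun i => binExp p b fun j => φ i j := by
  have hq : 0 ≤ 1 - p := by linarith
  set u : ℕ → ℝ := fun i => g.choose i * p ^ i * (1 - p) ^ (g - i) with hu
  set v : ℕ → ℝ := fun j => b.choose j * p ^ j * (1 - p) ^ (b - j) with hv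
  have hu0 : ∀ i, 0 ≤ u i := fun i => by positivity
  have hv0 : ∀ i, 0 ≤ v i := fun i => by positivity
  -- Letting `j` run up to `g` as well costs nothing, since the binomial coefficients of `b` vanish
  -- there; the square range allows `i` and `j` to be swapped.
  have h1 : (binExp p g fun i => binExp p b fun j => φ i j) =
      ∑ i ∈ Finset.range (g + 1), ∑ j ∈ Finset.range (g + 1), u i * v j * φ i j := by
    unfold binExp
    refine Finset.sum_congr rfl fun i _ => ?_
    rw [Finset.mul_sum]
    have hsub : Finset.range (b + 1) ⊆ Finset.range (g + 1) :=
      Finset.range_subset_range.2 (by omega)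
    rw [← Finset.sum_subset hsub]
    · exact Finset.sum_congr rfl fun j _ => by simp only [hu, hv]; ring
    · intro j _ hj
      have : b.choose j = 0 := Nat.choose_eq_zero_of_lt (by simpa using hj)
      simp [hv, this]
  have h2 : ∀ i j, j ≤ i → u j * v i ≤ u i * v j := by
    intro i j hji
    by_cases hib : i ≤ b
    · have hc : (g.choose j : ℝ) * b.choose i ≤ g.choose i * b.choose j := by
        exact_mod_cast choose_mul_choose_le hbg hji
      have e1 : u j * v i = (g.choose j * b.choose i) * (p ^ (i + j) * (1 - p) ^ (g + b - i - j)) := by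
        have : g + b - i - j = (g - j) + (b - i) := by omega
        rw [this, pow_add, pow_add]
        simp only [hu, hv]; ring
      have e2 : u i * v j = (g.choose i * b.choose j) * (p ^ (i + j) * (1 - p) ^ (g + b - i - j)) := by
        have : g + b - i - j = (g - i) + (b - j) := by omega
        rw [this, pow_add, pow_add]
        simp only [hu, hv]; ring
      rw [e1, e2]
      exact mul_le_mul_of_nonneg_right hc (by positivity)
    · have : b.choose i = 0 := Nat.choose_eq_zero_of_lt (by omega)
      have hvi : v i = 0 := by simp [hv, this]
      rw [hvi, mul_zero]
      exact mul_nonneg (hu0 i) (hv0 j)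
  have h3 : ∀ i j, 0 ≤ (u i * v j - u j * v i) * φ i j := by
    intro i j
    rcases le_total j i with h | h
    · exact mul_nonneg (by linarith [h2 i j h]) (hnn i j h)
    · have := hnn j i h
      rw [hanti] at this
      exact mul_nonneg_of_nonpos_of_nonpos (by linarith [h2 j i h]) (by linarith)
  -- Averaging the sum with its swapped form leaves the terms `(u i * v j - u j * v i) * φ i j`,
  -- whose two factors have the same sign.
  have h4 : ∑ i ∈ Finset.range (g + 1), ∑ j ∈ Finset.range (g + 1), u i * v j * φ i j =
      ∑ i ∈ Finset.range (g + 1), ∑ j ∈ Finset.range (g + 1), -(u j * v i * φ i j) := by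
    rw [Finset.sum_comm]
    refine Finset.sum_congr rfl fun i _ => Finset.sum_congr rfl fun j _ => ?_
    rw [hanti]
    ring
  have h5 : 0 ≤ ∑ i ∈ Finset.range (g + 1), ∑ j ∈ Finset.range (g + 1),
      (u i * v j - u j * v i) * φ i j :=
    Finset.sum_nonneg fun i _ => Finset.sum_nonneg fun j _ => h3 i j
  have h6 : ∑ i ∈ Finset.range (g + 1), ∑ j ∈ Finset.range (g + 1),
      (u i * v j - u j * v i) * φ i j =
      (∑ i ∈ Finset.range (g + 1), ∑ j ∈ Finset.range (g + 1), u i * v j * φ i j) +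
      ∑ i ∈ Finset.range (g + 1), ∑ j ∈ Finset.range (g + 1), -(u j * v i * φ i j) := by
    rw [← Finset.sum_add_distrib]
    refine Finset.sum_congr rfl fun i _ => ?_
    rw [← Finset.sum_add_distrib]
    exact Finset.sum_congr rfl fun j _ => by ring
  rw [h1]
  linarith

/-- The expected sign of the announcement of a node with `i` correct and `j` incorrect
neighbours. -/
def signMean (δ : ℝ) (i j : ℕ) : ℝ := if j < i then 1 else if i < j then -1 else 2 * δ

/-- The expected sign of the announcement of a new node, when `g` nodes announce the correct and
`b` nodes the incorrect opinion. -/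
def drift (p δ : ℝ) (g b : ℕ) : ℝ := binExp p g fun i => binExp p b fun j => signMean δ i j

lemma binExp_binExp_zero (g b : ℕ) :
    (binExp p g fun i => binExp p b fun j => if i = 0 ∧ j = 0 then (1 : ℝ) else 0) =
      (1 - p) ^ (g + b) := by
  have : (binExp p g fun i => binExp p b fun j => if i = 0 ∧ j = 0 then (1 : ℝ) else 0) =
      binExp p g fun i => binExp p b fun j => (fun k => if k = 0 then (1 : ℝ) else 0) (i + j) := by
    simp
  rw [this, binExp_binExp_add g b fun k => if k = 0 then (1 : ℝ) else 0, binExp,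
    Finset.sum_range_succ']
  simp

/-- The sign is at least -1, and with probability at least 1 - δ/2 no neighbour has announced and
its mean is 2δ. The resulting bound -1 + (1 + 2δ)(1 - δ/2) is at least δ because δ ≤ 1/2. -/
lemma drift_ge_of_few (hp : 0 ≤ p) (hp' : p ≤ 1) {δ : ℝ} (hδ : 0 ≤ δ) (hδ' : δ ≤ 1 / 2) {g b : ℕ}
    (h : p * (g + b : ℕ) ≤ δ / 2) : δ ≤ drift p δ g b := by
  have h1 : (binExp p g fun i => binExp p b fun j =>
      -1 + (1 + 2 * δ) * (if i = 0 ∧ j = 0 then (1 : ℝ) else 0)) ≤ drift p δ g b := by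
    refine binExp_mono hp hp' fun i => binExp_mono hp hp' fun j => ?_
    unfold signMean
    by_cases h0 : i = 0 ∧ j = 0
    · simp [h0]
    · rw [if_neg h0]
      split_ifs <;> linarith
  simp only [binExp_add, binExp_mul_left, binExp_const] at h1
  rw [binExp_binExp_zero] at h1
  have h2 := one_add_mul_le_pow (a := -p) (by linarith) (g + b)
  rw [← sub_eq_add_neg] at h2
  nlinarith

/-- Majority is compared with copying a uniformly random announced neighbour, whose mean sign is (i
- j)/(i + j). The difference is antisymmetric and nonnegative for j ≤ i, so majority does at least
as well. Copying has mean (g - b)/(g + b) ≥ ρ given that an announced neighbour exists; otherwise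
the signal has mean 2δ ≥ ρ. -/
lemma drift_ge_of_biased (hp : 0 ≤ p) (hp' : p ≤ 1) {δ ρ : ℝ} (hδ : 0 ≤ δ) (hρ : 0 ≤ ρ)
    (hρ' : ρ ≤ 2 * δ) {g b : ℕ} (h : ρ * (g + b) ≤ (g : ℝ) - b) : ρ ≤ drift p δ g b := by
  have hbg : b ≤ g := by
    have : (b : ℝ) ≤ g := by
      have : 0 ≤ ρ * ((g : ℝ) + b) := by positivity
      linarith
    exact_mod_cast this
  have hq : 0 ≤ 1 - p := by linarith
  -- Since the inverse of 0 is 0, `r` vanishes when there is no announced neighbour, and that event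
  -- contributes only through the signal.
  set r : ℕ → ℕ → ℝ := fun i j => ((i : ℝ) - j) * ((i + j : ℕ) : ℝ)⁻¹ with hr
  set C := p * binExp p (g + b - 1) fun k => (((k + 1 : ℕ) : ℝ))⁻¹ with hC
  set P := (1 - p) ^ (g + b) with hP
  have hE1 : (binExp p g fun i => binExp p b fun j => (i : ℝ) * ((i + j : ℕ) : ℝ)⁻¹) = g * C := by
    simp only [binExp_mul_left]
    rw [binExp_id_mul g fun i => binExp p b fun j => ((i + j : ℕ) : ℝ)⁻¹]
    rcases Nat.eq_zero_or_pos g with h0 | h0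
    · simp [h0]
    · have : (fun i => binExp p b fun j => ((i + 1 + j : ℕ) : ℝ)⁻¹) =
          fun i => binExp p b fun j => (fun k : ℕ => (((k + 1 : ℕ) : ℝ))⁻¹) (i + j) := by
        ext i
        congr 1
        ext j
        congr 2
        ring
      rw [this, binExp_binExp_add (g - 1) b fun k : ℕ => (((k + 1 : ℕ) : ℝ))⁻¹, hC,
        show g - 1 + b = g + b - 1 by omega]
      ring
  have hE2 : (binExp p g fun i => binExp p b fun j => (j : ℝ) * ((i + j : ℕ) : ℝ)⁻¹) = b * C := by
    have h1 : ∀ i, (binExp p b fun j => (j : ℝ) * ((i + j : ℕ) : ℝ)⁻¹) =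
        b * p * binExp p (b - 1) fun j => ((i + (j + 1) : ℕ) : ℝ)⁻¹ :=
      fun i => binExp_id_mul b fun j => ((i + j : ℕ) : ℝ)⁻¹
    simp only [h1, binExp_mul_left]
    rcases Nat.eq_zero_or_pos b with h0 | h0
    · simp [h0]
    · have := binExp_binExp_add (p := p) g (b - 1) fun k : ℕ => (((k + 1 : ℕ) : ℝ))⁻¹
      simp only [← add_assoc] at this ⊢
      rw [this, hC, show g + (b - 1) = g + b - 1 by omega]
      ring
  have hEr : (binExp p g fun i => binExp p b fun j => r i j) = ((g : ℝ) - b) * C := by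
    simp only [hr, sub_mul, binExp_sub, hE1, hE2]
  -- The constant `C` need not be evaluated: the shares i/(i + j) and j/(i + j) add up to 1 unless
  -- both counts vanish.
  have hsum : ((g : ℝ) + b) * C = 1 - P := by
    have h1 : (binExp p g fun i => binExp p b fun j => ((i : ℝ) * ((i + j : ℕ) : ℝ)⁻¹ +
        (j : ℝ) * ((i + j : ℕ) : ℝ)⁻¹)) = g * C + b * C := by
      simp only [binExp_add, hE1, hE2]
    have h2 : (fun i : ℕ => binExp p b fun j : ℕ => ((i : ℝ) * ((i + j : ℕ) : ℝ)⁻¹ +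
        (j : ℝ) * ((i + j : ℕ) : ℝ)⁻¹)) = fun i => binExp p b fun j =>
          (1 - if i = 0 ∧ j = 0 then (1 : ℝ) else 0) := by
      ext i
      congr 1
      ext j
      rw [← add_mul, ← Nat.cast_add]
      by_cases h0 : i = 0 ∧ j = 0
      · simp [h0]
      · have : ((i + j : ℕ) : ℝ) ≠ 0 := by
          rw [Nat.cast_ne_zero]
          omega
        rw [mul_inv_cancel₀ this, if_neg h0, sub_zero]
    rw [h2] at h1
    simp only [binExp_sub, binExp_const] at h1
    rw [binExp_binExp_zero] at h1
    linarith
  set φ : ℕ → ℕ → ℝ := fun i j => signMean 0 i j - r i j with hφ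
  have hnn : 0 ≤ binExp p g fun i => binExp p b fun j => φ i j := by
    refine binExp_antisymm_nonneg hp hp' hbg ?_ ?_
    · intro i j
      have : r j i = - r i j := by
        simp only [hr]
        rw [add_comm j i]
        ring
      simp only [hφ, this, signMean]
      rcases lt_trichotomy i j with h | h | h
      · simp [h, not_lt.2 h.le]; ring
      · simp [h]
      · simp [h, not_lt.2 h.le]; ring
    · intro i j hji
      rcases hji.lt_or_eq with h | h
      · have h1 : r i j ≤ 1 := by
          simp only [hr]
          have hpos : (0 : ℝ) < ((i + j : ℕ) : ℝ) := by
            rw [Nat.cast_pos]; omega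
          rw [← div_eq_mul_inv, div_le_one hpos]
          push_cast
          linarith [(Nat.cast_nonneg j : (0 : ℝ) ≤ j)]
        simp only [hφ, signMean, if_pos h]
        linarith
      · simp [hφ, hr, signMean, h]
  have hle : (binExp p g fun i => binExp p b fun j => (φ i j + r i j +
      2 * δ * if i = 0 ∧ j = 0 then (1 : ℝ) else 0)) ≤ drift p δ g b := by
    refine binExp_mono hp hp' fun i => binExp_mono hp hp' fun j => ?_
    simp only [hφ, signMean, sub_add_cancel]
    by_cases h0 : i = 0 ∧ j = 0
    · simp [h0]
    · rw [if_neg h0]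
      split_ifs <;> linarith
  simp only [binExp_add, binExp_mul_left] at hle
  rw [binExp_binExp_zero, hEr] at hle
  have hP0 : 0 ≤ P := by positivity
  have hC0 : 0 ≤ C := mul_nonneg hp (Finset.sum_nonneg fun i _ => by positivity)
  have h7 : ρ * (((g : ℝ) + b) * C) ≤ ((g : ℝ) - b) * C := by
    rw [← mul_assoc]
    exact mul_le_mul_of_nonneg_right h hC0
  rw [hsum] at h7
  nlinarith

end Binomial

/-! ### Typical signs, uniformly over all states with few announcements -/

section Signals

variable {V : Type*} [Fintype V]

lemma signalWeight_nonneg {δ : ℝ} (hδ : 0 ≤ δ) (hδ' : δ ≤ 1 / 2) (X : V → Bool) :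
    0 ≤ ∏ v, if X v then 1 / 2 + δ else 1 / 2 - δ :=
  Finset.prod_nonneg fun v _ => by split_ifs <;> linarith

/-- The nodes that announce `x`. -/
def announcing (c : Announcements V) (x : Option Bool) : Finset V :=
  Finset.univ.filter fun v => c v = x

lemma disjoint_announcing (c : Announcements V) {x y : Option Bool} (h : x ≠ y) :
    Disjoint (announcing c x) (announcing c y) := by
  rw [announcing, announcing, Finset.disjoint_filter]
  rintro v - rfl h'
  exact h h'

lemma card_announcing_some (c : Announcements V) :
    (((announcing c (some true)).card + (announcing c (some false)).card : ℕ) : ℝ) =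
      announcedCount c := by
  unfold announcing
  rw [Finset.card_filter, Finset.card_filter, ← Finset.sum_add_distrib, announcedCount, tally]
  push_cast
  refine Finset.sum_congr rfl fun v _ => ?_
  rcases c v with _ | _ | _ <;> simp

lemma card_announcing_none (c : Announcements V) :
    ((announcing c none).card : ℝ) = Fintype.card V - announcedCount c := by
  unfold announcing
  rw [Finset.card_filter, announcedCount, tally, eq_sub_iff_add_eq]
  push_cast
  rw [← Finset.sum_add_distrib, ← Finset.card_univ, ← nsmul_one, ← Finset.sum_const]
  refine Finset.sum_congr rfl fun v _ => ?_
  rcases c v with _ | _ | _ <;> simp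

lemma bias_eq_card_sub (c : Announcements V) :
    bias c = (announcing c (some true)).card - (announcing c (some false)).card := by
  unfold announcing
  rw [Finset.card_filter, Finset.card_filter, bias, tally]
  push_cast
  rw [← Finset.sum_sub_distrib]
  refine Finset.sum_congr rfl fun v _ => ?_
  rcases c v with _ | _ | _ <;> simp [voteSign]

variable [DecidableEq V]

/-- The expectation of a function of the private signals. -/
def signalExp (δ : ℝ) (F : (V → Bool) → ℝ) : ℝ :=
  ∑ X : V → Bool, (∏ v, if X v then 1 / 2 + δ else 1 / 2 - δ) * F X

/-- The joint expectation over the random graph and the private signals. -/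
def pairExp (p δ : ℝ) (F : SimpleGraph V → (V → Bool) → ℝ) : ℝ :=
  graphExp p fun G => signalExp δ (F G)

lemma signalExp_mono {δ : ℝ} (hδ : 0 ≤ δ) (hδ' : δ ≤ 1 / 2) {F F' : (V → Bool) → ℝ}
    (h : ∀ X, F X ≤ F' X) : signalExp δ F ≤ signalExp δ F' :=
  Finset.sum_le_sum fun X _ => mul_le_mul_of_nonneg_left (h X) (signalWeight_nonneg hδ hδ' X)

lemma signalExp_mul_left (δ r : ℝ) (F : (V → Bool) → ℝ) :
    signalExp δ (fun X => r * F X) = r * signalExp δ F := by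
  unfold signalExp
  rw [Finset.mul_sum]
  exact Finset.sum_congr rfl fun X _ => by ring

lemma signalExp_sum {ι : Type*} (s : Finset ι) (δ : ℝ) (F : ι → (V → Bool) → ℝ) :
    signalExp δ (fun X => ∑ i ∈ s, F i X) = ∑ i ∈ s, signalExp δ (F i) := by
  unfold signalExp
  rw [Finset.sum_comm]
  exact Finset.sum_congr rfl fun X _ => by rw [Finset.mul_sum]

lemma signalExp_prod (δ : ℝ) (S : Finset V) (h : V → Bool → ℝ) :
    signalExp δ (fun X => ∏ v ∈ S, h v (X v)) =
      ∏ v ∈ S, ((1 / 2 + δ) * h v true + (1 / 2 - δ) * h v false) := by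
  have key := Finset.prod_univ_sum (fun _ : V => (Finset.univ : Finset Bool))
    fun v x => (if x then 1 / 2 + δ else 1 / 2 - δ) * if v ∈ S then h v x else 1
  rw [Fintype.piFinset_univ] at key
  have h1 : ∏ v, ∑ x : Bool, ((if x then 1 / 2 + δ else 1 / 2 - δ) * if v ∈ S then h v x else 1) =
      ∏ v ∈ S, ((1 / 2 + δ) * h v true + (1 / 2 - δ) * h v false) := by
    rw [← Finset.prod_subset (Finset.subset_univ S)]
    · refine Finset.prod_congr rfl fun v hv => ?_
      simp [hv]
    · intro v _ hv
      simp [hv]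
      norm_num
  rw [← h1, key, signalExp]
  refine Finset.sum_congr rfl fun X _ => ?_
  rw [Finset.prod_mul_distrib, Finset.prod_ite_mem, Finset.univ_inter]

lemma pairExp_mono (p : unitInterval) {δ : ℝ} (hδ : 0 ≤ δ) (hδ' : δ ≤ 1 / 2)
    {F F' : SimpleGraph V → (V → Bool) → ℝ} (h : ∀ G X, F G X ≤ F' G X) :
    pairExp p δ F ≤ pairExp p δ F' :=
  graphExp_mono p fun G => signalExp_mono hδ hδ' (h G)

lemma pairExp_mul_left (p δ r : ℝ) (F : SimpleGraph V → (V → Bool) → ℝ) :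
    pairExp p δ (fun G X => r * F G X) = r * pairExp p δ F := by
  simp only [pairExp, signalExp_mul_left, graphExp_mul_left]

lemma pairExp_sum {ι : Type*} (s : Finset ι) (p δ : ℝ) (F : ι → SimpleGraph V → (V → Bool) → ℝ) :
    pairExp p δ (fun G X => ∑ i ∈ s, F i G X) = ∑ i ∈ s, pairExp p δ (F i) := by
  simp only [pairExp, signalExp_sum, graphExp_sum]

/-- The sum of the signs that the nodes without an announcement would announce if selected. -/
def newSigns (G : SimpleGraph V) (X : V → Bool) (c : Announcements V) : ℝ :=
  ∑ v ∈ announcing c none, voteSign (some (majorityOpinion G X c v))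

/-- For a fixed state, the edges from silent nodes to announced nodes form independent rows and the
signals are independent, so the moment generating function is a power. Each factor is at most 1 - θ
drift + θ². -/
lemma pairExp_exp_newSigns_le (p : unitInterval) {δ θ : ℝ} (hδ : 0 ≤ δ) (hδ' : δ ≤ 1 / 2)
    (hθ : 0 ≤ θ) (hθ' : θ ≤ 1) (c : Announcements V) :
    pairExp p δ (fun G X => Real.exp (-(θ * newSigns G X c))) ≤
      Real.exp ((announcing c none).card * (-(θ * drift p δ (announcing c (some true)).card
        (announcing c (some false)).card) + θ ^ 2)) := by
  have hp : (0 : ℝ) ≤ p := p.2.1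
  have hp1 : (p : ℝ) ≤ 1 := p.2.2
  set U₁ := announcing c (some true) with hU₁
  set U₀ := announcing c (some false) with hU₀
  set S := announcing c none with hS
  -- `K i j` is the exponential moment averaged over the signal of a node with `i` correct and `j`
  -- incorrect neighbours; the signal matters only when `i = j`.
  let K : ℕ → ℕ → ℝ := fun i j => (1 / 2 + δ) *
    Real.exp (-(θ * voteSign (some (if j < i then true else if i < j then false else true)))) +
    (1 / 2 - δ) *
    Real.exp (-(θ * voteSign (some (if j < i then true else if i < j then false else false))))
  have hmaj : ∀ G X v, majorityOpinion G X c v =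
      if nbrsIn G v U₀ < nbrsIn G v U₁ then true else if nbrsIn G v U₁ < nbrsIn G v U₀ then false
        else X v := by
    intro G X v
    rw [majorityOpinion, neighbourCount_eq_nbrsIn, neighbourCount_eq_nbrsIn]
    rfl
  have h1 : ∀ G : SimpleGraph V, signalExp δ (fun X => Real.exp (-(θ * newSigns G X c))) =
      ∏ v ∈ S, K (nbrsIn G v U₁) (nbrsIn G v U₀) := by
    intro G
    have := signalExp_prod δ S fun v x => Real.exp (-(θ * voteSign (some
      (if nbrsIn G v U₀ < nbrsIn G v U₁ then true else if nbrsIn G v U₁ < nbrsIn G v U₀ then false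
        else x))))
    simp only [K]
    rw [← this]
    congr 1
    ext X
    rw [newSigns, Finset.mul_sum, ← Finset.sum_neg_distrib, Real.exp_sum]
    simp only [hmaj]
    rfl
  unfold pairExp
  simp only [h1]
  rw [graphExp_rows p (disjoint_announcing c (by simp)) K S (disjoint_announcing c (by simp))
    (disjoint_announcing c (by simp))]
  have e1 : Real.exp (-θ) ≤ 1 - θ + θ ^ 2 := exp_neg_le (by rwa [abs_of_nonneg hθ])
  have e2 : Real.exp θ ≤ 1 + θ + θ ^ 2 := by
    have := exp_neg_le (x := -θ) (by rwa [abs_neg, abs_of_nonneg hθ])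
    simpa using this
  have hK : ∀ i j, K i j ≤ (1 + θ ^ 2) - θ * signMean δ i j := by
    intro i j
    simp only [K, signMean]
    rcases lt_trichotomy i j with h | h | h
    · simp only [h, not_lt.2 h.le, if_true, if_false, voteSign]
      simp only [mul_neg, mul_one, neg_neg]
      nlinarith
    · simp only [h, lt_irrefl, if_false, voteSign]
      simp only [mul_neg, mul_one, neg_neg]
      nlinarith
    · simp only [h, if_true, voteSign]
      simp only [mul_one]
      nlinarith
  have hK0 : ∀ i j, 0 ≤ K i j := by
    intro i j
    have : 0 ≤ 1 / 2 - δ := by linarith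
    simp only [K]
    positivity
  have h2 : (binExp p U₁.card fun i => binExp p U₀.card fun j => K i j) ≤
      (1 + θ ^ 2) - θ * drift p δ U₁.card U₀.card := by
    refine (binExp_mono hp hp1 fun i => binExp_mono hp hp1 fun j => hK i j).trans (le_of_eq ?_)
    simp only [binExp_sub, binExp_mul_left, binExp_const]
    rfl
  have h3 : 0 ≤ binExp p U₁.card fun i => binExp p U₀.card fun j => K i j := by
    have := binExp_mono hp hp1 (m := U₁.card) (f := fun _ => 0)
      (g := fun i => binExp p U₀.card fun j => K i j) (fun i => by
        have := binExp_mono hp hp1 (m := U₀.card) (f := fun _ => 0) (g := fun j => K i j) (hK0 i)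
        rwa [binExp_const] at this)
    rwa [binExp_const] at this
  calc _ ≤ ((1 + θ ^ 2) - θ * drift p δ U₁.card U₀.card) ^ S.card := pow_le_pow_left₀ h3 h2 _
    _ ≤ (Real.exp (-(θ * drift p δ U₁.card U₀.card) + θ ^ 2)) ^ S.card := by
        refine pow_le_pow_left₀ (h3.trans h2) ?_ _
        have := Real.add_one_le_exp (-(θ * drift p δ U₁.card U₀.card) + θ ^ 2)
        linarith
    _ = _ := by rw [← Real.exp_nat_mul]

/-- Generating function of the states by number of announcements: each node is silent or has two
ways to announce. It replaces a count of the states with few announcements. -/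
lemma sum_pow_announced (x : ℝ) :
    ∑ c : Announcements V, ∏ v, (if c v = none then 1 else x) = (1 + 2 * x) ^ Fintype.card V := by
  have key := Finset.prod_univ_sum (fun _ : V => (Finset.univ : Finset (Option Bool)))
    fun _ y => if y = none then 1 else x
  rw [Fintype.piFinset_univ] at key
  rw [← key, Finset.prod_const, Finset.card_univ]
  congr 1
  simp [Fintype.sum_option]

/-- The signs of new announcements are close to their expectation, for all states with few
announcements. -/
def HasTypicalSigns (p δ ε : ℝ) (m : ℕ) (G : SimpleGraph V) (X : V → Bool) : Prop :=
  ∀ c : Announcements V, announcedCount c ≤ m →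
    (announcing c none).card * drift p δ (announcing c (some true)).card
      (announcing c (some false)).card - ε * Fintype.card V ≤ newSigns G X c

-- Union bound over states by weights: x^(announcements - m) is at least 1 on the states concerned,
-- and the weights of all states sum to (1 + 2x)^n x^(-m). The choice θ = ε/2 turns -θε + θ² into
-- -ε²/4.
open scoped Classical in
lemma pairExp_not_hasTypicalSigns_le (p : unitInterval) {δ ε x : ℝ} (hδ : 0 ≤ δ)
    (hδ' : δ ≤ 1 / 2) (hε : 0 ≤ ε) (hε' : ε ≤ 2) (hx : 0 < x) (hx' : x ≤ 1) (m : ℕ) :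
    pairExp p δ (fun (G : SimpleGraph V) X => if HasTypicalSigns p δ ε m G X then 0 else 1) ≤
      (1 + 2 * x) ^ Fintype.card V * (x ^ m)⁻¹ * Real.exp (-(ε ^ 2 / 4 * Fintype.card V)) := by
  set n : ℝ := (Fintype.card V : ℝ) with hn
  set θ := ε / 2 with hθ
  have hθ0 : 0 ≤ θ := by positivity
  let M : Announcements V → ℝ := fun c => (announcing c none).card * drift p δ
    (announcing c (some true)).card (announcing c (some false)).card - ε * n
  let wt : Announcements V → ℝ := fun c => (∏ v, (if c v = none then 1 else x)) * (x ^ m)⁻¹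
  have hwt0 : ∀ c, 0 ≤ wt c := by
    intro c
    refine mul_nonneg (Finset.prod_nonneg fun v _ => ?_) (by positivity)
    split_ifs <;> linarith
  have hwt1 : ∀ c, announcedCount c ≤ m → 1 ≤ wt c := by
    intro c hc
    have h1 : (∏ v, (if c v = none then 1 else x)) =
        x ^ (Finset.univ.filter fun v => ¬ c v = none).card := by
      rw [Finset.prod_ite]
      simp
    have h2 : ((Finset.univ.filter fun v => ¬ c v = none).card : ℝ) = announcedCount c := by
      rw [Finset.card_filter, announcedCount, tally]
      push_cast
      refine Finset.sum_congr rfl fun v _ => ?_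
      by_cases h : c v = none <;> simp [h]
    rw [← h2] at hc
    have h3 : (Finset.univ.filter fun v => ¬ c v = none).card ≤ m := by exact_mod_cast hc
    simp only [wt]
    rw [h1, ← div_eq_mul_inv, one_le_div (by positivity)]
    exact pow_le_pow_of_le_one hx.le hx' h3
  have h1 : ∀ (G : SimpleGraph V) X, (if HasTypicalSigns p δ ε m G X then (0 : ℝ) else 1) ≤
      ∑ c, wt c * Real.exp (θ * M c) * Real.exp (-(θ * newSigns G X c)) := by
    intro G X
    have hnn : ∀ c ∈ (Finset.univ : Finset (Announcements V)),
        0 ≤ wt c * Real.exp (θ * M c) * Real.exp (-(θ * newSigns G X c)) := by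
      intro c _
      have := hwt0 c
      positivity
    split_ifs with h
    · exact Finset.sum_nonneg hnn
    · unfold HasTypicalSigns at h
      push Not at h
      obtain ⟨c, hc, hlt⟩ := h
      refine le_trans ?_ (Finset.single_le_sum hnn (Finset.mem_univ c))
      rw [mul_assoc, ← Real.exp_add]
      refine one_le_mul_of_one_le_of_one_le (hwt1 c hc) (Real.one_le_exp ?_)
      have : newSigns G X c ≤ M c := hlt.le
      nlinarith
  refine (pairExp_mono p hδ hδ' h1).trans ?_
  rw [pairExp_sum]
  have h2 : ∀ c : Announcements V, pairExp p δ (fun G X =>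
      wt c * Real.exp (θ * M c) * Real.exp (-(θ * newSigns G X c))) ≤
      wt c * Real.exp (-(ε ^ 2 / 4 * n)) := by
    intro c
    rw [pairExp_mul_left, mul_assoc]
    refine mul_le_mul_of_nonneg_left ?_ (hwt0 c)
    refine (mul_le_mul_of_nonneg_left (pairExp_exp_newSigns_le p hδ hδ' hθ0 (by linarith) c)
      (Real.exp_nonneg _)).trans ?_
    rw [← Real.exp_add]
    apply Real.exp_le_exp.2
    have h3 : ((announcing c none).card : ℝ) ≤ n := by
      rw [hn]
      exact_mod_cast Finset.card_le_univ _
    simp only [M, hθ]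
    nlinarith [sq_nonneg ε]
  refine (Finset.sum_le_sum fun c _ => h2 c).trans (le_of_eq ?_)
  rw [← Finset.sum_mul, ← Finset.sum_mul, sum_pow_announced]

lemma drift_le_one {p δ : ℝ} (hp : 0 ≤ p) (hp' : p ≤ 1) (hδ' : δ ≤ 1 / 2) (g b : ℕ) :
    drift p δ g b ≤ 1 := by
  have : drift p δ g b ≤ binExp p g fun _ => binExp p b fun _ => 1 := by
    refine binExp_mono hp hp' fun i => binExp_mono hp hp' fun j => ?_
    unfold signMean
    split_ifs <;> linarith
  simpa only [binExp_const] using this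

/-- Each node that has already announced can lower the sum by 2. Replacing the number of silent
nodes by n costs at most one more for each, because the drift is at most 1. -/
lemma HasTypicalSigns.le_sum_bias_step {p δ ε : ℝ} {m : ℕ} {G : SimpleGraph V} {X : V → Bool}
    (h : HasTypicalSigns p δ ε m G X) (hp : 0 ≤ p) (hp' : p ≤ 1) (hδ' : δ ≤ 1 / 2)
    {c : Announcements V} (hc : announcedCount c ≤ m) :
    Fintype.card V * drift p δ (announcing c (some true)).card (announcing c (some false)).card -
      ε * Fintype.card V - 3 * announcedCount c ≤ ∑ v, (bias (step G X c v) - bias c) := by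
  have h1 := h c hc
  have h2 : newSigns G X c - 2 * announcedCount c ≤ ∑ v, (bias (step G X c v) - bias c) := by
    have : newSigns G X c = ∑ v, if c v = none then
        voteSign (some (majorityOpinion G X c v)) else 0 := by
      rw [newSigns, announcing, Finset.sum_filter]
    rw [this, announcedCount, tally, Finset.mul_sum, ← Finset.sum_sub_distrib]
    refine Finset.sum_le_sum fun v _ => ?_
    rw [bias_step]
    have h3 := abs_le.1 (abs_voteSign_le (some (majorityOpinion G X c v)))
    have h4 := abs_le.1 (abs_voteSign_le (c v))
    split_ifs with h
    · simp [h, voteSign]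
    · linarith
  rw [card_announcing_none] at h1
  have h5 := drift_le_one hp hp' hδ' (announcing c (some true)).card (announcing c (some false)).card
  nlinarith [announcedCount_nonneg c]

end Signals

/-! ### Few weak nodes in biased states, and small set expansion -/

section Mixing

variable {V : Type*} [Fintype V]

open scoped Classical in
lemma sum_adj_voteSign (G : SimpleGraph V) (c : Announcements V) (v : V) :
    ∑ u, (if G.Adj v u then voteSign (c u) else 0) =
      nbrsIn G v (announcing c (some true)) - nbrsIn G v (announcing c (some false)) := by
  unfold nbrsIn announcing
  rw [Finset.filter_filter, Finset.filter_filter, Finset.card_filter, Finset.card_filter]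
  push_cast
  rw [← Finset.sum_sub_distrib]
  refine Finset.sum_congr rfl fun u _ => ?_
  by_cases h : G.Adj v u
  · simp only [h, if_true, and_true]
    rcases c u with _ | _ | _ <;> simp [voteSign]
  · simp [h]

/-- The nodes with at least as many incorrect as correct neighbours. -/
def weakSet (G : SimpleGraph V) (c : Announcements V) : Finset V :=
  Finset.univ.filter fun v =>
    nbrsIn G v (announcing c (some true)) ≤ nbrsIn G v (announcing c (some false))

lemma misledSet_subset_weakSet (G : SimpleGraph V) (X : V → Bool) (c : Announcements V) :
    misledSet G X c ⊆ weakSet G c := by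
  intro v
  simp only [misledSet, weakSet, Finset.mem_filter, Finset.mem_univ, true_and]
  intro h
  by_contra hlt
  rw [not_le, announcing, announcing] at hlt
  rw [majorityOpinion, neighbourCount_eq_nbrsIn, neighbourCount_eq_nbrsIn, if_pos hlt] at h
  simp at h

variable [DecidableEq V]

-- At tilt ρ/4, a row of `S` contributes at most -(ρ/2) bias + (ρ²/4) a + ρ/2 with a announcements,
-- the last term paying for the absent loop. The lead ρa and the hypothesis ρa ≥ 4 make this at most
-- -ρ²a/8; the prefactor p/2 then gives 1/16.
open scoped Classical in
lemma graphExp_exp_votes_le (p : unitInterval) {ρ : ℝ} (hρ : 0 < ρ) (hρ' : ρ ≤ 1)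
    {c : Announcements V} (hc : 4 / ρ ≤ announcedCount c) (hb : ρ * announcedCount c ≤ bias c)
    (S : Finset V) :
    graphExp p (fun G => Real.exp (∑ v, ∑ u, if G.Adj v u then
        (if v ∈ S then -(ρ / 4 * voteSign (c u)) else 0) else 0)) ≤
      Real.exp (-(p * S.card * (ρ ^ 2 * announcedCount c / 16))) := by
  refine (graphExp_exp_le p _).trans (Real.exp_le_exp.2 ?_)
  have hp : (0 : ℝ) ≤ p := p.2.1
  set a := announcedCount c with ha
  have h1 : ∀ v ∈ S, ∑ u, (if v = u then 0 else
      (Real.exp (2 * (if v ∈ S then -(ρ / 4 * voteSign (c u)) else 0)) - 1)) ≤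
      -(ρ ^ 2 * a / 8) := by
    intro v hv
    have h2 : ∀ u, (if v = u then 0 else
        (Real.exp (2 * (if v ∈ S then -(ρ / 4 * voteSign (c u)) else 0)) - 1)) ≤
        -(ρ / 2) * voteSign (c u) + ρ ^ 2 / 4 * (if c u = none then 0 else 1) +
          ρ / 2 * (if v = u then 1 else 0) := by
      intro u
      have hs := abs_le.1 (abs_voteSign_le (c u))
      by_cases h : v = u
      · simp only [h, if_true]
        have : (0 : ℝ) ≤ ρ ^ 2 / 4 * (if c u = none then 0 else 1) := by
          split_ifs <;> positivity
        nlinarith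
      · simp only [h, if_false, hv, if_true]
        have h3 := exp_neg_le (x := ρ / 2 * voteSign (c u)) (by
          rw [abs_mul, abs_of_pos (by linarith)]
          have := abs_voteSign_le (c u)
          nlinarith [abs_nonneg (voteSign (c u))])
        have h4 : voteSign (c u) ^ 2 = if c u = none then 0 else 1 := by
          rcases c u with _ | _ | _ <;> simp [voteSign]
        rw [← h4]
        have : 2 * -(ρ / 4 * voteSign (c u)) = -(ρ / 2 * voteSign (c u)) := by ring
        rw [this]
        nlinarith
    refine (Finset.sum_le_sum fun u _ => h2 u).trans ?_
    rw [Finset.sum_add_distrib, Finset.sum_add_distrib, ← Finset.mul_sum, ← Finset.mul_sum,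
      ← Finset.mul_sum]
    have e1 : ∑ u, voteSign (c u) = bias c := rfl
    have e2 : ∑ u, (if c u = none then (0 : ℝ) else 1) = a := rfl
    rw [e1, e2]
    simp only [Finset.sum_ite_eq, Finset.mem_univ, if_true]
    have h5 : 4 ≤ ρ * a := by
      rw [div_le_iff₀ hρ] at hc
      linarith
    nlinarith
  have h2 : ∑ v, ∑ u, (if v = u then 0 else
      (Real.exp (2 * (if v ∈ S then -(ρ / 4 * voteSign (c u)) else 0)) - 1)) ≤
      S.card * -(ρ ^ 2 * a / 8) := by
    rw [← nsmul_eq_mul, ← Finset.sum_const, ← Finset.sum_subset (Finset.subset_univ S)]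
    · exact Finset.sum_le_sum h1
    · intro v _ hv
      simp [hv]
  have := mul_le_mul_of_nonneg_left h2 (by positivity : (0 : ℝ) ≤ (p : ℝ) / 2)
  linarith

/-- In every sufficiently large biased state, few nodes have no majority of correct neighbours. -/
def HasFewWeak (ρ ε m : ℝ) (G : SimpleGraph V) : Prop :=
  ∀ c : Announcements V, m ≤ announcedCount c → ρ * announcedCount c ≤ bias c →
    ((weakSet G c).card : ℝ) ≤ ε * Fintype.card V

-- Union bound over all pairs of a state and a node set. With the weak set itself as `S` the tilted
-- sum is nonnegative, an event of probability at most exp(-4n) by `hpm`, and there are 3^n · 2^n =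
-- 6^n ≤ exp(2n) pairs.
open scoped Classical in
lemma graphExp_not_hasFewWeak_le (p : unitInterval) {ρ ε m : ℝ} (hρ : 0 < ρ) (hρ' : ρ ≤ 1)
    (hm : 4 / ρ ≤ m) (hpm : 64 ≤ p * m * ρ ^ 2 * ε) :
    graphExp p (fun G : SimpleGraph V => if HasFewWeak ρ ε m G then 0 else 1) ≤
      Real.exp (-(2 * Fintype.card V)) := by
  set n : ℝ := (Fintype.card V : ℝ) with hn
  have hn0 : 0 ≤ n := Nat.cast_nonneg _
  have hp : (0 : ℝ) ≤ p := p.2.1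
  let I : Finset (Announcements V × Finset V) := Finset.univ.filter fun x =>
    m ≤ announcedCount x.1 ∧ ρ * announcedCount x.1 ≤ bias x.1 ∧ ε * n ≤ x.2.card
  let Φ : Announcements V × Finset V → SimpleGraph V → ℝ := fun x G =>
    Real.exp (∑ v, ∑ u, if G.Adj v u then
        (if v ∈ x.2 then -(ρ / 4 * voteSign (x.1 u)) else 0) else 0)
  have h1 : ∀ G : SimpleGraph V, (if HasFewWeak ρ ε m G then (0 : ℝ) else 1) ≤
      ∑ x ∈ I, Φ x G := by
    intro G
    split_ifs with h
    · exact Finset.sum_nonneg fun x _ => Real.exp_nonneg _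
    · unfold HasFewWeak at h
      push Not at h
      obtain ⟨c, hc, hb, hlt⟩ := h
      have hmem : (c, weakSet G c) ∈ I := by
        simp only [I, Finset.mem_filter, Finset.mem_univ, true_and]
        exact ⟨hc, hb, hlt.le⟩
      refine le_trans ?_ (Finset.single_le_sum (f := fun x => Φ x G)
        (fun x _ => Real.exp_nonneg _) hmem)
      refine Real.one_le_exp ?_
      refine Finset.sum_nonneg fun v _ => ?_
      by_cases hv : v ∈ weakSet G c
      · have h2 : ∑ u, (if G.Adj v u then
            (if v ∈ weakSet G c then -(ρ / 4 * voteSign (c u)) else 0) else 0) =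
            -(ρ / 4) * ∑ u, (if G.Adj v u then voteSign (c u) else 0) := by
          rw [Finset.mul_sum]
          refine Finset.sum_congr rfl fun u _ => ?_
          by_cases h : G.Adj v u <;> simp [h, hv]
        rw [h2, sum_adj_voteSign]
        have h3 : (nbrsIn G v (announcing c (some true)) : ℝ) ≤
            nbrsIn G v (announcing c (some false)) := by
          have : nbrsIn G v (announcing c (some true)) ≤
            nbrsIn G v (announcing c (some false)) := by simpa [weakSet] using hv
          exact_mod_cast this
        nlinarith
      · simp [hv]
  refine (graphExp_mono p h1).trans ?_
  rw [graphExp_sum]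
  have h2 : ∀ x ∈ I, graphExp p (Φ x) ≤ Real.exp (-(4 * n)) := by
    intro x hx
    simp only [I, Finset.mem_filter, Finset.mem_univ, true_and] at hx
    refine (graphExp_exp_votes_le p hρ hρ' (hm.trans hx.1) hx.2.1 x.2).trans
      (Real.exp_le_exp.2 ?_)
    have hm0 : 0 ≤ m := le_trans (by positivity) hm
    have h3 : p * (ε * n) * (ρ ^ 2 * m / 16) ≤
        p * x.2.card * (ρ ^ 2 * announcedCount x.1 / 16) := by
      have := hx.1
      have := hx.2.2
      gcongr
    nlinarith
  refine (Finset.sum_le_sum h2).trans ?_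
  rw [Finset.sum_const, nsmul_eq_mul]
  have hcard : (I.card : ℝ) ≤ 6 ^ Fintype.card V := by
    have : I.card ≤ 6 ^ Fintype.card V := by
      refine (Finset.card_le_univ I).trans (le_of_eq ?_)
      simp only [Fintype.card_prod, Fintype.card_finset, Fintype.card_pi, Finset.prod_const,
        Fintype.card_option, Fintype.card_bool, Finset.card_univ]
      rw [← mul_pow]
      norm_num
    exact_mod_cast this
  have h6 : (6 : ℝ) ^ Fintype.card V ≤ Real.exp (2 * n) := by
    have : (6 : ℝ) ≤ Real.exp 2 := by
      have := Real.exp_one_gt_d9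
      have h : Real.exp 2 = Real.exp 1 * Real.exp 1 := by rw [← Real.exp_add]; norm_num
      rw [h]
      nlinarith
    calc (6 : ℝ) ^ Fintype.card V ≤ Real.exp 2 ^ Fintype.card V :=
          pow_le_pow_left₀ (by norm_num) this _
      _ = Real.exp (2 * n) := by rw [← Real.exp_nat_mul, hn]; ring_nf
  calc (I.card : ℝ) * Real.exp (-(4 * n)) ≤ Real.exp (2 * n) * Real.exp (-(4 * n)) :=
        mul_le_mul_of_nonneg_right (hcard.trans h6) (Real.exp_nonneg _)
    _ = Real.exp (-(2 * n)) := by rw [← Real.exp_add]; ring_nf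

/-- For x = z/n, the single term C(n,k) x^k is at most (1 + x)^n ≤ exp(z). Keeping `k` apart from
`z` lets one scale serve both sets in the expansion bound. -/
lemma choose_le_exp {n k z : ℕ} (hz : 0 < z) (hzn : z ≤ n) :
    (n.choose k : ℝ) ≤ Real.exp (z + k * Real.log (n / z)) := by
  have hz' : (0 : ℝ) < z := by exact_mod_cast hz
  have hn' : (0 : ℝ) < n := by exact_mod_cast hz.trans_le hzn
  set x : ℝ := z / n with hx
  have hx0 : 0 < x := by positivity
  have h1 : (n.choose k : ℝ) * x ^ k ≤ Real.exp z := by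
    by_cases hk : k ≤ n
    · have h2 : (n.choose k : ℝ) * x ^ k ≤ (x + 1) ^ n := by
        rw [add_pow]
        have := Finset.single_le_sum (f := fun i => x ^ i * 1 ^ (n - i) * (n.choose i : ℝ))
          (fun i _ => by positivity) (Finset.mem_range.2 (Nat.lt_succ_of_le hk))
        simp only [one_pow, mul_one] at this ⊢
        linarith
      refine h2.trans ?_
      calc (x + 1) ^ n ≤ Real.exp x ^ n :=
            pow_le_pow_left₀ (by positivity) (Real.add_one_le_exp x) n
        _ = Real.exp z := by
            rw [← Real.exp_nat_mul, hx, mul_div_cancel₀ _ hn'.ne']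
    · rw [Nat.choose_eq_zero_of_lt (by omega)]
      simp [Real.exp_nonneg]
  have h3 : Real.exp (k * Real.log (n / z)) * x ^ k = 1 := by
    rw [Real.exp_nat_mul, Real.exp_log (by positivity), ← mul_pow, hx]
    field_simp
    simp
  rw [Real.exp_add]
  have hxk : 0 < x ^ k := by positivity
  refine le_of_mul_le_mul_right ?_ hxk
  rw [mul_assoc, h3, mul_one]
  exact h1

/-- No set `Z` of at most `exp (-20) * n` nodes has too many nodes with at least `τ` neighbours
in `Z`. -/
def HasSmallSetExpansion (τ κ : ℝ) (G : SimpleGraph V) : Prop :=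
  ∀ Z : Finset V, (Z.card : ℝ) ≤ Real.exp (-20) * Fintype.card V →
    ((Finset.univ.filter fun v => τ ≤ nbrsIn G v Z).card : ℝ) ≤ κ * Z.card

open scoped Classical in
lemma graphExp_exp_nbrs_le (p : unitInterval) (θ : ℝ) (S Z : Finset V) :
    graphExp p (fun G => Real.exp (∑ v, ∑ u, if G.Adj v u then
        (if v ∈ S ∧ u ∈ Z then θ else 0) else 0)) ≤
      Real.exp (p / 2 * (S.card * Z.card * Real.exp (2 * θ))) := by
  refine (graphExp_exp_le p _).trans (Real.exp_le_exp.2 ?_)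
  have hp : (0 : ℝ) ≤ p := p.2.1
  refine mul_le_mul_of_nonneg_left ?_ (by positivity)
  have h1 : ∀ v u, (if v = u then 0 else
      (Real.exp (2 * (if v ∈ S ∧ u ∈ Z then θ else 0)) - 1)) ≤
      (if v ∈ S then 1 else 0) * ((if u ∈ Z then 1 else 0) * Real.exp (2 * θ)) := by
    intro v u
    have := Real.exp_nonneg (2 * θ)
    by_cases h : v = u
    · simp only [h, if_true]
      split_ifs <;> simp [this]
    · by_cases h1 : v ∈ S <;> by_cases h2 : u ∈ Z <;> simp [h, h1, h2]
  refine (Finset.sum_le_sum fun v _ => Finset.sum_le_sum fun u _ => h1 v u).trans (le_of_eq ?_)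
  simp only [← Finset.mul_sum, ← Finset.sum_mul]
  simp [mul_assoc]

open scoped Classical in
lemma mul_card_le_sum_adj {G : SimpleGraph V} {S Z : Finset V} {θ τ : ℝ} (hθ : 0 ≤ θ)
    (h : ∀ v ∈ S, τ ≤ nbrsIn G v Z) :
    θ * (S.card * τ) ≤
      ∑ v, ∑ u, (if G.Adj v u then (if v ∈ S ∧ u ∈ Z then θ else 0) else 0) := by
  have h3 : ∀ v, (if v ∈ S then θ * τ else 0) ≤
      ∑ u, (if G.Adj v u then (if v ∈ S ∧ u ∈ Z then θ else 0) else 0) := by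
    intro v
    by_cases hv : v ∈ S
    · have h5 : ∑ u, (if G.Adj v u then (if v ∈ S ∧ u ∈ Z then θ else 0) else 0) =
          θ * nbrsIn G v Z := by
        rw [nbrsIn, Finset.card_filter, ← Finset.sum_subset (Finset.subset_univ Z)]
        · push_cast
          rw [Finset.mul_sum]
          refine Finset.sum_congr rfl fun u hu => ?_
          by_cases h : G.Adj v u <;> simp [h, hv, hu]
        · intro u _ hu
          simp [hu]
      rw [h5, if_pos hv]
      exact mul_le_mul_of_nonneg_left (h v hv) hθ
    · simp [hv]
  refine le_trans (le_of_eq ?_) (Finset.sum_le_sum fun v _ => h3 v)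
  rw [Finset.sum_ite_mem, Finset.univ_inter, Finset.sum_const, nsmul_eq_mul]
  ring

/-- If z ≤ √n, the logarithm alone is at least half of log n; otherwise z alone exceeds it. This
makes the union bound summable even over very small sets. -/
lemma half_log_le {n z : ℝ} (hz : 1 ≤ z) (hzn : 20 ≤ Real.log (n / z)) (hn : 1 ≤ n) :
    Real.log n / 2 ≤ z * Real.log (n / z) := by
  have hz0 : 0 < z := by linarith
  have hn0 : 0 < n := by linarith
  rcases le_total z (Real.sqrt n) with h | h
  · have h1 : Real.log z ≤ Real.log n / 2 := by
      have := Real.log_le_log hz0 h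
      rwa [Real.log_sqrt hn0.le] at this
    have h2 : Real.log n / 2 ≤ Real.log (n / z) := by
      rw [Real.log_div hn0.ne' hz0.ne']
      linarith
    nlinarith
  · have h1 : Real.log n / 2 ≤ Real.sqrt n := by
      rw [← Real.log_sqrt hn0.le]
      exact (Real.log_le_sub_one_of_pos (Real.sqrt_pos.2 hn0)).trans (by linarith)
    nlinarith

-- Union bound over `Z` of size z and `S` of size about κz, tilted by ℓ/4 with ℓ = log(n/z). Each
-- pair costs exp(-8zℓ). Choosing `S` costs at most exp(z + 2zℓ) and choosing `Z` at most exp(z +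
-- zℓ); as ℓ ≥ 20 and zℓ ≥ (log n)/2, each size contributes at most n^(-2), and there are n sizes.
open scoped Classical in
lemma graphExp_not_hasSmallSetExpansion_le [Nonempty V] (p : unitInterval) {d : ℝ}
    (hd : d = p * Fintype.card V) (hd' : 12800 ≤ d) :
    graphExp p (fun G : SimpleGraph V =>
      if HasSmallSetExpansion (d / 200) (12800 / d) G then 0 else 1) ≤ 1 / Fintype.card V := by
  set N := Fintype.card V with hN
  set n : ℝ := (N : ℝ) with hn
  have hN0 : 0 < N := Fintype.card_pos
  have hn1 : 1 ≤ n := by rw [hn]; exact_mod_cast hN0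
  have hp : (0 : ℝ) ≤ p := p.2.1
  have hd0 : 0 < d := by linarith
  set κ := 12800 / d with hκ
  have hκ1 : κ ≤ 1 := by rw [hκ, div_le_one hd0]; exact hd'
  have hκ0 : 0 < κ := by positivity
  -- The least integer exceeding κz, so a violating set of nodes contains a subset of exactly this
  -- size.
  let s : ℕ → ℕ := fun z => ⌊κ * z⌋₊ + 1
  let ℓ : ℕ → ℝ := fun z => Real.log (n / z)
  let B : ℕ → ℝ := fun z => if 0 < z ∧ (z : ℝ) ≤ Real.exp (-20) * n then
    Real.exp (-(11 / 2 * (z * ℓ z))) else 0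
  obtain ⟨Ψ, hΨ⟩ : ∃ Ψ : Finset V → Finset V → SimpleGraph V → ℝ, Ψ = fun Z S G =>
    Real.exp (-(ℓ Z.card / 4 * (S.card * (d / 200)))) *
      Real.exp (∑ v, ∑ u, if G.Adj v u then (if v ∈ S ∧ u ∈ Z then ℓ Z.card / 4 else 0) else 0) :=
    ⟨_, rfl⟩
  obtain ⟨I, hI⟩ : ∃ I : Finset (Finset V), ∀ Z, Z ∈ I ↔
      0 < Z.card ∧ (Z.card : ℝ) ≤ Real.exp (-20) * n :=
    ⟨Finset.univ.filter fun Z => 0 < Z.card ∧ (Z.card : ℝ) ≤ Real.exp (-20) * n, by simp⟩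
  have hℓ : ∀ z : ℕ, 0 < z → (z : ℝ) ≤ Real.exp (-20) * n → 20 ≤ ℓ z := by
    intro z hz hzn
    have hz' : (0 : ℝ) < z := by exact_mod_cast hz
    simp only [ℓ]
    rw [Real.le_log_iff_exp_le (by positivity), le_div_iff₀ hz']
    calc Real.exp 20 * z ≤ Real.exp 20 * (Real.exp (-20) * n) :=
          mul_le_mul_of_nonneg_left hzn (Real.exp_nonneg _)
      _ = n := by rw [← mul_assoc, ← Real.exp_add]; simp
  have h1 : ∀ G : SimpleGraph V, (if HasSmallSetExpansion (d / 200) κ G then (0 : ℝ) else 1) ≤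
      ∑ Z ∈ I, ∑ S ∈ Finset.univ.powersetCard (s Z.card), Ψ Z S G := by
    intro G
    have hnn : ∀ Z S, 0 ≤ Ψ Z S G := fun Z S => by
      rw [hΨ]
      exact mul_nonneg (Real.exp_nonneg _) (Real.exp_nonneg _)
    split_ifs with h
    · exact Finset.sum_nonneg fun Z _ => Finset.sum_nonneg fun S _ => hnn Z S
    · unfold HasSmallSetExpansion at h
      push Not at h
      obtain ⟨Z, hZ, hlt⟩ := h
      have hZ0 : 0 < Z.card := by
        by_contra h0
        have h0' : Z = ∅ := Finset.card_eq_zero.1 (by omega)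
        rw [h0'] at hlt
        simp only [nbrsIn, Finset.filter_empty, Finset.card_empty, Nat.cast_zero, mul_zero] at hlt
        have : ¬ d / 200 ≤ 0 := by linarith
        simp [this] at hlt
      have hs : s Z.card ≤ (Finset.univ.filter fun v => d / 200 ≤ nbrsIn G v Z).card := by
        simp only [s]
        exact Nat.succ_le_of_lt ((Nat.floor_lt (by positivity)).2 hlt)
      obtain ⟨S, hS, hScard⟩ := Finset.exists_subset_card_eq hs
      have hmemI : Z ∈ I := (hI Z).2 ⟨hZ0, hZ⟩
      have hmemS : S ∈ Finset.univ.powersetCard (s Z.card) :=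
        Finset.mem_powersetCard.2 ⟨Finset.subset_univ _, hScard⟩
      have hI1 : ∑ S ∈ Finset.univ.powersetCard (s Z.card), Ψ Z S G ≤
          ∑ Z ∈ I, ∑ S ∈ Finset.univ.powersetCard (s Z.card), Ψ Z S G :=
        Finset.single_le_sum (f := fun Z : Finset V =>
          ∑ S ∈ (Finset.univ : Finset V).powersetCard (s Z.card), Ψ Z S G)
          (fun Z _ => Finset.sum_nonneg fun S _ => hnn Z S) hmemI
      have hI2 : Ψ Z S G ≤ ∑ S ∈ Finset.univ.powersetCard (s Z.card), Ψ Z S G :=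
        Finset.single_le_sum (f := fun S => Ψ Z S G) (fun S _ => hnn Z S) hmemS
      refine le_trans ?_ (hI2.trans hI1)
      rw [hΨ]
      dsimp only
      rw [← Real.exp_add]
      refine Real.one_le_exp ?_
      have hℓZ := hℓ _ hZ0 hZ
      have h2 := mul_card_le_sum_adj (G := G) (S := S) (Z := Z) (θ := ℓ Z.card / 4)
        (τ := d / 200) (by linarith) fun v hv => by simpa using hS hv
      linarith
  refine (graphExp_mono p h1).trans ?_
  rw [graphExp_sum]
  simp only [graphExp_sum]
  have h2 : ∀ Z ∈ I, ∑ S ∈ Finset.univ.powersetCard (s Z.card), graphExp p (Ψ Z S) ≤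
      B Z.card := by
    intro Z hZ
    rw [hI] at hZ
    have hℓZ := hℓ _ hZ.1 hZ.2
    set z := Z.card with hz
    have hz1 : (1 : ℝ) ≤ z := by exact_mod_cast hZ.1
    have hsle : (s z : ℝ) ≤ 2 * z := by
      simp only [s]
      push_cast
      have := Nat.floor_le (show 0 ≤ κ * (z : ℝ) by positivity)
      nlinarith
    have hsge : κ * z ≤ s z := by
      simp only [s]
      push_cast
      exact (Nat.lt_floor_add_one _).le
    have h3 : ∀ S ∈ (Finset.univ : Finset V).powersetCard (s z), graphExp p (Ψ Z S) ≤
        Real.exp (-(8 * (z * ℓ z))) := by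
      intro S hS
      have hSc := (Finset.mem_powersetCard.1 hS).2
      rw [hΨ]
      dsimp only
      rw [graphExp_mul_left]
      refine (mul_le_mul_of_nonneg_left (graphExp_exp_nbrs_le p (ℓ z / 4) S Z)
        (Real.exp_nonneg _)).trans ?_
      rw [← Real.exp_add, hSc, ← hz]
      apply Real.exp_le_exp.2
      have e1 : (z : ℝ) * Real.exp (2 * (ℓ z / 4)) = n * Real.exp (-(ℓ z / 2)) := by
        have hn0 : 0 < n := by linarith
        have : n = z * Real.exp (ℓ z) := by
          simp only [ℓ]
          rw [Real.exp_log (by positivity), mul_div_cancel₀ _ (by positivity)]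
        conv_rhs => rw [this, mul_assoc, ← Real.exp_add]
        congr 2
        ring
      have e2 : p / 2 * ((s z : ℝ) * z * Real.exp (2 * (ℓ z / 4))) =
          s z * d * (Real.exp (-(ℓ z / 2)) / 2) := by
        rw [mul_assoc (s z : ℝ), e1, hd]
        ring
      rw [e2]
      -- The bound exp(-20) n on the size of `Z` is used here: for ℓ ≥ 20 the quadratic lower bound
      -- for exp(ℓ/2) already exceeds 800/ℓ. The mean term is then at most half of the tilt gain.
      have e3 : Real.exp (-(ℓ z / 2)) ≤ ℓ z / 800 := by
        rw [Real.exp_neg, inv_le_comm₀ (Real.exp_pos _) (by linarith)]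
        have := Real.quadratic_le_exp_of_nonneg (show 0 ≤ ℓ z / 2 by linarith)
        refine le_trans ?_ this
        rw [inv_div, div_le_iff₀ (by linarith)]
        nlinarith
      have e4 : 12800 * (z : ℝ) ≤ s z * d := by
        have : κ * d = 12800 := by rw [hκ]; field_simp
        nlinarith
      have e5 : (s z : ℝ) * d * (Real.exp (-(ℓ z / 2)) / 2) ≤ s z * d * (ℓ z / 1600) := by
        refine mul_le_mul_of_nonneg_left (by linarith) (by positivity)
      have e6 : 12800 * (z : ℝ) * (ℓ z / 1600) ≤ s z * d * (ℓ z / 1600) :=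
        mul_le_mul_of_nonneg_right e4 (by linarith)
      linarith
    refine (Finset.sum_le_sum h3).trans ?_
    rw [Finset.sum_const, Finset.card_powersetCard, nsmul_eq_mul, Finset.card_univ]
    have hzN : z ≤ N := Finset.card_le_univ Z
    have h4 := choose_le_exp (k := s z) hZ.1 hzN
    simp only [B]
    rw [if_pos hZ]
    refine (mul_le_mul_of_nonneg_right h4 (Real.exp_nonneg _)).trans ?_
    rw [← Real.exp_add]
    apply Real.exp_le_exp.2
    change (z : ℝ) + s z * ℓ z + -(8 * (z * ℓ z)) ≤ _
    have h5 : (s z : ℝ) * ℓ z ≤ 2 * z * ℓ z := mul_le_mul_of_nonneg_right hsle (by linarith)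
    have h6 : (z : ℝ) * 20 ≤ z * ℓ z := mul_le_mul_of_nonneg_left hℓZ (by linarith)
    linarith
  refine (Finset.sum_le_sum h2).trans ?_
  have hB0 : ∀ z, 0 ≤ B z := by
    intro z
    simp only [B]
    split_ifs
    · exact Real.exp_nonneg _
    · exact le_rfl
  refine (Finset.sum_le_sum_of_subset_of_nonneg (Finset.subset_univ I)
    fun Z _ _ => hB0 _).trans ?_
  rw [← Finset.powerset_univ, Finset.sum_powerset_apply_card B, Finset.card_univ]
  have h5 : ∀ z ∈ Finset.range (N + 1), N.choose z • B z ≤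
      if z = 0 then 0 else 1 / n ^ 2 := by
    intro z hzr
    by_cases hz : 0 < z ∧ (z : ℝ) ≤ Real.exp (-20) * n
    · have hℓz := hℓ z hz.1 hz.2
      have hz1 : (1 : ℝ) ≤ z := by exact_mod_cast hz.1
      simp only [B]
      rw [if_pos hz, if_neg (by omega), nsmul_eq_mul]
      have h4 := choose_le_exp (k := z) hz.1 (Nat.lt_succ_iff.1 (Finset.mem_range.1 hzr))
      refine (mul_le_mul_of_nonneg_right h4 (Real.exp_nonneg _)).trans ?_
      rw [← Real.exp_add]
      have h6 := half_log_le hz1 hℓz hn1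
      have h7 : 1 / n ^ 2 = Real.exp (-(2 * Real.log n)) := by
        rw [Real.exp_neg, one_div]
        congr 1
        have : 2 * Real.log n = ((2 : ℕ) : ℝ) * Real.log n := by norm_num
        rw [this, Real.exp_nat_mul, Real.exp_log (by linarith)]
      rw [h7]
      apply Real.exp_le_exp.2
      change (z : ℝ) + z * ℓ z + -(11 / 2 * (z * ℓ z)) ≤ _
      have h6' : Real.log n / 2 ≤ z * ℓ z := h6
      have h8 : (z : ℝ) * 20 ≤ z * ℓ z := mul_le_mul_of_nonneg_left hℓz (by linarith)
      linarith
    · simp only [B]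
      rw [if_neg hz, smul_zero]
      split_ifs <;> positivity
  refine (Finset.sum_le_sum h5).trans (le_of_eq ?_)
  rw [Finset.sum_range_succ']
  simp only [Nat.add_eq_zero_iff, one_ne_zero, and_false, if_false, if_true, add_zero,
    Finset.sum_const, Finset.card_range, nsmul_eq_mul]
  have hn0 : n ≠ 0 := by linarith
  change n * (1 / n ^ 2) = 1 / n
  field_simp

end Mixing

/-! ### Isolated nodes and nodes of low degree -/

section Degrees

variable {V : Type*} [Fintype V] [DecidableEq V]

/-- The pairs of `v` with the nodes outside `R`. -/
def rowEdges (v : V) (R : Finset V) : Finset (Sym2 V) := Rᶜ.image fun u => s(v, u)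

lemma card_rowEdges (v : V) (R : Finset V) : (rowEdges v R).card = Rᶜ.card :=
  Finset.card_image_of_injective _ fun _ _ => Sym2.congr_right.1

lemma le_card_rowEdges (v : V) (R : Finset V) :
    (Fintype.card V : ℝ) - R.card ≤ (rowEdges v R).card := by
  have h : Fintype.card V ≤ (rowEdges v R).card + R.card := by
    rw [card_rowEdges, Finset.card_compl]
    omega
  have : (Fintype.card V : ℝ) ≤ (rowEdges v R).card + R.card := by exact_mod_cast h
  linarith

lemma rowEdges_subset {v : V} {R : Finset V} (hv : v ∈ R) : rowEdges v R ⊆ allEdges V := by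
  intro e he
  obtain ⟨u, hu, rfl⟩ := Finset.mem_image.1 he
  have : v ≠ u := fun h => (Finset.mem_compl.1 hu) (h ▸ hv)
  simpa [allEdges] using this

lemma notMem_rowEdges {v : V} {R : Finset V} {x y : V} (hx : x ∈ R) (hy : y ∈ R) :
    s(x, y) ∉ rowEdges v R := by
  intro h
  obtain ⟨u, hu, he⟩ := Finset.mem_image.1 h
  rw [Finset.mem_compl] at hu
  rw [Sym2.eq_iff] at he
  rcases he with ⟨_, h⟩ | ⟨_, h⟩
  · exact hu (h ▸ hy)
  · exact hu (h ▸ hx)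

/-- Leaving out the pairs inside `R` makes the rows of nodes of `R` disjoint, hence independent of
each other and of any edges prescribed inside `R`. -/
lemma disjoint_rowEdges {v v' : V} {R : Finset V} (hv' : v' ∈ R) (hne : v ≠ v') :
    Disjoint (rowEdges v R) (rowEdges v' R) := by
  rw [Finset.disjoint_left]
  intro e he he'
  obtain ⟨u, hu, rfl⟩ := Finset.mem_image.1 he
  obtain ⟨u', hu', h⟩ := Finset.mem_image.1 he'
  rw [Sym2.eq_iff] at h
  rcases h with ⟨h, _⟩ | ⟨h, _⟩
  · exact hne h.symm
  · exact (Finset.mem_compl.1 hu) (h ▸ hv')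

open scoped Classical in
lemma card_rowEdges_filter_le (G : SimpleGraph V) (v : V) (R : Finset V) :
    ((rowEdges v R).filter (· ∈ G.edgeSet)).card ≤ nbrsIn G v Finset.univ := by
  rw [rowEdges, Finset.filter_image]
  refine Finset.card_image_le.trans (Finset.card_le_card ?_)
  intro u hu
  rw [Finset.mem_filter] at hu
  exact Finset.mem_filter.2 ⟨Finset.mem_univ _, hu.2⟩

-- Exponential Markov inequality with weight exp(-2) per edge of `I`. Since exp(-2) ≤ 1/5, every
-- pair contributes a factor at most exp(-4p/5).
open scoped Classical in
lemma graphExp_subset_and_few_le (p : unitInterval) {F I : Finset (Sym2 V)}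
    (hF : F ⊆ allEdges V) (hI : I ⊆ allEdges V) (hFI : Disjoint F I) (r : ℝ) :
    graphExp p (fun G => if (∀ e ∈ F, e ∈ G.edgeSet) ∧
      ((I.filter (· ∈ G.edgeSet)).card : ℝ) ≤ r then 1 else 0) ≤
      (p : ℝ) ^ F.card * Real.exp (2 * r - 4 / 5 * (p * I.card)) := by
  have hp : (0 : ℝ) ≤ p := p.2.1
  have hp1 : (p : ℝ) ≤ 1 := p.2.2
  have h1 := graphExp_subset_pow_card (V := V) (p : ℝ) (Real.exp (-2)) hF hI hFI
  have h2 : ∀ G : SimpleGraph V, (if (∀ e ∈ F, e ∈ G.edgeSet) ∧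
      ((I.filter (· ∈ G.edgeSet)).card : ℝ) ≤ r then (1 : ℝ) else 0) ≤
      Real.exp (2 * r) * ((if ∀ e ∈ F, e ∈ G.edgeSet then 1 else 0) *
        Real.exp (-2) ^ (I.filter (· ∈ G.edgeSet)).card) := by
    intro G
    by_cases hA : ∀ e ∈ F, e ∈ G.edgeSet
    · by_cases hB : ((I.filter (· ∈ G.edgeSet)).card : ℝ) ≤ r
      · rw [if_pos ⟨hA, hB⟩, if_pos hA, one_mul, ← Real.exp_nat_mul, ← Real.exp_add]
        exact Real.one_le_exp (by linarith)
      · rw [if_neg fun h => hB h.2]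
        positivity
    · rw [if_neg fun h => hA h.1]
      positivity
  refine (graphExp_mono p h2).trans ?_
  rw [graphExp_mul_left, h1, mul_left_comm, sub_eq_add_neg (2 * r), Real.exp_add]
  refine mul_le_mul_of_nonneg_left (mul_le_mul_of_nonneg_left ?_ (Real.exp_nonneg _))
    (by positivity)
  have h5 : Real.exp (-2) ≤ 1 / 5 := by
    rw [Real.exp_neg, one_div]
    refine inv_anti₀ (by norm_num) ?_
    have := Real.quadratic_le_exp_of_nonneg (show (0 : ℝ) ≤ 2 by norm_num)
    linarith
  calc (1 - (p : ℝ) + p * Real.exp (-2)) ^ I.card ≤ Real.exp (-(4 / 5 * p)) ^ I.card := by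
        refine pow_le_pow_left₀ ?_ ?_ _
        · have : 0 ≤ (p : ℝ) * Real.exp (-2) := by positivity
          linarith
        · have := Real.add_one_le_exp (-(4 / 5 * (p : ℝ)))
          nlinarith
    _ = Real.exp (-(4 / 5 * (p * I.card))) := by
        rw [← Real.exp_nat_mul]
        ring_nf

open scoped Classical in
lemma graphExp_isolated_le (p : unitInterval) :
    graphExp p (fun G : SimpleGraph V => if ∀ v, 0 < nbrsIn G v Finset.univ then 0 else 1) ≤
      Fintype.card V * Real.exp (-(p * (Fintype.card V - 1))) := by
  have hp : (0 : ℝ) ≤ p := p.2.1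
  have hp1 : (p : ℝ) ≤ 1 := p.2.2
  -- With weight 0 per edge, the power is the indicator of an empty row, because 0 ^ 0 = 1.
  have h1 : ∀ G : SimpleGraph V, (if ∀ v, 0 < nbrsIn G v Finset.univ then (0 : ℝ) else 1) ≤
      ∑ v, (if ∀ e ∈ (∅ : Finset (Sym2 V)), e ∈ G.edgeSet then (1 : ℝ) else 0) *
        0 ^ ((rowEdges v {v}).filter (· ∈ G.edgeSet)).card := by
    intro G
    have hnn : ∀ v ∈ (Finset.univ : Finset V),
        0 ≤ (if ∀ e ∈ (∅ : Finset (Sym2 V)), e ∈ G.edgeSet then (1 : ℝ) else 0) *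
        0 ^ ((rowEdges v {v}).filter (· ∈ G.edgeSet)).card := by
      intro v _
      positivity
    by_cases h : ∀ v, 0 < nbrsIn G v Finset.univ
    · rw [if_pos h]
      exact Finset.sum_nonneg hnn
    · rw [if_neg h]
      push Not at h
      obtain ⟨v, hv⟩ := h
      refine le_trans ?_ (Finset.single_le_sum hnn (Finset.mem_univ v))
      have := card_rowEdges_filter_le G v {v}
      have h0 : ((rowEdges v {v}).filter (· ∈ G.edgeSet)).card = 0 := by omega
      rw [h0]
      simp
  refine (graphExp_mono p h1).trans ?_
  rw [graphExp_sum]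
  have h2 : ∀ v ∈ (Finset.univ : Finset V), graphExp p (fun G : SimpleGraph V =>
      (if ∀ e ∈ (∅ : Finset (Sym2 V)), e ∈ G.edgeSet then (1 : ℝ) else 0) *
        0 ^ ((rowEdges v {v}).filter (· ∈ G.edgeSet)).card) ≤
        Real.exp (-(p * (Fintype.card V - 1))) := by
    intro v _
    rw [graphExp_subset_pow_card (p : ℝ) 0 (Finset.empty_subset _)
      (rowEdges_subset (Finset.mem_singleton_self v)) (Finset.disjoint_empty_left _)]
    simp only [Finset.card_empty, pow_zero, one_mul, mul_zero, add_zero]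
    have h3 := le_card_rowEdges v {v}
    rw [Finset.card_singleton, Nat.cast_one] at h3
    calc (1 - (p : ℝ)) ^ (rowEdges v {v}).card ≤ Real.exp (-p) ^ (rowEdges v {v}).card := by
          refine pow_le_pow_left₀ (by linarith) ?_ _
          have := Real.add_one_le_exp (-(p : ℝ))
          linarith
      _ ≤ _ := by
          rw [← Real.exp_nat_mul]
          apply Real.exp_le_exp.2
          nlinarith
  refine (Finset.sum_le_sum h2).trans (le_of_eq ?_)
  rw [Finset.sum_const, nsmul_eq_mul, Finset.card_univ]

/-- The nodes of degree less than `r`. -/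
def smallSet (r : ℝ) (G : SimpleGraph V) : Finset V :=
  Finset.univ.filter fun v => (nbrsIn G v Finset.univ : ℝ) < r

lemma graphExp_card_smallSet_le (p : unitInterval) (r : ℝ) :
    graphExp p (fun G : SimpleGraph V => ((smallSet r G).card : ℝ)) ≤
      Fintype.card V * Real.exp (2 * r - 4 / 5 * (p * (Fintype.card V - 1))) := by
  classical
  have hp : (0 : ℝ) ≤ p := p.2.1
  have h1 : ∀ G : SimpleGraph V, ((smallSet r G).card : ℝ) ≤
      ∑ v, if (∀ e ∈ (∅ : Finset (Sym2 V)), e ∈ G.edgeSet) ∧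
        (((rowEdges v {v}).filter (· ∈ G.edgeSet)).card : ℝ) ≤ r then (1 : ℝ) else 0 := by
    intro G
    rw [smallSet, Finset.card_filter]
    push_cast
    refine Finset.sum_le_sum fun v _ => ?_
    by_cases hv : (nbrsIn G v Finset.univ : ℝ) < r
    · have h2 : (((rowEdges v {v}).filter (· ∈ G.edgeSet)).card : ℝ) ≤
          nbrsIn G v Finset.univ := by exact_mod_cast card_rowEdges_filter_le G v {v}
      rw [if_pos hv, if_pos ⟨by simp, by linarith⟩]
    · rw [if_neg hv]
      split_ifs <;> norm_num
  refine (graphExp_mono p h1).trans ?_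
  rw [graphExp_sum]
  have h2 : ∀ v ∈ (Finset.univ : Finset V), graphExp p (fun G : SimpleGraph V =>
      if (∀ e ∈ (∅ : Finset (Sym2 V)), e ∈ G.edgeSet) ∧
        (((rowEdges v {v}).filter (· ∈ G.edgeSet)).card : ℝ) ≤ r then (1 : ℝ) else 0) ≤
        Real.exp (2 * r - 4 / 5 * (p * (Fintype.card V - 1))) := by
    intro v _
    refine (graphExp_subset_and_few_le p (Finset.empty_subset _)
      (rowEdges_subset (Finset.mem_singleton_self v)) (Finset.disjoint_empty_left _) r).trans ?_
    rw [Finset.card_empty, pow_zero, one_mul]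
    apply Real.exp_le_exp.2
    have h3 := le_card_rowEdges v {v}
    rw [Finset.card_singleton, Nat.cast_one] at h3
    nlinarith
  refine (Finset.sum_le_sum h2).trans (le_of_eq ?_)
  rw [Finset.sum_const, nsmul_eq_mul, Finset.card_univ]

/-- The nodes of `S` are pairwise at distance more than two. -/
def IsScattered (G : SimpleGraph V) (S : Finset V) : Prop :=
  ∀ v ∈ S, ∀ v' ∈ S, v ≠ v' → ¬ G.Adj v v' ∧ ∀ u, G.Adj v u → ¬ G.Adj v' u

-- `R` contains the two nodes and, for a path of length two, the middle node. The prescribed edges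
-- lie inside `R`, while two low degrees leave at most 2r edges among at least 2(n - 3) pairs that
-- leave `R`.
open scoped Classical in
lemma graphExp_two_rows_le (p : unitInterval) {v v' : V} (hne : v ≠ v') {R : Finset V}
    (hv : v ∈ R) (hv' : v' ∈ R) (hR : R.card ≤ 3) {F : Finset (Sym2 V)} (hF : F ⊆ allEdges V)
    (hFR : ∀ e ∈ F, ∃ x ∈ R, ∃ y ∈ R, e = s(x, y)) (r : ℝ) :
    graphExp p (fun G : SimpleGraph V => if (∀ e ∈ F, e ∈ G.edgeSet) ∧
      (nbrsIn G v Finset.univ : ℝ) < r ∧ (nbrsIn G v' Finset.univ : ℝ) < r then 1 else 0) ≤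
      (p : ℝ) ^ F.card * Real.exp (4 * r - 8 / 5 * (p * (Fintype.card V - 3))) := by
  have hp : (0 : ℝ) ≤ p := p.2.1
  set I := rowEdges v R ∪ rowEdges v' R with hI
  have hd := disjoint_rowEdges hv' hne
  have hIcard : 2 * ((Fintype.card V : ℝ) - 3) ≤ I.card := by
    rw [hI, Finset.card_union_of_disjoint hd]
    push_cast
    have h1 := le_card_rowEdges v R
    have h2 := le_card_rowEdges v' R
    have h3 : (R.card : ℝ) ≤ 3 := by exact_mod_cast hR
    linarith
  have hFI : Disjoint F I := by
    rw [Finset.disjoint_left]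
    intro e he heI
    obtain ⟨x, hx, y, hy, rfl⟩ := hFR e he
    rcases Finset.mem_union.1 heI with h | h
    · exact notMem_rowEdges hx hy h
    · exact notMem_rowEdges hx hy h
  have h1 := graphExp_subset_and_few_le p hF
    (Finset.union_subset (rowEdges_subset hv) (rowEdges_subset hv')) hFI (2 * r)
  refine (graphExp_mono p fun G => ?_).trans (h1.trans ?_)
  · by_cases h : (∀ e ∈ F, e ∈ G.edgeSet) ∧
        (nbrsIn G v Finset.univ : ℝ) < r ∧ (nbrsIn G v' Finset.univ : ℝ) < r
    · have h2 : ((I.filter (· ∈ G.edgeSet)).card : ℝ) ≤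
          nbrsIn G v Finset.univ + nbrsIn G v' Finset.univ := by
        rw [hI, Finset.filter_union]
        exact_mod_cast (Finset.card_union_le _ _).trans
          (add_le_add (card_rowEdges_filter_le G v R) (card_rowEdges_filter_le G v' R))
      rw [if_pos h, if_pos ⟨h.1, by linarith [h.2.1, h.2.2]⟩]
    · rw [if_neg h]
      split_ifs <;> norm_num
  · refine mul_le_mul_of_nonneg_left (Real.exp_le_exp.2 ?_) (by positivity)
    nlinarith

-- First moment over the n² p adjacent pairs and the n³ p² paths of length two whose two end nodes
-- both have low degree.
open scoped Classical in
lemma graphExp_not_isScattered_le (p : unitInterval) (r : ℝ) :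
    graphExp p (fun G : SimpleGraph V => if IsScattered G (smallSet r G) then 0 else 1) ≤
      ((Fintype.card V : ℝ) ^ 2 * p + (Fintype.card V : ℝ) ^ 3 * p ^ 2) *
        Real.exp (4 * r - 8 / 5 * (p * (Fintype.card V - 3))) := by
  set n : ℝ := (Fintype.card V : ℝ) with hn
  have hp : (0 : ℝ) ≤ p := p.2.1
  set B := Real.exp (4 * r - 8 / 5 * (p * (n - 3))) with hB
  let Q : SimpleGraph V → V → V → Prop := fun G v v' =>
    (nbrsIn G v Finset.univ : ℝ) < r ∧ (nbrsIn G v' Finset.univ : ℝ) < r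
  let P₁ : V × V → SimpleGraph V → ℝ := fun x G => if x.1 ≠ x.2 ∧ G.Adj x.1 x.2 ∧ Q G x.1 x.2
    then 1 else 0
  let P₂ : V × V × V → SimpleGraph V → ℝ := fun x G =>
    if x.1 ≠ x.2.1 ∧ G.Adj x.1 x.2.2 ∧ G.Adj x.2.1 x.2.2 ∧ Q G x.1 x.2.1 then 1 else 0
  have hP₁ : ∀ x G, 0 ≤ P₁ x G := fun x G => by
    simp only [P₁]; split_ifs <;> norm_num
  have hP₂ : ∀ x G, 0 ≤ P₂ x G := fun x G => by
    simp only [P₂]; split_ifs <;> norm_num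
  have h1 : ∀ G : SimpleGraph V, (if IsScattered G (smallSet r G) then (0 : ℝ) else 1) ≤
      ∑ x, P₁ x G + ∑ x, P₂ x G := by
    intro G
    have n1 : 0 ≤ ∑ x, P₁ x G := Finset.sum_nonneg fun x _ => hP₁ x G
    have n2 : 0 ≤ ∑ x, P₂ x G := Finset.sum_nonneg fun x _ => hP₂ x G
    split_ifs with h
    · positivity
    · simp only [IsScattered, smallSet, Finset.mem_filter, Finset.mem_univ, true_and] at h
      push Not at h
      obtain ⟨v, hv, v', hv', hne, himp⟩ := h
      by_cases hadj : G.Adj v v'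
      · have h2 : P₁ (v, v') G ≤ ∑ x, P₁ x G :=
          Finset.single_le_sum (f := fun x => P₁ x G) (fun x _ => hP₁ x G) (Finset.mem_univ _)
        have h3 : P₁ (v, v') G = 1 := if_pos ⟨hne, hadj, hv, hv'⟩
        linarith
      · obtain ⟨u, hu, hu'⟩ := himp hadj
        have h2 : P₂ (v, v', u) G ≤ ∑ x, P₂ x G :=
          Finset.single_le_sum (f := fun x => P₂ x G) (fun x _ => hP₂ x G) (Finset.mem_univ _)
        have h3 : P₂ (v, v', u) G = 1 := if_pos ⟨hne, hu, hu', hv, hv'⟩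
        linarith
  have hzero : graphExp p (fun _ : SimpleGraph V => (0 : ℝ)) = 0 := subsetExp_const _ 0
  have b1 : ∀ x, graphExp p (P₁ x) ≤ p * B := by
    rintro ⟨v, v'⟩
    by_cases hne : v = v'
    · have : P₁ (v, v') = fun _ => 0 := by
        ext G
        exact if_neg fun h => h.1 hne
      rw [this, hzero]
      positivity
    · have := graphExp_two_rows_le p hne (R := {v, v'}) (by simp) (by simp)
        (Finset.card_le_two.trans (by norm_num)) (F := {s(v, v')})
        (by simpa [allEdges] using hne)
        (fun e he => ⟨v, by simp, v', by simp, Finset.mem_singleton.1 he⟩) r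
      rw [Finset.card_singleton, pow_one] at this
      refine (graphExp_mono p fun G => ?_).trans this
      by_cases h : v ≠ v' ∧ G.Adj v v' ∧ Q G v v'
      · rw [if_pos ⟨by simpa using h.2.1, h.2.2⟩]
        exact (if_pos h).le
      · refine (if_neg h).le.trans ?_
        split_ifs <;> norm_num
  have b2 : ∀ x, graphExp p (P₂ x) ≤ (p : ℝ) ^ 2 * B := by
    rintro ⟨v, v', u⟩
    by_cases hne : v ≠ v' ∧ v ≠ u ∧ v' ≠ u
    · obtain ⟨hne, hvu, hvu'⟩ := hne
      have := graphExp_two_rows_le p hne (R := {v, v', u}) (by simp) (by simp)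
        Finset.card_le_three (F := {s(v, u), s(v', u)})
        (by
          intro e he
          rw [Finset.mem_insert, Finset.mem_singleton] at he
          rcases he with rfl | rfl
          · simpa [allEdges] using hvu
          · simpa [allEdges] using hvu')
        (by
          intro e he
          rw [Finset.mem_insert, Finset.mem_singleton] at he
          rcases he with rfl | rfl
          · exact ⟨v, by simp, u, by simp, rfl⟩
          · exact ⟨v', by simp, u, by simp, rfl⟩) r
      rw [Finset.card_pair (by
        intro h
        exact hne (Sym2.congr_left.1 h))] at this
      refine (graphExp_mono p fun G => ?_).trans this
      by_cases h : v ≠ v' ∧ G.Adj v u ∧ G.Adj v' u ∧ Q G v v'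
      · rw [if_pos ⟨by simpa using ⟨h.2.1, h.2.2.1⟩, h.2.2.2⟩]
        exact (if_pos h).le
      · refine (if_neg h).le.trans ?_
        split_ifs <;> norm_num
    · have : P₂ (v, v', u) = fun _ => 0 := by
        ext G
        exact if_neg fun h => hne ⟨h.1, h.2.1.ne, h.2.2.1.ne⟩
      rw [this, hzero]
      positivity
  refine (graphExp_mono p h1).trans ?_
  have hadd : graphExp p (fun G : SimpleGraph V => ∑ x, P₁ x G + ∑ x, P₂ x G) =
      ∑ x, graphExp p (P₁ x) + ∑ x, graphExp p (P₂ x) := by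
    rw [← graphExp_sum, ← graphExp_sum]
    exact subsetExp_add _ _ _
  rw [hadd]
  refine (add_le_add (Finset.sum_le_sum fun x _ => b1 x)
    (Finset.sum_le_sum fun x _ => b2 x)).trans (le_of_eq ?_)
  simp only [Finset.sum_const, Finset.card_univ, Fintype.card_prod, nsmul_eq_mul]
  push_cast
  ring

/-- A node of degree at least d/100 with half of its neighbours in `Z` has at least d/200 of them
there, which is the threshold of small set expansion. -/
lemma isExpanding_of_typical {G : SimpleGraph V} {d κ : ℝ}
    (hpos : ∀ v, 0 < nbrsIn G v Finset.univ) (hsc : IsScattered G (smallSet (d / 100) G))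
    (hexp : HasSmallSetExpansion (d / 200) κ G) :
    IsExpanding G (smallSet (d / 100) G) κ (Real.exp (-20) * Fintype.card V) where
  deg_pos := hpos
  not_adj v hv v' hv' hadj := (hsc v hv v' hv' hadj.ne).1 hadj
  no_common v hv v' hv' hne u hu := (hsc v hv v' hv' hne).2 u hu
  card_le Z hZ := by
    refine le_trans ?_ (hexp Z hZ)
    have : (influenced G Z).filter (· ∉ smallSet (d / 100) G) ⊆
        Finset.univ.filter fun v => d / 200 ≤ nbrsIn G v Z := by
      intro v
      simp only [Finset.mem_filter, influenced, smallSet, Finset.mem_univ, true_and, not_lt]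
      rintro ⟨h1, h2⟩
      have : (nbrsIn G v Finset.univ : ℝ) ≤ 2 * nbrsIn G v Z := by exact_mod_cast h1
      linarith
    exact_mod_cast Finset.card_le_card this

end Degrees

/-! ### The three regimes combined on a typical graph -/

section Trajectory

variable {V : Type*} [Fintype V] [DecidableEq V] [Nonempty V] {G : SimpleGraph V} {X : V → Bool}

lemma HasTypicalSigns.drift_le {p δ ε ε' ρ : ℝ} {m : ℕ} (h : HasTypicalSigns p δ ε m G X)
    (hp : 0 ≤ p) (hp' : p ≤ 1) (hδ' : δ ≤ 1 / 2) {c : Announcements V}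
    (hc : announcedCount c ≤ m) (hε' : ε + 3 * m / Fintype.card V ≤ ε')
    (hρ : ρ ≤ drift p δ (announcing c (some true)).card (announcing c (some false)).card) :
    Fintype.card V * (ρ - ε') ≤ ∑ v, (bias (step G X c v) - bias c) := by
  refine le_trans ?_ (h.le_sum_bias_step hp hp' hδ' hc)
  have hn : (0 : ℝ) < Fintype.card V := by exact_mod_cast Fintype.card_pos
  have h1 : 3 * (m : ℝ) / Fintype.card V * Fintype.card V = 3 * m := by field_simp
  nlinarith

/-- In the initial phase the signals dominate, and the majority of the announcements is correct. -/
lemma HasTypicalSigns.biased {p δ ε η θ : ℝ} {t₀ t₁ : ℕ} (h : HasTypicalSigns p δ ε t₁ G X)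
    (hp : 0 ≤ p) (hp' : p ≤ 1) (hδ : 0 < δ) (hδ' : δ ≤ 1 / 2) (ht : t₀ ≤ t₁)
    (ht₀ : p * t₀ ≤ δ / 2) (hθ : 0 ≤ θ) (hθ' : θ ≤ 1 / 2)
    (hη : ε + 3 * t₁ / Fintype.card V + 4 * θ ≤ η) (hη' : η ≤ δ / 16)
    (hηt : η * t₁ ≤ δ * t₀ / 16) :
    (avgStep G X)^[t₁] ({c | δ / 16 * t₁ ≤ bias c ∧ announcedCount c ≤ t₁}ᶜ.indicator 1)
      (fun _ => none) ≤ Real.exp (-(θ * (δ * t₀ / 8))) := by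
  -- The curve starts at -δt₀/8, which yields the exponential bound, climbs with slope δ/4 to δt₀/8
  -- at time `t₀`, and continues with slope δ/16 - η. By `hηt` it stays above the line δs/16 from
  -- `t₀` to `t₁`, so the drift bound for biased states keeps applying.
  set h₁ : ℕ → ℝ := fun s => if s ≤ t₀ then δ * s / 4 - δ * t₀ / 8 else
    δ * t₀ / 8 + (δ / 16 - η) * ((s : ℝ) - t₀) with hh₁
  have hbelow : ∀ s ≤ t₀, h₁ s = δ * s / 4 - δ * t₀ / 8 := fun s hs => if_pos hs
  have habove : ∀ s, t₀ ≤ s → h₁ s = δ * t₀ / 8 + (δ / 16 - η) * ((s : ℝ) - t₀) := by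
    intro s hs
    rcases hs.eq_or_lt with rfl | hs
    · rw [hbelow _ le_rfl]; ring
    · exact if_neg (by omega)
  have ht' : (t₀ : ℝ) ≤ t₁ := by exact_mod_cast ht
  have ht0 : (0 : ℝ) ≤ t₀ := Nat.cast_nonneg _
  have hline : ∀ s, t₀ ≤ s → s ≤ t₁ → δ / 16 * s ≤ h₁ s := by
    intro s hs hs'
    rw [habove s hs]
    have h1 : (t₀ : ℝ) ≤ s := by exact_mod_cast hs
    have h2 : (s : ℝ) ≤ t₁ := by exact_mod_cast hs'
    rcases le_or_gt 0 η with h0 | h0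
    · have : η * ((s : ℝ) - t₀) ≤ η * t₁ := mul_le_mul_of_nonneg_left (by linarith) h0
      nlinarith
    · nlinarith
  have key := bias_above_curve (G := G) (X := X) (h := h₁) (T := t₁) hθ hθ' ?_
  · refine le_trans (avgStep_iterate_mono (fun c => ?_) t₁ _) (key.trans (le_of_eq ?_))
    · refine Set.indicator_le_indicator_of_subset ?_ (fun _ => zero_le_one) c
      rw [Set.compl_subset_compl]
      rintro c ⟨h1, h2⟩
      exact ⟨(hline t₁ ht le_rfl).trans h1, h2⟩
    · rw [hbelow 0 (Nat.zero_le _)]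
      congr 1
      push_cast
      ring
  · intro s hs c hc hb
    have hsm : (s : ℝ) ≤ t₁ := by exact_mod_cast hs.le
    have hcard := card_announcing_some c
    by_cases hst : s < t₀
    · rw [hbelow s hst.le, hbelow (s + 1) hst]
      have hst' : (s : ℝ) ≤ t₀ := by exact_mod_cast hst.le
      have hd : δ ≤ drift p δ (announcing c (some true)).card (announcing c (some false)).card := by
        refine drift_ge_of_few hp hp' hδ.le hδ' ?_
        rw [hcard]
        exact le_trans (mul_le_mul_of_nonneg_left (hc.trans hst') hp) ht₀
      refine le_trans ?_ (h.drift_le hp hp' hδ' (hc.trans hsm) le_rfl hd)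
      refine mul_le_mul_of_nonneg_left ?_ (Nat.cast_nonneg _)
      push_cast
      linarith
    · have hst' : t₀ ≤ s := by omega
      rw [habove s hst', habove (s + 1) (by omega)]
      have hd : δ / 16 ≤
          drift p δ (announcing c (some true)).card (announcing c (some false)).card := by
        refine drift_ge_of_biased hp hp' hδ.le (by linarith) (by linarith) ?_
        rw [← bias_eq_card_sub, ← Nat.cast_add, hcard]
        have h1 := hline s hst' hs.le
        have h2 : δ / 16 * announcedCount c ≤ δ / 16 * s :=
          mul_le_mul_of_nonneg_left hc (by linarith)
        linarith
      refine le_trans ?_ (h.drift_le hp hp' hδ' (hc.trans hsm) le_rfl hd)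
      refine mul_le_mul_of_nonneg_left ?_ (Nat.cast_nonneg _)
      push_cast
      linarith

/-- The failure probability of the dynamics on a typical graph with typical signals. -/
lemma not_consensus_le {p δ εA η θ ε κ : ℝ} {t₀ t₁ : ℕ} {S : Finset V}
    (hA : HasTypicalSigns p δ εA t₁ G X)
    (hB : HasFewWeak (δ / 32) ε (δ / 16 * t₁) G)
    (hC : IsExpanding G S κ (Real.exp (-20) * Fintype.card V))
    (hS : (S.card : ℝ) ≤ Real.exp (-20) / 4 * Fintype.card V)
    (hp : 0 ≤ p) (hp' : p ≤ 1) (hδ : 0 < δ) (hδ' : δ ≤ 1 / 2) (ht : t₀ ≤ t₁)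
    (ht₀ : p * t₀ ≤ δ / 2) (hθ : 0 ≤ θ) (hθ' : θ ≤ 1 / 2)
    (hη : εA + 3 * t₁ / Fintype.card V + 4 * θ ≤ η) (hη' : η ≤ δ / 16)
    (hηt : η * t₁ ≤ δ * t₀ / 16) (hε : 0 < ε) (hε' : ε ≤ 1 / 80)
    (hκ : 0 ≤ κ) (hκ' : κ ≤ 1 / 2) (TB T j : ℕ)
    (hj : (2 * κ) ^ j * (Real.exp (-20) * Fintype.card V) < 1) :
    (avgStep G X)^[t₁ + (TB + 2 * j * T)] ({c | wrongSet c = ∅}ᶜ.indicator 1) (fun _ => none) ≤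
      Real.exp (-(θ * (δ * t₀ / 8))) +
      (Real.exp (-(ε / 2 * (δ / 32 * t₁))) +
        TB * Real.exp (-(ε / 2 * (Fintype.card V / 4 - 2))) +
        ((1 - 1 / Fintype.card V) ^ TB + 2 * ε) / (Real.exp (-20) / 4) +
        2 * j * (Fintype.card V * (1 - 1 / Fintype.card V) ^ T)) := by
  have hn : (1 : ℝ) ≤ Fintype.card V := by exact_mod_cast (Fintype.card_pos : 0 < Fintype.card V)
  have hq : (0 : ℝ) ≤ 1 - 1 / Fintype.card V := by
    have : 1 / (Fintype.card V : ℝ) ≤ 1 := by rw [div_le_one (by linarith)]; exact hn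
    linarith
  refine (avgStep_iterate_add_le
    (Q₁ := {c | δ / 16 * t₁ ≤ bias c ∧ announcedCount c ≤ t₁}) (by positivity) ?_ _).trans
    (add_le_add_left (hA.biased hp hp' hδ hδ' ht ht₀ hθ hθ' hη hη' hηt) _)
  rintro c ⟨hb, ha⟩
  refine (avgStep_iterate_add_le
    (Q₁ := {c | ((wrongSet c).card : ℝ) ≤ Real.exp (-20) / 4 * Fintype.card V})
    (r := 2 * j * (Fintype.card V * (1 - 1 / Fintype.card V) ^ T)) (by positivity) ?_ _).trans
    (add_le_add_left ?_ _)
  · intro c hc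
    -- The wrong nodes and `S` each have at most exp(-20) n / 4 elements, so twice their total fits
    -- the size bound of expansion.
    refine hC.consensus_le hκ hκ' ?_ T j hj
    have : ((wrongSet c).card : ℝ) ≤ Real.exp (-20) / 4 * Fintype.card V := hc
    linarith
  · have hle : ∀ c, ((misledSet G X c).card : ℝ) ≤ (weakSet G c).card := fun c => by
      exact_mod_cast Finset.card_le_card (misledSet_subset_weakSet G X c)
    -- The state reached has bias at least δt₁/16 and at most t₁ announcements. Asking only for the
    -- ratio δ/32 from now on leaves a starting margin of δt₁/32.
    have h1 := few_wrong_of_biased (G := G) (X := X) (ρ := δ / 32) (m := δ / 16 * t₁)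
      (η := Real.exp (-20) / 4) hε hε' (by linarith) (by linarith) (by positivity)
      (fun c hc hc' => (hle c).trans (hB c hc hc')) TB c (hb.trans (bias_le_announcedCount c))
    refine h1.trans ?_
    gcongr
    nlinarith

end Trajectory

/-! ### From finite expectations to the joint law -/

section Linearity

variable {V : Type*} [Fintype V] [DecidableEq V]

lemma graphExp_const (p r : ℝ) : graphExp p (fun _ : SimpleGraph V => r) = r :=
  subsetExp_const _ _

lemma graphExp_add (p : ℝ) (F F' : SimpleGraph V → ℝ) :
    graphExp p (fun G => F G + F' G) = graphExp p F + graphExp p F' :=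
  subsetExp_add _ _ _

lemma signalExp_const (δ r : ℝ) : signalExp δ (fun _ : V → Bool => r) = r := by
  have h := signalExp_prod (V := V) δ ∅ fun _ _ => 0
  simp only [Finset.prod_empty] at h
  have h' := signalExp_mul_left (V := V) δ r fun _ => 1
  rw [h, mul_one] at h'
  simpa using h'

lemma pairExp_graph (p δ : ℝ) (F : SimpleGraph V → ℝ) :
    pairExp p δ (fun G _ => F G) = graphExp p F := by
  simp only [pairExp, signalExp_const]

lemma pairExp_add (p δ : ℝ) (F F' : SimpleGraph V → (V → Bool) → ℝ) :
    pairExp p δ (fun G X => F G X + F' G X) = pairExp p δ F + pairExp p δ F' := by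
  simp only [pairExp, ← graphExp_add, signalExp, mul_add, Finset.sum_add_distrib]

end Linearity

section JointLaw

instance (n : ℕ) (δ : Set.Ioo (0 : ℝ) (1 / 2)) : IsProbabilityMeasure (signalLaw n δ) := by
  unfold signalLaw; infer_instance

instance (n : ℕ) (p : unitInterval) (δ : Set.Ioo (0 : ℝ) (1 / 2)) :
    IsProbabilityMeasure (jointLaw (n + 1) p δ) := by
  unfold jointLaw; infer_instance

lemma signalLaw_real_singleton (n : ℕ) (δ : Set.Ioo (0 : ℝ) (1 / 2)) (X : Fin n → Bool) :
    (signalLaw n δ).real {X} = ∏ v, if X v then 1 / 2 + (δ : ℝ) else 1 / 2 - δ := by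
  rw [measureReal_def, signalLaw, Measure.pi_singleton, ENNReal.toReal_prod]
  refine Finset.prod_congr rfl fun v _ => ?_
  rw [← measureReal_def, bernoulliMeasure_real_apply _ (.of_discrete)]
  cases X v <;> simp [correctProb]
  ring

/-- The probability of an event is at most the expectation of its probability over the choice of
the selected nodes. -/
lemma jointLaw_real_le (n : ℕ) (p : unitInterval) (δ : Set.Ioo (0 : ℝ) (1 / 2))
    (A : Set (SimpleGraph (Fin (n + 1)) × (Fin (n + 1) → Bool) × (ℕ → Fin (n + 1)))) :
    (jointLaw (n + 1) p δ).real A ≤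
      pairExp p δ fun G X => (selectionLaw (n + 1)).real {s | (G, X, s) ∈ A} := by
  classical
  -- The event is covered by its finitely many slices at fixed graph and signals. Monotonicity and
  -- subadditivity of outer measure suffice, so `A` need not be measurable.
  have hsub : A ⊆ ⋃ x : SimpleGraph (Fin (n + 1)) × (Fin (n + 1) → Bool),
      ({x.1} : Set _) ×ˢ (({x.2} : Set _) ×ˢ {s | (x.1, x.2, s) ∈ A}) := by
    rintro ⟨G, X, s⟩ h
    exact Set.mem_iUnion.2 ⟨(G, X), rfl, rfl, h⟩
  refine (measureReal_mono hsub).trans ((measureReal_iUnion_fintype_le _).trans (le_of_eq ?_))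
  rw [pairExp, graphExp_eq_sum, Fintype.sum_prod_type]
  refine Finset.sum_congr rfl fun G _ => ?_
  rw [signalExp, Finset.mul_sum]
  refine Finset.sum_congr rfl fun X _ => ?_
  rw [jointLaw, measureReal_prod_prod, measureReal_prod_prod, signalLaw_real_singleton]

/-- The failure probability of the dynamics on the binomial random graph. -/
lemma jointLaw_real_not_correctWithin_le (n : ℕ) (p : unitInterval)
    (δ : Set.Ioo (0 : ℝ) (1 / 2)) {N d εA x η θ ε B : ℝ} {t₀ t₁ TB T j : ℕ}
    (hN : N = (n + 1 : ℕ)) (hd : d = p * N) (hd' : 25600 ≤ d)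
    (hεA : 0 ≤ εA) (hεA' : εA ≤ 2) (hx : 0 < x) (hx' : x ≤ 1)
    (ht : t₀ ≤ t₁) (ht₀ : (p : ℝ) * t₀ ≤ (δ : ℝ) / 2) (hθ : 0 ≤ θ) (hθ' : θ ≤ 1 / 2)
    (hη : εA + 3 * t₁ / N + 4 * θ ≤ η) (hη' : η ≤ (δ : ℝ) / 16)
    (hηt : η * t₁ ≤ δ * t₀ / 16) (hε : 0 < ε) (hε' : ε ≤ 1 / 80)
    (hm : 4 / ((δ : ℝ) / 32) ≤ δ / 16 * t₁)
    (hpm : 64 ≤ (p : ℝ) * (δ / 16 * t₁) * ((δ : ℝ) / 32) ^ 2 * ε)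
    (hj : (2 * (12800 / d)) ^ j * (Real.exp (-20) * N) < 1)
    (hB : ((t₁ + (TB + 2 * j * T) : ℕ) : ℝ) ≤ B) :
    (jointLaw (n + 1) p δ).real (correctWithin (n + 1) B)ᶜ ≤
      (Real.exp (-(θ * (δ * t₀ / 8))) +
        (Real.exp (-(ε / 2 * (δ / 32 * t₁))) + TB * Real.exp (-(ε / 2 * (N / 4 - 2))) +
          ((1 - 1 / N) ^ TB + 2 * ε) / (Real.exp (-20) / 4) + 2 * j * (N * (1 - 1 / N) ^ T))) +
      ((1 + 2 * x) ^ (n + 1) * (x ^ t₁)⁻¹ * Real.exp (-(εA ^ 2 / 4 * N)) +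
      (Real.exp (-(2 * N)) + (1 / N + (N * Real.exp (-(p * (N - 1))) +
        ((N ^ 2 * p + N ^ 3 * p ^ 2) * Real.exp (4 * (d / 100) - 8 / 5 * (p * (N - 3))) +
          Real.exp (2 * (d / 100) - 4 / 5 * (p * (N - 1))) / (Real.exp (-20) / 4)))))) := by
  classical
  have hcard : ((Fintype.card (Fin (n + 1)) : ℕ) : ℝ) = N := by rw [Fintype.card_fin, hN]
  have hN1 : 1 ≤ N := by rw [hN]; exact_mod_cast Nat.succ_pos n
  have hp0 : (0 : ℝ) ≤ p := p.2.1
  have hp1 : (p : ℝ) ≤ 1 := p.2.2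
  obtain ⟨hδ, hδ'⟩ := δ.2
  have hκ : (0 : ℝ) ≤ 12800 / d := by positivity
  have hκ' : 12800 / d ≤ 1 / 2 := by rw [div_le_div_iff₀ (by linarith) (by norm_num)]; linarith
  have hw : 0 < Real.exp (-20) / 4 * N := by positivity
  set R := Real.exp (-(θ * (δ * t₀ / 8))) +
    (Real.exp (-(ε / 2 * (δ / 32 * t₁))) + TB * Real.exp (-(ε / 2 * (N / 4 - 2))) +
      ((1 - 1 / N) ^ TB + 2 * ε) / (Real.exp (-20) / 4) + 2 * j * (N * (1 - 1 / N) ^ T)) with hR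
  clear_value R
  have hR0 : 0 ≤ R := by
    have : (0 : ℝ) ≤ 1 - 1 / N := by
      have : 1 / N ≤ 1 := by rw [div_le_one (by linarith)]; exact hN1
      linarith
    rw [hR]; positivity
  -- Each bad property of the graph or signals pays 1, which exceeds any probability. The size of
  -- the low degree set is paid for in Markov form, so that only its mean is needed.
  have hpt : ∀ (G : SimpleGraph (Fin (n + 1))) X,
      (selectionLaw (n + 1)).real {s | (G, X, s) ∈ (correctWithin (n + 1) B)ᶜ} ≤
      R + ((if HasTypicalSigns p δ εA t₁ G X then 0 else 1) +
        ((if HasFewWeak ((δ : ℝ) / 32) ε (δ / 16 * t₁) G then 0 else 1) +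
        ((if HasSmallSetExpansion (d / 200) (12800 / d) G then 0 else 1) +
        ((if ∀ v, 0 < nbrsIn G v Finset.univ then 0 else 1) +
        ((if IsScattered G (smallSet (d / 100) G) then 0 else 1) +
        (Real.exp (-20) / 4 * N)⁻¹ * (smallSet (d / 100) G).card))))) := by
    intro G X
    have hle1 : (selectionLaw (n + 1)).real {s | (G, X, s) ∈ (correctWithin (n + 1) B)ᶜ} ≤ 1 :=
      measureReal_le_one
    have ite0 : ∀ P : Prop, [Decidable P] → (0 : ℝ) ≤ if P then 0 else 1 := by
      intro P _; split_ifs <;> norm_num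
    have h1 := ite0 (HasTypicalSigns p δ εA t₁ G X)
    have h2 := ite0 (HasFewWeak ((δ : ℝ) / 32) ε (δ / 16 * t₁) G)
    have h3 := ite0 (HasSmallSetExpansion (d / 200) (12800 / d) G)
    have h4 := ite0 (∀ v, 0 < nbrsIn G v Finset.univ)
    have h5 := ite0 (IsScattered G (smallSet (d / 100) G))
    have h6 : 0 ≤ (Real.exp (-20) / 4 * N)⁻¹ * (smallSet (d / 100) G).card := by positivity
    by_cases g1 : HasTypicalSigns p δ εA t₁ G X
    swap; · rw [if_neg g1]; linarith
    by_cases g2 : HasFewWeak ((δ : ℝ) / 32) ε (δ / 16 * t₁) G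
    swap; · rw [if_neg g2]; linarith
    by_cases g3 : HasSmallSetExpansion (d / 200) (12800 / d) G
    swap; · rw [if_neg g3]; linarith
    by_cases g4 : ∀ v, 0 < nbrsIn G v Finset.univ
    swap; · rw [if_neg g4]; linarith
    by_cases g5 : IsScattered G (smallSet (d / 100) G)
    swap; · rw [if_neg g5]; linarith
    by_cases g6 : ((smallSet (d / 100) G).card : ℝ) ≤ Real.exp (-20) / 4 * N
    swap
    · have : 1 ≤ (Real.exp (-20) / 4 * N)⁻¹ * (smallSet (d / 100) G).card := by
        rw [inv_mul_eq_div, one_le_div hw]; exact (not_le.1 g6).le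
      linarith
    have hexp := isExpanding_of_typical g4 g5 g3
    have key := not_consensus_le g1 g2 hexp (by rw [hcard]; exact g6) hp0 hp1 hδ hδ'.le ht ht₀ hθ
      hθ' (by rw [hcard]; exact hη) hη' hηt hε hε' hκ hκ' TB T j (by rw [hcard]; exact hj)
    rw [← selectionLaw_real_announcement, hcard, ← hR] at key
    have hsub : {s | (G, X, s) ∈ (correctWithin (n + 1) B)ᶜ} ⊆
        {s | announcement G X s (t₁ + (TB + 2 * j * T)) ∈ {c | wrongSet c = ∅}ᶜ} := by
      intro s hs hc
      exact hs ⟨_, hB, hexp.isTerminal hc⟩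
    have := (measureReal_mono (μ := selectionLaw (n + 1)) hsub).trans key
    linarith
  refine (jointLaw_real_le n p δ _).trans ((pairExp_mono p hδ.le hδ'.le hpt).trans ?_)
  rw [pairExp_add, pairExp_add, pairExp_graph p δ fun _ => R, graphExp_const,
    pairExp_graph p δ fun G => (if HasFewWeak ((δ : ℝ) / 32) ε (δ / 16 * t₁) G then (0 : ℝ) else 1)
      + ((if HasSmallSetExpansion (d / 200) (12800 / d) G then 0 else 1) +
        ((if ∀ v, 0 < nbrsIn G v Finset.univ then 0 else 1) +
        ((if IsScattered G (smallSet (d / 100) G) then 0 else 1) +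
        (Real.exp (-20) / 4 * N)⁻¹ * (smallSet (d / 100) G).card))),
    graphExp_add, graphExp_add, graphExp_add, graphExp_add, graphExp_mul_left]
  have b1 := pairExp_not_hasTypicalSigns_le (V := Fin (n + 1)) p hδ.le hδ'.le hεA hεA' hx hx' t₁
  have b2 := graphExp_not_hasFewWeak_le (V := Fin (n + 1)) p (ρ := (δ : ℝ) / 32) (by linarith)
    (by linarith) hm hpm
  have b3 := graphExp_not_hasSmallSetExpansion_le (V := Fin (n + 1)) p (hd.trans (by rw [hcard]))
    (by linarith)
  have b4 := graphExp_isolated_le (V := Fin (n + 1)) p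
  have b5 := graphExp_not_isScattered_le (V := Fin (n + 1)) p (d / 100)
  have b6 := graphExp_card_smallSet_le (V := Fin (n + 1)) p (d / 100)
  rw [hcard] at b2 b3 b4 b5 b6
  rw [hcard, Fintype.card_fin] at b1
  have b6' : (Real.exp (-20) / 4 * N)⁻¹ *
      graphExp p (fun G : SimpleGraph (Fin (n + 1)) => ((smallSet (d / 100) G).card : ℝ)) ≤
      Real.exp (2 * (d / 100) - 4 / 5 * (p * (N - 1))) / (Real.exp (-20) / 4) := by
    refine (mul_le_mul_of_nonneg_left b6 (by positivity)).trans (le_of_eq ?_)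
    field_simp
  refine add_le_add_right (add_le_add b1 (add_le_add b2 (add_le_add b3 (add_le_add ?_
    (add_le_add b5 b6'))))) _
  refine le_trans (le_of_eq ?_) b4
  congr!

end JointLaw

/-! ### Error terms near the connectivity threshold -/

section Asymptotics

lemma tendsto_log_natCast : Tendsto (fun n : ℕ => Real.log n) atTop atTop :=
  Real.tendsto_log_atTop.comp tendsto_natCast_atTop_atTop

lemma tendsto_log_log_natCast : Tendsto (fun n : ℕ => Real.log (Real.log n)) atTop atTop :=
  Real.tendsto_log_atTop.comp tendsto_log_natCast

lemma tendsto_log_pow_div_natCast (k : ℕ) :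
    Tendsto (fun n : ℕ => Real.log n ^ k / n) atTop (𝓝 0) := by
  have h := (Real.isLittleO_pow_log_id_atTop (n := k)).tendsto_div_nhds_zero
  exact h.comp tendsto_natCast_atTop_atTop

lemma tendsto_pow_mul_exp_neg (k : ℕ) {c : ℝ} (hc : 0 < c) :
    Tendsto (fun x : ℝ => x ^ k * Real.exp (-(c * x))) atTop (𝓝 0) := by
  have h := ((Real.tendsto_pow_mul_exp_neg_atTop_nhds_zero k).comp
    (tendsto_id.const_mul_atTop hc)).const_mul ((c ^ k)⁻¹)
  rw [mul_zero] at h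
  refine h.congr fun x => ?_
  simp only [Function.comp, id]
  rw [mul_pow]
  field_simp

lemma one_sub_inv_pow_le {n : ℝ} (hn : 1 ≤ n) {T : ℕ} {a : ℝ} (hT : n * a ≤ T) :
    (1 - 1 / n) ^ T ≤ Real.exp (-a) := by
  have h0 : 0 < n := by linarith
  have h1 : 0 ≤ 1 - 1 / n := by
    have : 1 / n ≤ 1 := by rw [div_le_one h0]; exact hn
    linarith
  calc (1 - 1 / n) ^ T ≤ Real.exp (-(1 / n)) ^ T :=
        pow_le_pow_left₀ h1 (Real.one_sub_le_exp_neg _) _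
    _ = Real.exp (-(T / n)) := by rw [← Real.exp_nat_mul]; congr 1; ring
    _ ≤ Real.exp (-a) := Real.exp_le_exp.2 (neg_le_neg (by rw [le_div_iff₀ h0]; linarith))

/-- The edge probabilities just above the connectivity threshold. -/
structure NearThreshold (ω p : ℕ → ℝ) : Prop where
  tendsto_atTop : Tendsto ω atTop atTop
  le_deg : ∀ᶠ n : ℕ in atTop, Real.log n + ω n ≤ p n * n
  deg_le : ∀ᶠ n in atTop, p n * n ≤ Real.log n ^ 2

/-- Eventually ω ≤ log log n ≤ log n, so pn is at most (log n)². This crude bound serves to make p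
tend to 0. -/
lemma nearThreshold_of_isLittleO {ω p : ℕ → ℝ} (hω : Tendsto ω atTop atTop)
    (hω' : ω =o[atTop] fun n : ℕ => Real.log (Real.log n))
    (hp : ∀ᶠ n : ℕ in atTop, (Real.log n + ω n) / n ≤ p n ∧ p n ≤ ω n * Real.log n / n) :
    NearThreshold ω p where
  tendsto_atTop := hω
  le_deg := by
    filter_upwards [hp, eventually_gt_atTop 0] with n h hn
    have hn : (0 : ℝ) < n := by exact_mod_cast hn
    exact (div_le_iff₀ hn).1 h.1
  deg_le := by
    filter_upwards [hp, eventually_gt_atTop 0, hω'.bound one_pos,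
      tendsto_log_natCast.eventually_ge_atTop 1] with n h hn hb hlog
    have hn : (0 : ℝ) < n := by exact_mod_cast hn
    have h1 := (le_div_iff₀ hn).1 h.2
    have h2 : 0 ≤ Real.log (Real.log n) := Real.log_nonneg hlog
    have h3 : Real.log (Real.log n) ≤ Real.log n - 1 :=
      Real.log_le_sub_one_of_pos (by linarith)
    rw [Real.norm_eq_abs, Real.norm_eq_abs, abs_of_nonneg h2] at hb
    have h4 := (le_abs_self _).trans hb
    nlinarith

namespace NearThreshold

variable {ω p : ℕ → ℝ}

lemma log_le (h : NearThreshold ω p) : ∀ᶠ n : ℕ in atTop, Real.log n ≤ p n * n := by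
  filter_upwards [h.le_deg, h.tendsto_atTop.eventually_ge_atTop 0] with n h1 h2
  linarith

lemma tendsto_deg (h : NearThreshold ω p) : Tendsto (fun n => p n * n) atTop atTop :=
  tendsto_atTop_mono' _ h.log_le tendsto_log_natCast

lemma pos (h : NearThreshold ω p) : ∀ᶠ n in atTop, 0 < p n := by
  filter_upwards [h.tendsto_deg.eventually_gt_atTop 0] with n hn
  exact pos_of_mul_pos_left hn (Nat.cast_nonneg n)

lemma tendsto_zero (h : NearThreshold ω p) : Tendsto p atTop (𝓝 0) := by
  refine squeeze_zero' (h.pos.mono fun _ => le_of_lt) ?_ (tendsto_log_pow_div_natCast 2)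
  filter_upwards [h.deg_le, eventually_gt_atTop 0] with n h1 hn
  have hn : (0 : ℝ) < n := by exact_mod_cast hn
  exact (le_div_iff₀ hn).2 h1

lemma tendsto_floor (h : NearThreshold ω p) {a : ℝ} (ha : 0 < a) :
    Tendsto (fun n => ((⌊a / p n⌋₊ : ℕ) : ℝ)) atTop atTop := by
  have h1 : Tendsto p atTop (𝓝[>] 0) :=
    tendsto_nhdsWithin_iff.2 ⟨h.tendsto_zero, h.pos⟩
  have h2 : Tendsto (fun n => a / p n) atTop atTop := by
    simpa only [div_eq_mul_inv, Function.comp_def] using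
      (tendsto_inv_nhdsGT_zero.comp h1).const_mul_atTop ha
  exact tendsto_natCast_atTop_atTop.comp (tendsto_nat_floor_atTop.comp h2)

lemma tendsto_floor_div (h : NearThreshold ω p) {a : ℝ} (ha : 0 < a) :
    Tendsto (fun n => ((⌊a / p n⌋₊ : ℕ) : ℝ) / n) atTop (𝓝 0) := by
  have h1 : Tendsto (fun n => a / (p n * n)) atTop (𝓝 0) := h.tendsto_deg.const_div_atTop a
  refine squeeze_zero' (Eventually.of_forall fun n => by positivity) ?_ h1
  filter_upwards [h.pos] with n hp
  rw [← div_div]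
  exact div_le_div_of_nonneg_right (Nat.floor_le (by positivity)) (Nat.cast_nonneg n)

lemma tendsto_exp_floor (h : NearThreshold ω p) {a c : ℝ} (ha : 0 < a) (hc : 0 < c) :
    Tendsto (fun n => Real.exp (-(c * (⌊a / p n⌋₊ : ℕ)))) atTop (𝓝 0) :=
  Real.tendsto_exp_neg_atTop_nhds_zero.comp ((h.tendsto_floor ha).const_mul_atTop hc)

/-- Here pn ≥ log n would not suffice: the expected number of isolated nodes is of order exp(-ω),
and ω must tend to infinity. -/
lemma tendsto_isolated (h : NearThreshold ω p) :
    Tendsto (fun n : ℕ => (n : ℝ) * Real.exp (-(p n * (n - 1)))) atTop (𝓝 0) := by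
  have h1 : Tendsto (fun n => Real.exp (-(ω n - 1))) atTop (𝓝 0) :=
    Real.tendsto_exp_neg_atTop_nhds_zero.comp (tendsto_atTop_add_const_right _ _ h.tendsto_atTop)
  refine squeeze_zero' (Eventually.of_forall fun n => by positivity) ?_ h1
  filter_upwards [h.le_deg, h.tendsto_zero.eventually_le_const one_pos,
    eventually_gt_atTop 0] with n h2 h3 hn
  have hn : (0 : ℝ) < n := by exact_mod_cast hn
  nth_rewrite 1 [← Real.exp_log hn]
  rw [← Real.exp_add]
  exact Real.exp_le_exp.2 (by linarith)

/-- The coefficient of d in the exponent is 4/100 - 8/5 = -1 - 14/25. One factor exp(-d) cancels n ≤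
exp(d), the rest beats d², and exp(5) absorbs the correction 24p/5. -/
lemma tendsto_scattered (h : NearThreshold ω p) :
    Tendsto (fun n : ℕ => ((n : ℝ) ^ 2 * p n + (n : ℝ) ^ 3 * p n ^ 2) *
      Real.exp (4 * (p n * n / 100) - 8 / 5 * (p n * (n - 3)))) atTop (𝓝 0) := by
  have h1 := ((tendsto_pow_mul_exp_neg 2 (c := 14 / 25) (by norm_num)).comp
    h.tendsto_deg).const_mul (2 * Real.exp 5)
  rw [mul_zero] at h1
  refine squeeze_zero' (h.pos.mono fun n hp => by positivity) ?_ h1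
  filter_upwards [h.log_le, h.tendsto_zero.eventually_le_const one_pos,
    eventually_gt_atTop 0, h.tendsto_deg.eventually_ge_atTop 1] with n h2 h3 hn h4
  have hn : (0 : ℝ) < n := by exact_mod_cast hn
  simp only [Function.comp]
  set d := p n * n with hd
  have h5 : (n : ℝ) ≤ Real.exp d := by
    rw [← Real.exp_log hn]; exact Real.exp_le_exp.2 h2
  have h6 : (n : ℝ) ^ 2 * p n + (n : ℝ) ^ 3 * p n ^ 2 ≤ Real.exp d * (2 * d ^ 2) := by
    calc (n : ℝ) ^ 2 * p n + (n : ℝ) ^ 3 * p n ^ 2 = n * (d + d ^ 2) := by rw [hd]; ring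
      _ ≤ Real.exp d * (2 * d ^ 2) := by gcongr; nlinarith
  have h7 : Real.exp (4 * (d / 100) - 8 / 5 * (p n * (n - 3))) ≤
      Real.exp (5 - d - 14 / 25 * d) := Real.exp_le_exp.2 (by nlinarith)
  calc _ ≤ Real.exp d * (2 * d ^ 2) * Real.exp (5 - d - 14 / 25 * d) := by gcongr
    _ = 2 * Real.exp 5 * (d ^ 2 * (Real.exp d * Real.exp (-d) * Real.exp (-(14 / 25 * d)))) := by
        rw [show 5 - d - 14 / 25 * d = 5 + (-d + -(14 / 25 * d)) by ring, Real.exp_add,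
          Real.exp_add]
        ring
    _ = 2 * Real.exp 5 * (d ^ 2 * Real.exp (-(14 / 25 * d))) := by
        rw [← Real.exp_add d, add_neg_cancel, Real.exp_zero, one_mul]

lemma tendsto_small (h : NearThreshold ω p) :
    Tendsto (fun n : ℕ => Real.exp (2 * (p n * n / 100) - 4 / 5 * (p n * (n - 1))))
      atTop (𝓝 0) := by
  have h1 : Tendsto (fun n => Real.exp (-(1 / 2 * (p n * n) - 1))) atTop (𝓝 0) :=
    Real.tendsto_exp_neg_atTop_nhds_zero.comp
      (tendsto_atTop_add_const_right _ _ (h.tendsto_deg.const_mul_atTop (by norm_num)))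
  refine squeeze_zero' (Eventually.of_forall fun n => by positivity) ?_ h1
  filter_upwards [h.tendsto_zero.eventually_le_const one_pos,
    h.tendsto_deg.eventually_ge_atTop 1] with n h2 h3
  exact Real.exp_le_exp.2 (by nlinarith)

/-- With x = ε²/32, both (1 + 2x)^n and x^(-t₁) are at most exp(ε²n/16), the latter eventually
because t₁ = o(n). Half of the exponent ε²n/4 survives. -/
lemma tendsto_atypical (h : NearThreshold ω p) {a ε : ℝ} (ha : 0 < a) (hε : 0 < ε) :
    Tendsto (fun n : ℕ => (1 + 2 * (ε ^ 2 / 32)) ^ n * ((ε ^ 2 / 32) ^ ⌊a / p n⌋₊)⁻¹ *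
      Real.exp (-(ε ^ 2 / 4 * n))) atTop (𝓝 0) := by
  have h1 : Tendsto (fun n : ℕ => Real.exp (-(ε ^ 2 / 8 * n))) atTop (𝓝 0) :=
    Real.tendsto_exp_neg_atTop_nhds_zero.comp
      (tendsto_natCast_atTop_atTop.const_mul_atTop (by positivity))
  refine squeeze_zero' (Eventually.of_forall fun n => by positivity) ?_ h1
  have h2 := (h.tendsto_floor_div ha).mul_const (-Real.log (ε ^ 2 / 32))
  rw [zero_mul] at h2
  filter_upwards [h2.eventually_le_const (show 0 < ε ^ 2 / 16 by positivity),
    eventually_gt_atTop 0] with n h3 hn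
  have hn : (0 : ℝ) < n := by exact_mod_cast hn
  rw [div_mul_eq_mul_div, div_le_iff₀ hn] at h3
  have h4 : (1 + 2 * (ε ^ 2 / 32)) ^ n ≤ Real.exp (n * (ε ^ 2 / 16)) := by
    rw [Real.exp_nat_mul]
    refine pow_le_pow_left₀ (by positivity) ?_ _
    have := Real.add_one_le_exp (ε ^ 2 / 16)
    linarith
  have h5 : ((ε ^ 2 / 32) ^ ⌊a / p n⌋₊)⁻¹ ≤ Real.exp (ε ^ 2 / 16 * n) := by
    rw [← Real.exp_log (show 0 < ε ^ 2 / 32 by positivity), ← Real.exp_nat_mul, ← Real.exp_neg]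
    exact Real.exp_le_exp.2 (by linarith)
  calc _ ≤ Real.exp (n * (ε ^ 2 / 16)) * Real.exp (ε ^ 2 / 16 * n) *
        Real.exp (-(ε ^ 2 / 4 * n)) := by gcongr
    _ = Real.exp (-(ε ^ 2 / 8 * n)) := by
        rw [← Real.exp_add, ← Real.exp_add]; congr 1; ring

end NearThreshold

end Asymptotics

/-! ### Choice of parameters and conclusion -/

section Main

lemma tendsto_ceil_mul_exp {c : ℝ} (hc : 0 < c) :
    Tendsto (fun n : ℕ => ((⌈n * Real.log n⌉₊ : ℕ) : ℝ) * Real.exp (-(c * (n / 4 - 2))))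
      atTop (𝓝 0) := by
  have h1 := ((tendsto_pow_mul_exp_neg 2 (c := c / 4) (by positivity)).comp
    (tendsto_natCast_atTop_atTop (R := ℝ))).const_mul (Real.exp (2 * c))
  rw [mul_zero] at h1
  refine squeeze_zero' (Eventually.of_forall fun n => by positivity) ?_ h1
  filter_upwards [eventually_gt_atTop 0] with n hn
  have hn : (1 : ℝ) ≤ n := by exact_mod_cast hn
  have h2 : ((⌈n * Real.log n⌉₊ : ℕ) : ℝ) ≤ (n : ℝ) ^ 2 := by
    have h3 := Real.log_le_sub_one_of_pos (show (0 : ℝ) < n by linarith)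
    have h4 := Nat.ceil_lt_add_one (mul_nonneg (Nat.cast_nonneg n) (Real.log_nonneg hn))
    nlinarith
  calc _ ≤ (n : ℝ) ^ 2 * Real.exp (-(c * (n / 4 - 2))) := by gcongr
    _ = Real.exp (2 * c) * ((n : ℝ) ^ 2 * Real.exp (-(c / 4 * n))) := by
      rw [show -(c * ((n : ℝ) / 4 - 2)) = 2 * c + -(c / 4 * n) by ring, Real.exp_add]; ring

lemma tendsto_one_sub_inv_pow :
    Tendsto (fun n : ℕ => (1 - 1 / (n : ℝ)) ^ ⌈n * Real.log n⌉₊) atTop (𝓝 0) := by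
  refine squeeze_zero' ?_ ?_ (Real.tendsto_exp_neg_atTop_nhds_zero.comp tendsto_log_natCast)
  · filter_upwards [eventually_gt_atTop 0] with n hn
    have hn : (1 : ℝ) ≤ n := by exact_mod_cast hn
    have : 1 / (n : ℝ) ≤ 1 := by rw [div_le_one (by linarith)]; exact hn
    exact pow_nonneg (by linarith) _
  · filter_upwards [eventually_gt_atTop 0] with n hn
    exact one_sub_inv_pow_le (by exact_mod_cast hn) (Nat.le_ceil _)

/-- The number of generations in which the set of wrong nodes dies out. -/
def generations (n : ℕ) : ℕ := ⌊2 * Real.log n / Real.log (Real.log n)⌋₊ + 1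

lemma generations_le : ∀ᶠ n : ℕ in atTop,
    (generations n : ℝ) ≤ 3 * (Real.log n / Real.log (Real.log n)) := by
  filter_upwards [tendsto_log_natCast.eventually_ge_atTop 1,
    tendsto_log_log_natCast.eventually_gt_atTop 0] with n h1 h2
  have h3 := Real.log_le_sub_one_of_pos (show 0 < Real.log n by linarith)
  have h4 : 1 ≤ Real.log n / Real.log (Real.log n) := by rw [one_le_div h2]; linarith
  have h5 := Nat.floor_le (show 0 ≤ 2 * Real.log n / Real.log (Real.log n) by positivity)
  rw [generations]
  push_cast
  rw [mul_div_assoc] at h5 ⊢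
  linarith

/-- An epoch of 2n log n rounds fails with probability at most n · n^(-2), small enough for a union
bound over the O(log n) epochs. -/
lemma tendsto_generations_mul :
    Tendsto (fun n : ℕ => 2 * (generations n : ℝ) *
      (n * (1 - 1 / (n : ℝ)) ^ ⌈2 * (n * Real.log n)⌉₊)) atTop (𝓝 0) := by
  have h1 := (tendsto_log_pow_div_natCast 1).const_mul 6
  rw [mul_zero] at h1
  have hq : ∀ᶠ n : ℕ in atTop, (0 : ℝ) ≤ 1 - 1 / (n : ℝ) := by
    filter_upwards [eventually_gt_atTop 0] with n hn
    have hn : (1 : ℝ) ≤ n := by exact_mod_cast hn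
    have : 1 / (n : ℝ) ≤ 1 := by rw [div_le_one (by linarith)]; exact hn
    linarith
  refine squeeze_zero' (hq.mono fun n hn => by positivity) ?_ h1
  filter_upwards [generations_le, eventually_gt_atTop 0, hq,
    tendsto_log_natCast.eventually_ge_atTop 1,
    tendsto_log_log_natCast.eventually_ge_atTop 1] with n h2 hn hq h3 h4
  have hn : (1 : ℝ) ≤ n := by exact_mod_cast hn
  have hn0 : (0 : ℝ) < n := by linarith
  have h5 : (1 - 1 / (n : ℝ)) ^ ⌈2 * (n * Real.log n)⌉₊ ≤ 1 / n * (1 / n) := by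
    refine (one_sub_inv_pow_le hn (a := 2 * Real.log n) ?_).trans (le_of_eq ?_)
    · exact le_trans (le_of_eq (by ring)) (Nat.le_ceil _)
    · rw [show -(2 * Real.log n) = -Real.log n + -Real.log n by ring, Real.exp_add, Real.exp_neg,
        Real.exp_log hn0, one_div]
  have h6 : (generations n : ℝ) ≤ 3 * Real.log n :=
    h2.trans (mul_le_mul_of_nonneg_left (div_le_self (by linarith) h4) (by norm_num))
  calc _ ≤ 2 * (3 * Real.log n) * (n * (1 / n * (1 / n))) := by gcongr
    _ = 6 * (Real.log n ^ 1 / n) := by field_simp; ring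

/-- Since d ≥ log n, the shrinking factor 25600/d is eventually at most (log n)^(-1/2). Raised to a
power of at least 2 log n / log log n, it is at most 1/n. -/
lemma NearThreshold.pow_generations_lt {ω p : ℕ → ℝ} (h : NearThreshold ω p) :
    ∀ᶠ n : ℕ in atTop,
      (2 * (12800 / (p n * n))) ^ generations n * (Real.exp (-20) * n) < 1 := by
  have hsq : Tendsto (fun n : ℕ => Real.exp (Real.log (Real.log n) / 2)) atTop atTop :=
    Real.tendsto_exp_atTop.comp (tendsto_log_log_natCast.atTop_div_const (by norm_num))
  filter_upwards [h.log_le, tendsto_log_natCast.eventually_ge_atTop 1,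
    tendsto_log_log_natCast.eventually_gt_atTop 0, hsq.eventually_ge_atTop 25600,
    eventually_gt_atTop 0] with n h1 h2 h3 h4 hn
  have hn : (0 : ℝ) < n := by exact_mod_cast hn
  set l := Real.log (Real.log n) with hl
  have h5 : 2 * (12800 / (p n * n)) ≤ Real.exp (-(l / 2)) := by
    rw [Real.exp_neg, ← mul_div_assoc, div_le_iff₀ (by linarith), inv_mul_eq_div,
      le_div_iff₀ (Real.exp_pos _)]
    have h6 : Real.exp (l / 2) * Real.exp (l / 2) = Real.log n := by
      rw [← Real.exp_add, add_halves, hl, Real.exp_log (by linarith)]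
    nlinarith
  have h7 : 2 * Real.log n / l ≤ generations n := by
    rw [generations]; push_cast; exact (Nat.lt_floor_add_one _).le
  rw [div_le_iff₀ h3] at h7
  have h8 : (2 * (12800 / (p n * n))) ^ generations n ≤ (n : ℝ)⁻¹ := by
    refine (pow_le_pow_left₀ (by have : 0 < p n * n := by linarith
                                 positivity) h5 _).trans ?_
    rw [← Real.exp_nat_mul, ← Real.exp_log (inv_pos.2 hn), Real.log_inv]
    exact Real.exp_le_exp.2 (by linarith)
  calc _ ≤ (n : ℝ)⁻¹ * (Real.exp (-20) * n) := by gcongr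
    _ = Real.exp (-20) := by field_simp
    _ < 1 := by rw [Real.exp_lt_one_iff]; norm_num

/-- The regimes contribute 1, 2 and 18 times the bound. The last number is 2 · 3 · 3: two epochs for
each pair of generations, at most 3 log n / log log n such pairs, and at most 3n log n rounds in an
epoch. -/
lemma NearThreshold.time_le {ω p : ℕ → ℝ} (h : NearThreshold ω p) {a : ℝ} (ha : 0 < a) :
    ∀ᶠ n : ℕ in atTop, ((⌊a / p n⌋₊ + (⌈n * Real.log n⌉₊ +
      2 * generations n * ⌈2 * (n * Real.log n)⌉₊) : ℕ) : ℝ) ≤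
        21 * (n * Real.log n ^ 2 / Real.log (Real.log n)) := by
  filter_upwards [(h.tendsto_floor_div ha).eventually_le_const one_pos, generations_le,
    tendsto_log_natCast.eventually_ge_atTop 1, tendsto_log_log_natCast.eventually_gt_atTop 0,
    eventually_gt_atTop 0] with n h1 h2 h3 h4 hn
  have hn : (1 : ℝ) ≤ n := by exact_mod_cast hn
  have hn0 : (0 : ℝ) < n := by linarith
  set L := Real.log n with hL
  set l := Real.log L with hl
  have hlL : l ≤ L := (Real.log_le_sub_one_of_pos (by linarith)).trans (by linarith)
  rw [div_le_one hn0] at h1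
  have hnL : (n : ℝ) ≤ n * L := le_mul_of_one_le_right hn0.le h3
  have h5 := (Nat.ceil_lt_add_one (show 0 ≤ (n : ℝ) * L by positivity)).le
  have h6 := (Nat.ceil_lt_add_one (show 0 ≤ 2 * ((n : ℝ) * L) by positivity)).le
  have h7 : (n : ℝ) * L ≤ n * L ^ 2 / l := by
    rw [le_div_iff₀ h4]
    calc (n : ℝ) * L * l ≤ n * L * L := by gcongr
      _ = n * L ^ 2 := by ring
  have h8 : 2 * (generations n : ℝ) * (⌈2 * (n * L)⌉₊ : ℕ) ≤ 18 * (n * L ^ 2 / l) := by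
    calc _ ≤ 2 * (3 * (L / l)) * (3 * (n * L)) := by gcongr; linarith
      _ = 18 * (n * L ^ 2 / l) := by ring
  push_cast
  linarith

/-- Above the connectivity threshold the failure probability tends to `0`. -/
lemma NearThreshold.eventually_real_le {ω : ℕ → ℝ} {p : ℕ → unitInterval}
    (h : NearThreshold ω fun n => p n) (δ : Set.Ioo (0 : ℝ) (1 / 2)) {r : ℝ} (hr : 0 < r) :
    ∀ᶠ n : ℕ in atTop, (jointLaw n (p n) δ).real
      (correctWithin n (21 * (n * Real.log n ^ 2 / Real.log (Real.log n))))ᶜ ≤ r := by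
  obtain ⟨hδ, hδ'⟩ := δ.2
  -- The Markov step leaves a failure probability proportional to ε that does not vanish with n, so
  -- ε is fitted to the target `r`; all other terms tend to 0.
  obtain ⟨ε, hε, hε', hεr⟩ : ∃ ε : ℝ, 0 < ε ∧ ε ≤ 1 / 80 ∧
      2 * ε / (Real.exp (-20) / 4) ≤ r / 2 := by
    refine ⟨min (1 / 80) (Real.exp (-20) / 4 * r / 4), by positivity, min_le_left _ _, ?_⟩
    rw [div_le_iff₀ (by positivity)]
    linarith [min_le_right (1 / 80) (Real.exp (-20) / 4 * r / 4)]
  -- Flooring may cost half, so p t₁ is only known to be at least a/2; the numerator 128 then gives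
  -- the 64 required for few weak nodes.
  obtain ⟨a, ha⟩ : ∃ a, a = 128 / ((δ : ℝ) / 16 * (δ / 32) ^ 2 * ε) := ⟨_, rfl⟩
  have hden : 0 < (δ : ℝ) / 16 * (δ / 32) ^ 2 * ε := by positivity
  have haden : a * ((δ : ℝ) / 16 * (δ / 32) ^ 2 * ε) = 128 := by
    rw [ha]; exact div_mul_cancel₀ _ hden.ne'
  have ha2 : 2 ≤ a := by
    rw [ha, le_div_iff₀ hden]
    have h1 : (δ : ℝ) / 16 * (δ / 32) ^ 2 * ε ≤ 1 * 1 ^ 2 * 1 := by gcongr <;> linarith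
    linarith
  have ha0 : 0 < a := by linarith
  -- Since p t₁ ≤ a and p t₀ ≥ δ/4, the value ηa = δ²/64 gives ηt₁ ≤ δt₀/16.
  obtain ⟨η, hη⟩ : ∃ η, η = (δ : ℝ) ^ 2 / (64 * a) := ⟨_, rfl⟩
  have hη0 : 0 < η := by rw [hη]; positivity
  have hηa : η * a = (δ : ℝ) ^ 2 / 64 := by rw [hη]; field_simp
  have hη' : η ≤ (δ : ℝ) / 16 := by nlinarith
  have hδ2 : 0 < (δ : ℝ) / 2 := by positivity
  have c1 := h.tendsto_exp_floor hδ2 (show 0 < η / 16 * (δ / 8) by positivity)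
  have c2 := h.tendsto_exp_floor ha0 (show 0 < ε / 2 * (δ / 32) by positivity)
  have c3 := tendsto_ceil_mul_exp (show 0 < ε / 2 by positivity)
  have c4 := tendsto_one_sub_inv_pow.div_const (Real.exp (-20) / 4)
  have c5 := tendsto_generations_mul
  have c6 := h.tendsto_atypical ha0 (show 0 < η / 4 by positivity)
  have c7 : Tendsto (fun n : ℕ => Real.exp (-(2 * (n : ℝ)))) atTop (𝓝 0) :=
    Real.tendsto_exp_neg_atTop_nhds_zero.comp
      (tendsto_natCast_atTop_atTop.const_mul_atTop (by norm_num))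
  have c8 : Tendsto (fun n : ℕ => 1 / (n : ℝ)) atTop (𝓝 0) := tendsto_one_div_atTop_nhds_zero_nat
  have c9 := h.tendsto_small.div_const (Real.exp (-20) / 4)
  have key := ((((((((((c1.add c2).add c3).add c4).add c5).add c6).add c7).add c8).add
    h.tendsto_isolated).add h.tendsto_scattered).add c9)
  simp only [zero_div, add_zero] at key
  filter_upwards [key.eventually_le_const (half_pos hr), h.pos, h.time_le ha0,
    h.pow_generations_lt, h.tendsto_deg.eventually_ge_atTop 25600,
    h.tendsto_zero.eventually_le_const (show 0 < (δ : ℝ) / 4 by positivity),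
    (h.tendsto_floor_div ha0).eventually_le_const (show 0 < η / 12 by positivity),
    (h.tendsto_floor ha0).eventually_ge_atTop (4 / ((δ : ℝ) / 32) / (δ / 16)),
    eventually_gt_atTop 0] with n hkey hp htime hgen hdeg hp' hfd hfl hn
  obtain ⟨m, rfl⟩ : ∃ m, n = m + 1 := ⟨n - 1, by omega⟩
  set P : ℝ := (p (m + 1) : ℝ) with hP
  have ht₀ : P * (⌊(δ : ℝ) / 2 / P⌋₊ : ℕ) ≤ δ / 2 := by
    have := Nat.floor_le (show 0 ≤ (δ : ℝ) / 2 / P by positivity)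
    rw [le_div_iff₀ hp] at this
    linarith
  have ht₀' : (δ : ℝ) / 4 ≤ P * (⌊(δ : ℝ) / 2 / P⌋₊ : ℕ) := by
    have := (Nat.lt_floor_add_one ((δ : ℝ) / 2 / P)).le
    rw [div_le_iff₀ hp] at this
    linarith
  have ht₁ : P * (⌊a / P⌋₊ : ℕ) ≤ a := by
    have := Nat.floor_le (show 0 ≤ a / P by positivity)
    rw [le_div_iff₀ hp] at this
    linarith
  have ht₁' : a / 2 ≤ P * (⌊a / P⌋₊ : ℕ) := by
    have := (Nat.lt_floor_add_one (a / P)).le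
    rw [div_le_iff₀ hp] at this
    linarith
  -- The loss budget η receives three quarters: `εA`, 4θ and eventually 3t₁/n are each at most η/4.
  refine (jointLaw_real_not_correctWithin_le m (p (m + 1)) δ (N := (m + 1 : ℕ))
    (d := P * (m + 1 : ℕ)) (εA := η / 4) (x := (η / 4) ^ 2 / 32) (η := η) (θ := η / 16) (ε := ε)
    (t₀ := ⌊(δ : ℝ) / 2 / P⌋₊) (t₁ := ⌊a / P⌋₊) rfl rfl hdeg (by positivity) (by linarith)
    (by positivity) (by nlinarith) (Nat.floor_le_floor (by gcongr; linarith)) ht₀ (by positivity)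
    (by linarith) ?_ hη' ?_ hε hε' ?_ ?_ hgen htime).trans ?_
  · rw [mul_div_assoc]; linarith
  · refine le_of_mul_le_mul_left ?_ hp
    calc P * (η * (⌊a / P⌋₊ : ℕ)) = η * (P * (⌊a / P⌋₊ : ℕ)) := by ring
      _ ≤ η * a := by gcongr
      _ = δ * (δ / 4) / 16 := by rw [hηa]; ring
      _ ≤ δ * (P * (⌊(δ : ℝ) / 2 / P⌋₊ : ℕ)) / 16 := by gcongr
      _ = P * (δ * (⌊(δ : ℝ) / 2 / P⌋₊ : ℕ) / 16) := by ring
  · rwa [div_le_iff₀ (by positivity), mul_comm] at hfl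
  · calc (64 : ℝ) = a / 2 * ((δ : ℝ) / 16 * (δ / 32) ^ 2 * ε) := by linarith
      _ ≤ P * (⌊a / P⌋₊ : ℕ) * ((δ : ℝ) / 16 * (δ / 32) ^ 2 * ε) := by gcongr
      _ = P * (δ / 16 * (⌊a / P⌋₊ : ℕ)) * ((δ : ℝ) / 32) ^ 2 * ε := by ring
  · rw [show η / 16 * ((δ : ℝ) * (⌊(δ : ℝ) / 2 / P⌋₊ : ℕ) / 8) =
      η / 16 * (δ / 8) * (⌊(δ : ℝ) / 2 / P⌋₊ : ℕ) by ring,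
      show ε / 2 * ((δ : ℝ) / 32 * (⌊a / P⌋₊ : ℕ)) = ε / 2 * (δ / 32) * (⌊a / P⌋₊ : ℕ) by ring,
      add_div]
    linarith

end Main

end

end MajorityDynamics

theorem theorem2 :
    ∃ K : ℝ, 0 < K ∧
      ∀ (δ : Set.Ioo (0 : ℝ) (1 / 2)), (δ : ℝ) ≤ 1 / 10 →
      ∀ (ω : ℕ → ℝ), Tendsto ω atTop atTop →
        (ω =o[atTop] fun n : ℕ => Real.log (Real.log n)) →
      ∀ (p : ℕ → unitInterval),
        (∀ᶠ n : ℕ in atTop, (Real.log n + ω n) / n ≤ (p n : ℝ) ∧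
          (p n : ℝ) ≤ ω n * Real.log n / n) →
        Tendsto (fun n : ℕ => MajorityDynamics.jointLaw n (p n) δ
            (MajorityDynamics.correctWithin n
              (K * (n * Real.log n ^ 2 / Real.log (Real.log n)))))
          atTop (𝓝 1) := by
  refine ⟨21, by norm_num, fun δ _ ω hω hω' p hp => ?_⟩
  have h := MajorityDynamics.nearThreshold_of_isLittleO hω hω' hp
  set A : (n : ℕ) → Set (SimpleGraph (Fin n) × (Fin n → Bool) × (ℕ → Fin n)) := fun n =>
    MajorityDynamics.correctWithin n (21 * (n * Real.log n ^ 2 / Real.log (Real.log n))) with hA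
  have h0 : Tendsto (fun n => MajorityDynamics.jointLaw n (p n) δ (A n)ᶜ) atTop (𝓝 0) := by
    rw [ENNReal.tendsto_nhds_zero]
    intro r hr
    rcases eq_or_ne r ⊤ with rfl | hr'
    · exact Eventually.of_forall fun _ => le_top
    filter_upwards [h.eventually_real_le δ (ENNReal.toReal_pos hr.ne' hr'),
      eventually_gt_atTop 0] with n hn hn0
    obtain ⟨m, rfl⟩ : ∃ m, n = m + 1 := ⟨n - 1, by omega⟩
    exact (ENNReal.toReal_le_toReal (measure_ne_top _ _) hr').1 hn
  have h1 : Tendsto (fun n => 1 - MajorityDynamics.jointLaw n (p n) δ (A n)ᶜ) atTop (𝓝 1) := by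
    simpa using ENNReal.Tendsto.sub tendsto_const_nhds h0 (Or.inl ENNReal.one_ne_top)
  refine tendsto_of_tendsto_of_tendsto_of_le_of_le' h1 tendsto_const_nhds ?_ ?_
  · filter_upwards [eventually_gt_atTop 0] with n hn0
    obtain ⟨m, rfl⟩ : ∃ m, n = m + 1 := ⟨n - 1, by omega⟩
    -- Subadditivity over the event and its complement gives the lower bound without measurability
    -- of the event.
    rw [tsub_le_iff_right, ← measure_univ (μ := MajorityDynamics.jointLaw (m + 1) (p (m + 1)) δ),
      ← Set.union_compl_self (A (m + 1))]
    exact measure_union_le _ _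
  · filter_upwards [eventually_gt_atTop 0] with n hn0
    obtain ⟨m, rfl⟩ : ∃ m, n = m + 1 := ⟨n - 1, by omega⟩
    exact prob_le_one
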